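/- **Conventions.** A 2-category is strict; 2-functors, 2-natural transformations and 2-natural isomorphisms are the strict ones; $\circ$ denotes composition of 1-cells in the order of functions, vertical composition of 2-cells is written by juxtaposition, and the identity 2-cell of a 1-cell is denoted by that 1-cell. $\mathbf{Cat}$ denotes 2-categories of (possibly large) categories. Let $\Delta$ be the category of all finite ordinals $n=\{0,\dots,n-1\}$ ($n\ge 0$) and monotone functions, with the ordinal sum $+$, and let $\boldsymbol\Delta$ be the 2-category with one 0-cell $*$, whose 1-cells and 2-cells are the objects and morphisms of $\Delta$, and whose composition of 1-cells (and horizontal composition of 2-cells) is $g\circ f=g+f$. Let $\Pi_l$ (the left partial simplicial category) have the same objects, its morphisms $m\to n$ being the partial monotone functions whose domain is an initial segment of $m$, with composition of partial functions. The weight $W_l:\boldsymbol\Delta\to\mathbf{Cat}$ is the action of $\Delta$ on $\Pi_l$ by tensoring on the left: $W_l(*)=\Pi_l$, $W_l(n)=n+(-)$, $W_l(f)=f+(-)$. Let $\mathcal D$ be a 2-category and $(C,T,\eta,\mu)$ a monad in $\mathcal D$. A 2-functor $\mathbf T:\boldsymbol\Delta\to\mathcal D$ *corresponds* to $T$ if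 $(\mathbf T(*),\mathbf T(1),\mathbf T(0\to 1),\mathbf T(2\to 1))=(C,T,\eta,\mu)$. * $\mathrm{Cone}_{W}(\mathbf T):\mathcal D^{op}\to\mathbf{Cat}$, for a 2-functor $W:\boldsymbol\Delta\to\mathbf{Cat}$, sends $X$ to the category of 2-natural transformations $W\to\mathcal D(X,\mathbf T(-))$ and modifications, and acts on 1-cells and 2-cells by composition. A *$W$-weighted limit* of $\mathbf T$ is a 0-cell $L$ for which there is a 2-natural isomorphism $\mathcal D(-,L)\cong\mathrm{Cone}_W(\mathbf T)$. * $\mathrm{Mnd}(\mathcal D)$ is the 2-category of monads in $\mathcal D$. Its 1-cells $(B,S,\eta,\mu)\to(C,T,\eta,\mu)$ are the lax morphisms: pairs $(F,\varphi)$ with $F:B\to C$ and $\varphi:T\circ F\Rightarrow F\circ S$ such that $\varphi\,(\eta\circ F)=F\circ\eta$ and $\varphi\,(\mu\circ F)=(F\circ\mu)(\varphi\circ S)(T\circ\varphi)$. Its 2-cells $(F,\varphi)\to(F',\varphi')$ are the 2-cells $\tau:F\Rightarrow F'$ with $\varphi'(T\circ\tau)=(\tau\circ S)\varphi$. Let $\iota:\mathcal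 D\to\mathrm{Mnd}(\mathcal D)$ send $X$ to the identity monad on $X$. An *Eilenberg–Moore object* of $T$ is a 0-cell $E$ for which there is a 2-natural isomorphism $\mathcal D(-,E)\cong\mathrm{Mnd}(\iota(-),T)$. * $\mathrm{Subeq}_T:\mathcal D^{op}\to\mathbf{Cat}$ sends $X$ to the category of pairs $(U:X\to C,\ \xi:T\circ U\Rightarrow U)$ with $\xi\,(\eta\circ U)=U$ and $\xi\,(T\circ\xi)=\xi\,(\mu\circ U)$, a morphism $(U,\xi)\to(U',\xi')$ being a 2-cell $\tau:U\Rightarrow U'$ with $\tau\,\xi=\xi'\,(T\circ\tau)$; it acts on 1-cells and 2-cells by composition. **Theorem.** Let $(C,T,\eta,\mu)$ be a monad in a 2-category $\mathcal D$. There is a 2-functor $\boldsymbol\Delta\to\mathcal D$ corresponding to $T$, and for every 2-functor $\mathbf T:\boldsymbol\Delta\to\mathcal D$ corresponding to $T$: 1. $T$ admits an Eilenberg–Moore object if and only if $\mathbf T$ has a $W_l$-weighted limit; 2. every Eilenberg–Moore object of $T$ is isomorphic in $\mathcal D$ to every $W_l$-weighted limit of $\mathbf T$; 3. there are 2-natural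 isomorphisms $\mathrm{Cone}_{W_l}(\mathbf T)\cong\mathrm{Subeq}_T\cong\mathrm{Mnd}(\iota(-),T)$. -/

import Mathlib

open CategoryTheory

universe w v u w₁ v₁ u₁ w₂ v₂ u₂ w₃ v₃ u₃

attribute [-instance] CategoryTheory.catToReflQuiver

namespace EilenbergMoore

/-! ### The simplicial category `Δ` and the one-object 2-category `𝚫` -/

/-- An object of the (algebraists') simplicial category: the finite linear order
`{0, …, len - 1}`, with `len = 0` allowed. -/
@[ext]
structure Simp : Type where
  len : ℕ

namespace Simp

/-- Morphisms are monotone functions. -/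
instance : Category.{0} Simp where
  Hom m n := Fin m.len →o Fin n.len
  id _ := OrderHom.id
  comp f g := g.comp f

/-- The underlying monotone function. -/
def fn {m n : Simp} (f : m ⟶ n) : Fin m.len →o Fin n.len := f

/-- Ordinal sum on objects. -/
def add (m n : Simp) : Simp := ⟨m.len + n.len⟩

/-- Ordinal sum on morphisms: `f` on the first block, `g` on the second. -/
def addHom {m m' n n' : Simp} (f : m ⟶ m') (g : n ⟶ n') : add m n ⟶ add m' n' :=
  show Fin (m.len + n.len) →o Fin (m'.len + n'.len) from
  { toFun := Fin.addCases (fun i => Fin.castAdd n'.len (fn f i)) (fun j => Fin.natAdd m'.len (fn g j))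
    monotone' := by
      intro i j
      induction i using Fin.addCases with
      | left i =>
        induction j using Fin.addCases with
        | left j =>
          intro h
          simp only [Fin.addCases_left]
          exact (fn f).monotone h
        | right j =>
          intro _
          simp only [Fin.addCases_left, Fin.addCases_right, Fin.le_def, Fin.val_castAdd, Fin.val_natAdd]
          omega
      | right i =>
        induction j using Fin.addCases with
        | left j =>
          intro h
          simp only [Fin.le_def, Fin.val_castAdd, Fin.val_natAdd] at h
          omega
        | right j =>
          intro h
          simp only [Fin.addCases_right, Fin.le_def, Fin.val_natAdd] at h ⊢
          have : (fn g) i ≤ (fn g) j := (fn g).monotone (by rw [Fin.le_def]; omega)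
          rw [Fin.le_def] at this
          omega }

theorem hom_ext {m n : Simp} {f g : m ⟶ n} (h : ∀ i, (fn f i).val = (fn g i).val) : f = g :=
  OrderHom.ext _ _ (funext fun i => Fin.ext (h i))

theorem fn_id {m : Simp} (i) : fn (𝟙 m) i = i := rfl

theorem fn_comp {m n k : Simp} (f : m ⟶ n) (g : n ⟶ k) (i) : fn (f ≫ g) i = fn g (fn f i) := rfl

theorem fn_eqToHom {m n : Simp} (h : m = n) (i) : (fn (eqToHom h) i).val = i.val := by
  subst h; rfl

theorem fn_addHom_val {m m' n n' : Simp} (f : m ⟶ m') (g : n ⟶ n') (i : Fin (add m n).len) :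
    (fn (addHom f g) i).val =
      if h : i.val < m.len then (fn f ⟨i.val, h⟩).val
      else m'.len + (fn g ⟨i.val - m.len, by have := i.is_lt; simp only [add] at this; omega⟩).val := by
  change Fin (m.len + n.len) at i
  induction i using Fin.addCases with
  | left i =>
    simp only [Fin.val_castAdd, Fin.is_lt, dif_pos]
    show (Fin.addCases (motive := fun _ => Fin (m'.len + n'.len)) _ _ (Fin.castAdd n.len i)).val = _
    rw [Fin.addCases_left]; rfl
  | right i =>
    simp only [Fin.val_natAdd]
    rw [dif_neg (by omega)]
    show (Fin.addCases (motive := fun _ => Fin (m'.len + n'.len)) _ _ (Fin.natAdd m.len i)).val = _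
    rw [Fin.addCases_right]
    simp

theorem fn_congr {m n : Simp} (f : m ⟶ n) {i j : Fin m.len} (h : i.val = j.val) :
    (fn f i).val = (fn f j).val := by rw [Fin.ext h]

theorem addHom_id (m n : Simp) : addHom (𝟙 m) (𝟙 n) = 𝟙 (add m n) := by
  apply hom_ext; intro i
  rw [fn_addHom_val]
  simp only [fn_id]
  split_ifs <;> omega

theorem addHom_comp {m m' m'' n n' n'' : Simp} (f : m ⟶ m') (f' : m' ⟶ m'') (g : n ⟶ n')
    (g' : n' ⟶ n'') : addHom (f ≫ f') (g ≫ g') = addHom f g ≫ addHom f' g' := by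
  apply hom_ext; intro i
  rw [fn_comp, fn_addHom_val, fn_addHom_val]
  simp only [fn_comp]
  by_cases h : i.val < m.len
  · have e : (fn (addHom f g) i).val = (fn f ⟨i.val, h⟩).val := by rw [fn_addHom_val, dif_pos h]
    rw [dif_pos h, dif_pos (by rw [e]; exact Fin.is_lt _)]
    exact fn_congr _ e.symm
  · have e : (fn (addHom f g) i).val = m'.len + (fn g ⟨i.val - m.len, by
        have : i.val < m.len + n.len := i.is_lt
        omega⟩).val := by rw [fn_addHom_val, dif_neg h]
    rw [dif_neg h, dif_neg (by rw [e]; omega)]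
    congr 1
    apply fn_congr
    simp only [e]
    omega

theorem add_assoc' (m n k : Simp) : add (add m n) k = add m (add n k) :=
  Simp.ext (Nat.add_assoc _ _ _)
theorem add_zero' (m : Simp) : add m ⟨0⟩ = m := rfl
theorem zero_add' (m : Simp) : add ⟨0⟩ m = m := Simp.ext (Nat.zero_add _)

theorem addHom_assoc {m m' n n' k k' : Simp} (f : m ⟶ m') (g : n ⟶ n') (h : k ⟶ k') :
    addHom (addHom f g) h =
      eqToHom (add_assoc' m n k) ≫ addHom f (addHom g h) ≫ eqToHom (add_assoc' m' n' k').symm := by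
  apply hom_ext; intro i
  have hi : i.val < m.len + n.len + k.len := i.is_lt
  have e := fn_eqToHom (add_assoc' m n k) i
  rw [fn_comp, fn_comp, fn_eqToHom, fn_addHom_val, fn_addHom_val]
  by_cases h1 : i.val < m.len
  · rw [dif_pos (by simp only [add]; omega), dif_pos (by omega), fn_addHom_val, dif_pos h1]
    exact fn_congr _ e.symm
  · rw [dif_neg (c := (fn (eqToHom (add_assoc' m n k)) i).val < m.len) (by omega), fn_addHom_val]
    by_cases h2 : i.val < m.len + n.len
    · rw [dif_pos (by simp only [add]; omega), dif_pos (by simp only []; omega), fn_addHom_val, dif_neg h1]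
      congr 1
      apply fn_congr
      simp only [e]
    · rw [dif_neg (by simp only [add]; omega), dif_neg (by simp only []; omega)]
      have e' : (fn h ⟨i.val - (add m n).len, by simp only [add]; omega⟩).val =
          (fn h ⟨(fn (eqToHom (add_assoc' m n k)) i).val - m.len - n.len, by omega⟩).val := by
        apply fn_congr
        show i.val - (m.len + n.len) =
          (fn (eqToHom (add_assoc' m n k)) i).val - m.len - n.len
        rw [e, Nat.sub_sub]
      rw [e']
      exact Nat.add_assoc _ _ _

theorem addHom_assoc_symm {m m' n n' k k' : Simp} (f : m ⟶ m') (g : n ⟶ n') (h : k ⟶ k') :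
    addHom f (addHom g h) =
      eqToHom (add_assoc' m n k).symm ≫ addHom (addHom f g) h ≫ eqToHom (add_assoc' m' n' k') := by
  simp [addHom_assoc]

theorem addHom_zero {m m' : Simp} (f : m ⟶ m') :
    addHom f (𝟙 (⟨0⟩ : Simp)) = eqToHom (add_zero' m) ≫ f ≫ eqToHom (add_zero' m').symm := by
  apply hom_ext; intro i
  have hi : i.val < m.len + 0 := i.is_lt
  rw [fn_comp, fn_comp, fn_eqToHom, fn_addHom_val, dif_pos (by omega)]
  exact fn_congr _ (fn_eqToHom _ _).symm

theorem zero_addHom {m m' : Simp} (f : m ⟶ m') :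
    addHom (𝟙 (⟨0⟩ : Simp)) f = eqToHom (zero_add' m) ≫ f ≫ eqToHom (zero_add' m').symm := by
  apply hom_ext; intro i
  rw [fn_comp, fn_comp, fn_eqToHom, fn_addHom_val, dif_neg (by simp only []; omega)]
  rw [Nat.zero_add]
  exact fn_congr _ (fn_eqToHom (zero_add' m) i).symm

theorem addHom_eqToHom {m m' n n' : Simp} (h : m = m') (k : n = n') :
    addHom (eqToHom h) (eqToHom k) = eqToHom (by rw [h, k]) := by
  subst h k; exact addHom_id _ _

end Simp

/-- The 2-category `𝚫`: one 0-cell, with `Δ` as its category of 1-cells and 2-cells, the ordinal sum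
being the composition. The composite of `f` followed by `g` is `g + f`, so that for a 2-functor `𝐓`
on `𝚫` one has `𝐓(g + f) = 𝐓(g) ∘ 𝐓(f)`. -/
inductive Del : Type
  | star

namespace Del

open Simp

instance : CategoryStruct.{0} Del where
  Hom _ _ := Simp
  id _ := ⟨0⟩
  comp f g := Simp.add g f

instance (a b : Del) : Category.{0} (a ⟶ b) := inferInstanceAs (Category Simp)

theorem assoc' {a b c d : Del} (f : a ⟶ b) (g : b ⟶ c) (h : c ⟶ d) :
    (f ≫ g) ≫ h = f ≫ g ≫ h := Simp.ext (Nat.add_assoc _ _ _).symm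
theorem id_comp' {a b : Del} (f : a ⟶ b) : 𝟙 a ≫ f = f := Simp.ext (Nat.add_zero _)
theorem comp_id' {a b : Del} (f : a ⟶ b) : f ≫ 𝟙 b = f := Simp.ext (Nat.zero_add _)

instance : Bicategory.{0} Del where
  whiskerLeft f _ _ η := Simp.addHom η (𝟙 (f : Simp))
  whiskerRight η h := Simp.addHom (𝟙 (h : Simp)) η
  associator f g h := eqToIso (assoc' f g h)
  leftUnitor f := eqToIso (id_comp' f)
  rightUnitor f := eqToIso (comp_id' f)
  whiskerLeft_id f g := Simp.addHom_id _ _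
  whiskerLeft_comp f _ _ _ η θ := by
    rw [← Simp.addHom_comp, Category.comp_id]
  id_whiskerLeft η := Simp.addHom_zero η
  comp_whiskerLeft f g _ _ η :=
    (congrArg (Simp.addHom η) (Simp.addHom_id g f).symm).trans (Simp.addHom_assoc_symm η (𝟙 _) (𝟙 _))
  id_whiskerRight f g := Simp.addHom_id _ _
  comp_whiskerRight η θ i := by
    rw [← Simp.addHom_comp, Category.comp_id]
  whiskerRight_id η := Simp.zero_addHom η
  whiskerRight_comp η g h :=
    (congrArg (Simp.addHom · η) (Simp.addHom_id h g).symm).trans (Simp.addHom_assoc (𝟙 _) (𝟙 _) η)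
  whisker_assoc f _ _ η h := Simp.addHom_assoc_symm (𝟙 _) η (𝟙 _)
  whisker_exchange η θ := by
    rw [← Simp.addHom_comp, ← Simp.addHom_comp]
    simp
  pentagon f g h i := by
    have e1 := Simp.addHom_eqToHom (rfl : (i : Simp) = i) (assoc' f g h)
    have e2 := Simp.addHom_eqToHom (assoc' g h i) (rfl : (f : Simp) = f)
    rw [eqToHom_refl] at e1 e2
    refine (congrArg₂ (fun x y => x ≫ _ ≫ y) e1 e2).trans ?_
    simp only [eqToIso.hom]
    exact (congrArg (_ ≫ ·) (eqToHom_trans _ _)).trans ((eqToHom_trans _ _).trans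
      (eqToHom_trans _ _).symm)
  triangle f g := by
    have e1 := Simp.addHom_eqToHom (rfl : (g : Simp) = g) (comp_id' f)
    have e2 := Simp.addHom_eqToHom (id_comp' g) (rfl : (f : Simp) = f)
    rw [eqToHom_refl] at e1 e2
    refine (congrArg (_ ≫ ·) e2).trans (Eq.trans ?_ e1.symm)
    exact eqToHom_trans (assoc' f (𝟙 _) g) _

instance : Bicategory.Strict Del where
  id_comp := id_comp'
  comp_id := comp_id'
  assoc := assoc'

end Del

/-! ### The left partial simplicial category `Π_l` and the weight `W_l` -/

/-- An object of the partial simplicial category: the finite linear order `{0, …, len - 1}`. -/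
@[ext]
structure PiL : Type where
  len : ℕ

namespace PiL

/-- A morphism of the left partial simplicial category: a partial monotone function (`none` meaning
undefined) such that whenever it is defined at `j`, it is defined at every `i ≤ j`. -/
@[ext]
structure Hom (m n : PiL) : Type where
  toFun : Fin m.len → Option (Fin n.len)
  monotone : ∀ i j a b, i ≤ j → toFun i = some a → toFun j = some b → a ≤ b
  defined_of_le : ∀ i j, i ≤ j → (toFun j).isSome → (toFun i).isSome

/-- Composition is the composition of partial functions. -/
instance : Category.{0} PiL where
  Hom := Hom
  id m :=
    { toFun := some
      monotone := by
        intro i j a b h ha hb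
        cases ha; cases hb; exact h
      defined_of_le := fun _ _ _ _ => rfl }
  comp {m n k} f g :=
    { toFun := fun i => (f.toFun i).bind g.toFun
      monotone := by
        intro i j a b h ha hb
        obtain ⟨x, hx, hx'⟩ := Option.bind_eq_some_iff.1 ha
        obtain ⟨y, hy, hy'⟩ := Option.bind_eq_some_iff.1 hb
        exact g.monotone x y a b (f.monotone i j x y h hx hy) hx' hy'
      defined_of_le := by
        intro i j h hj
        obtain ⟨b, hb⟩ := Option.isSome_iff_exists.1 hj
        obtain ⟨y, hy, hy'⟩ := Option.bind_eq_some_iff.1 hb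
        obtain ⟨x, hx⟩ := Option.isSome_iff_exists.1 (f.defined_of_le i j h (by rw [hy]; rfl))
        rw [hx]
        exact g.defined_of_le x y (f.monotone i j x y h hx hy) (by rw [hy']; rfl) }
  id_comp _ := rfl
  comp_id f := Hom.ext (funext fun i => Option.bind_fun_some (f.toFun i))
  assoc _ _ _ := Hom.ext (funext fun _ => Option.bind_assoc _ _ _)

/-- The underlying partial function. -/
def fn {m n : PiL} (f : m ⟶ n) : Fin m.len → Option (Fin n.len) := Hom.toFun f

/-- The object `m + k` for `m` in `Δ` and `k` in `Π_l`. -/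
def act (m : Simp) (k : PiL) : PiL := ⟨m.len + k.len⟩

/-- The partial function underlying `f + g`: `f` on the first block, `g` on the second. -/
def actFun {m m' : Simp} {k k' : PiL} (f : m ⟶ m') (g : k ⟶ k') :
    Fin (m.len + k.len) → Option (Fin (m'.len + k'.len)) :=
  Fin.addCases (fun i => some (Fin.castAdd k'.len (Simp.fn f i)))
    (fun j => (fn g j).map (Fin.natAdd m'.len))

theorem actFun_left {m m' : Simp} {k k' : PiL} (f : m ⟶ m') (g : k ⟶ k') (i : Fin m.len) :
    actFun f g (Fin.castAdd k.len i) = some (Fin.castAdd k'.len (Simp.fn f i)) := by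
  simp only [actFun, Fin.addCases_left]

theorem actFun_right {m m' : Simp} {k k' : PiL} (f : m ⟶ m') (g : k ⟶ k') (j : Fin k.len) :
    actFun f g (Fin.natAdd m.len j) = (fn g j).map (Fin.natAdd m'.len) := by
  simp only [actFun, Fin.addCases_right]

theorem actFun_monotone {m m' : Simp} {k k' : PiL} (f : m ⟶ m') (g : k ⟶ k')
    (i j : Fin (m.len + k.len)) (a b : Fin (m'.len + k'.len)) (h : i ≤ j)
    (ha : actFun f g i = some a) (hb : actFun f g j = some b) : a ≤ b := by
  induction i using Fin.addCases with
  | left i =>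
    rw [actFun_left] at ha
    cases ha
    induction j using Fin.addCases with
    | left j =>
      rw [actFun_left] at hb
      cases hb
      exact (Simp.fn f).monotone h
    | right j =>
      rw [actFun_right] at hb
      obtain ⟨y, _, rfl⟩ := Option.map_eq_some_iff.1 hb
      simp only [Fin.le_def, Fin.val_castAdd, Fin.val_natAdd]
      omega
  | right i =>
    rw [actFun_right] at ha
    obtain ⟨x, hx, rfl⟩ := Option.map_eq_some_iff.1 ha
    induction j using Fin.addCases with
    | left j =>
      simp only [Fin.le_def, Fin.val_castAdd, Fin.val_natAdd] at h
      omega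
    | right j =>
      rw [actFun_right] at hb
      obtain ⟨y, hy, rfl⟩ := Option.map_eq_some_iff.1 hb
      simp only [Fin.le_def, Fin.val_natAdd] at h ⊢
      have := Hom.monotone g i j x y (by rw [Fin.le_def]; omega) hx hy
      rw [Fin.le_def] at this
      omega

theorem actFun_defined {m m' : Simp} {k k' : PiL} (f : m ⟶ m') (g : k ⟶ k')
    (i j : Fin (m.len + k.len)) (h : i ≤ j) (hj : (actFun f g j).isSome) :
    (actFun f g i).isSome := by
  induction i using Fin.addCases with
  | left i => rw [actFun_left]; rfl
  | right i =>
    induction j using Fin.addCases with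
    | left j =>
      simp only [Fin.le_def, Fin.val_castAdd, Fin.val_natAdd] at h
      omega
    | right j =>
      rw [actFun_right, Option.isSome_map] at hj ⊢
      simp only [Fin.le_def, Fin.val_natAdd] at h
      exact Hom.defined_of_le g i j (by rw [Fin.le_def]; omega) hj

/-- The morphism `f + g` for `f` in `Δ` and `g` in `Π_l`. -/
def actHom {m m' : Simp} {k k' : PiL} (f : m ⟶ m') (g : k ⟶ k') : act m k ⟶ act m' k' :=
  Hom.mk (actFun f g) (actFun_monotone f g) (actFun_defined f g)

/-- The partial function underlying a morphism, on natural numbers. -/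
def val {m n : PiL} (f : m ⟶ n) (i : ℕ) : Option ℕ :=
  if h : i < m.len then (fn f ⟨i, h⟩).map Fin.val else none

theorem hom_ext {m n : PiL} {f g : m ⟶ n} (h : ∀ i, i < m.len → val f i = val g i) : f = g := by
  apply Hom.ext
  funext i
  have := h i.val i.is_lt
  simp only [val, dif_pos i.is_lt] at this
  exact Option.map_injective Fin.val_injective this

theorem val_id {m : PiL} {i : ℕ} (h : i < m.len) : val (𝟙 m) i = some i := by
  simp only [val, dif_pos h]; rfl

theorem val_comp {m n k : PiL} (f : m ⟶ n) (g : n ⟶ k) (i : ℕ) :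
    val (f ≫ g) i = (val f i).bind (val g) := by
  unfold val
  split
  · next h =>
    show ((fn f ⟨i, h⟩).bind (fn g)).map Fin.val = _
    cases fn f ⟨i, h⟩ with
    | none => rfl
    | some a => simp
  · rfl

theorem val_eqToHom {m n : PiL} (e : m = n) {i : ℕ} (h : i < m.len) :
    val (eqToHom e) i = some i := by
  subst e; exact val_id h

theorem val_lt {m n : PiL} (f : m ⟶ n) {i a : ℕ} (h : val f i = some a) : a < n.len := by
  unfold val at h
  split at h
  · obtain ⟨x, _, rfl⟩ := Option.map_eq_some_iff.1 h
    exact x.is_lt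
  · cases h

theorem val_conj {m n m' n' : PiL} (e : m' = m) (f : m ⟶ n) (e' : n = n') (i : ℕ) :
    val (eqToHom e ≫ f ≫ eqToHom e') i = val f i := by
  subst e e'; simp

theorem val_actHom_left {m m' : Simp} {k k' : PiL} (f : m ⟶ m') (g : k ⟶ k') {i : ℕ}
    (h : i < m.len) : val (actHom f g) i = some (Simp.fn f ⟨i, h⟩).val := by
  have h' : i < (act m k).len := Nat.lt_add_right _ h
  simp only [val, dif_pos h']
  exact congrArg (Option.map Fin.val) (actFun_left f g ⟨i, h⟩)

theorem val_actHom_right {m m' : Simp} {k k' : PiL} (f : m ⟶ m') (g : k ⟶ k') (j : ℕ) :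
    val (actHom f g) (m.len + j) = (val g j).map (m'.len + ·) := by
  by_cases h : j < k.len
  · have h' : m.len + j < (act m k).len := Nat.add_lt_add_left h _
    simp only [val, dif_pos h', dif_pos h]
    refine (congrArg (Option.map Fin.val) (actFun_right f g ⟨j, h⟩)).trans ?_
    rw [Option.map_map, Option.map_map]
    rfl
  · have h' : ¬ m.len + j < (act m k).len := by
      simp only [act]; omega
    simp only [val, dif_neg h', dif_neg h]
    rfl

/-- Induction over the two blocks. -/
theorem block {m : Simp} {k : PiL} {P : ℕ → Prop} (h₁ : ∀ i, i < m.len → P i)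
    (h₂ : ∀ j, j < k.len → P (m.len + j)) (i : ℕ) (hi : i < (act m k).len) : P i := by
  by_cases h : i < m.len
  · exact h₁ i h
  · have := h₂ (i - m.len) (by simp only [act] at hi; omega)
    rwa [Nat.add_sub_cancel' (Nat.le_of_not_lt h)] at this

theorem actHom_id (m : Simp) (k : PiL) : actHom (𝟙 m) (𝟙 k) = 𝟙 (act m k) := by
  apply hom_ext
  apply block
  · intro i h
    rw [val_actHom_left _ _ h, val_id (m := act m k) (Nat.lt_add_right _ h)]
    rfl
  · intro j h
    rw [val_actHom_right, val_id h, val_id (m := act m k) (Nat.add_lt_add_left h _)]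
    rfl

theorem actHom_comp {m m' m'' : Simp} {k k' k'' : PiL} (f : m ⟶ m') (f' : m' ⟶ m'') (g : k ⟶ k')
    (g' : k' ⟶ k'') : actHom (f ≫ f') (g ≫ g') = actHom f g ≫ actHom f' g' := by
  apply hom_ext
  apply block
  · intro i h
    rw [val_comp, val_actHom_left _ _ h, val_actHom_left _ _ h, Option.bind_some,
      val_actHom_left _ _ (Fin.is_lt _)]
    rfl
  · intro j h
    rw [val_comp, val_actHom_right, val_actHom_right, val_comp]
    cases val g j with
    | none => rfl
    | some a =>
      rw [Option.bind_some, Option.map_some, Option.bind_some, val_actHom_right]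

theorem act_add (m n : Simp) (k : PiL) : act (Simp.add m n) k = act m (act n k) :=
  PiL.ext (Nat.add_assoc _ _ _)

theorem act_zero (k : PiL) : act ⟨0⟩ k = k := PiL.ext (Nat.zero_add _)

theorem actHom_add {m m' n n' : Simp} {k k' : PiL} (f : m ⟶ m') (g : n ⟶ n') (h : k ⟶ k') :
    actHom (Simp.addHom f g) h =
      eqToHom (act_add m n k) ≫ actHom f (actHom g h) ≫ eqToHom (act_add m' n' k').symm := by
  apply hom_ext
  apply block
  · intro i hi
    have hi' : i < m.len + n.len := hi
    rw [val_conj, val_actHom_left _ _ hi, Simp.fn_addHom_val]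
    split
    · next hm =>
      rw [val_actHom_left _ _ hm]
    · next hm =>
      obtain ⟨j, rfl⟩ := Nat.exists_eq_add_of_le (Nat.le_of_not_lt hm)
      rw [val_actHom_right, val_actHom_left _ _ (by omega)]
      simp
  · intro j hj
    rw [val_conj, val_actHom_right]
    have : (Simp.add m n).len + j = m.len + (n.len + j) := Nat.add_assoc _ _ _
    rw [this, val_actHom_right, val_actHom_right, Option.map_map]
    congr 1
    funext x
    exact Nat.add_assoc _ _ _

theorem actHom_zero {k k' : PiL} (g : k ⟶ k') :
    actHom (𝟙 (⟨0⟩ : Simp)) g = eqToHom (act_zero k) ≫ g ≫ eqToHom (act_zero k').symm := by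
  apply hom_ext
  intro i _
  rw [val_conj]
  have := val_actHom_right (𝟙 (⟨0⟩ : Simp)) g i
  simpa using this

theorem actHom_comp_id {m m' m'' : Simp} (f : m ⟶ m') (f' : m' ⟶ m'') (k : PiL) :
    actHom (f ≫ f') (𝟙 k) = actHom f (𝟙 k) ≫ actHom f' (𝟙 k) := by
  rw [← actHom_comp, Category.comp_id]

theorem actHom_add_id {m m' : Simp} (f : m ⟶ m') (n : Simp) (k : PiL) :
    actHom (Simp.addHom f (𝟙 n)) (𝟙 k) =
      eqToHom (act_add m n k) ≫ actHom f (𝟙 (act n k)) ≫ eqToHom (act_add m' n k).symm := by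
  rw [actHom_add, actHom_id]

/-- The functor `n + (-)` on `Π_l`. -/
def actFunctor (n : Simp) : PiL ⥤ PiL where
  obj k := act n k
  map g := actHom (𝟙 n) g
  map_id k := actHom_id n k
  map_comp g g' := by rw [← actHom_comp, Category.comp_id]

/-- The natural transformation `f + (-)`. -/
def actTrans {m n : Simp} (f : m ⟶ n) : actFunctor m ⟶ actFunctor n where
  app k := actHom f (𝟙 k)
  naturality k k' g := by
    simp only [actFunctor]
    rw [← actHom_comp, ← actHom_comp]
    simp

end PiL

open Bicategory in
/-- The weight `W_l : 𝚫 ⥤ Cat`, the action of `Δ` on `Π_l` by tensoring on the left: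
`W_l(*) = Π_l`, `W_l(n) = n + (-)`, `W_l(f) = f + (-)`. -/
def Wl : StrictPseudofunctor Del Cat.{0, 0} := StrictPseudofunctor.mk''
  { obj := fun _ => Cat.of PiL
    map := fun n => (PiL.actFunctor n).toCatHom
    map₂ := fun f => (PiL.actTrans f).toCatHom₂
    map₂_id := by
      intro a b f
      ext k
      exact PiL.actHom_id f k
    map₂_comp := by
      intro a b f g h η θ
      ext k
      exact PiL.actHom_comp_id η θ k
    map_id := by
      intro a
      apply Cat.ext
      exact CategoryTheory.Functor.ext PiL.act_zero (fun k k' g => PiL.actHom_zero g)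
    map_comp := by
      intro a b c f g
      apply Cat.ext
      refine CategoryTheory.Functor.ext (fun k => PiL.act_add g f k) (fun k k' h => ?_)
      show PiL.actHom (𝟙 (Simp.add g f)) h = _
      rw [← Simp.addHom_id]
      exact PiL.actHom_add (𝟙 g) (𝟙 f) h
    map₂_whisker_left := by
      intro a b c f g g' η
      ext k
      simp only [Cat.Hom.toNatTrans_comp, Cat.Hom₂.eqToHom_toNatTrans, NatTrans.comp_app,
        eqToHom_app]
      exact PiL.actHom_add_id η f k
    map₂_whisker_right := by
      intro a b c f f' η g
      ext k
      simp only [Cat.Hom.toNatTrans_comp, Cat.Hom₂.eqToHom_toNatTrans, NatTrans.comp_app,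
        eqToHom_app]
      exact PiL.actHom_add (𝟙 g) η (𝟙 k) }

/-! ### 2-natural transformations and modifications between `Cat`-valued 2-functors -/

open Bicategory

section TwoNat

variable {I : Type u₁} [Bicategory.{w₁, v₁} I]

/-- A 2-natural transformation between 2-functors with values in categories (the two 2-functors may
take values in categories of different sizes): the equations hold strictly, on 1-cells and on
2-cells; the `eqToHom`s are the identities coming from the equation on 1-cells. -/
@[ext]
structure TwoNat (F : StrictPseudofunctor I Cat.{w₂, v₂}) (G : StrictPseudofunctor I Cat.{w₃, v₃}) where
  app (i : I) : F.obj i ⥤ G.obj i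
  naturality {i j : I} (f : i ⟶ j) :
    (F.map f).toFunctor ⋙ app j = app i ⋙ (G.map f).toFunctor
  naturality₂ {i j : I} {f g : i ⟶ j} (α : f ⟶ g) :
    Functor.whiskerRight (F.map₂ α).toNatTrans (app j) =
      eqToHom (naturality f) ≫ Functor.whiskerLeft (app i) (G.map₂ α).toNatTrans ≫
        eqToHom (naturality g).symm

variable {F : StrictPseudofunctor I Cat.{w₂, v₂}} {G : StrictPseudofunctor I Cat.{w₃, v₃}}

/-- A modification between 2-natural transformations. -/
@[ext]
structure Modif (l l' : TwoNat F G) where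
  app (i : I) : l.app i ⟶ l'.app i
  naturality {i j : I} (f : i ⟶ j) :
    Functor.whiskerLeft (F.map f).toFunctor (app j) =
      eqToHom (l.naturality f) ≫ Functor.whiskerRight (app i) (G.map f).toFunctor ≫
        eqToHom (l'.naturality f).symm

instance : Category (TwoNat F G) where
  Hom := Modif
  id l := { app := fun i => 𝟙 (l.app i), naturality := by intros; simp }
  comp ν ν' :=
    { app := fun i => ν.app i ≫ ν'.app i
      naturality := by
        intro i j f
        rw [Functor.whiskerLeft_comp, ν.naturality, ν'.naturality, Functor.whiskerRight_comp]
        simp }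
  id_comp _ := Modif.ext (funext fun _ => Category.id_comp _)
  comp_id _ := Modif.ext (funext fun _ => Category.comp_id _)
  assoc _ _ _ := Modif.ext (funext fun _ => Category.assoc _ _ _)

/-- The component of a modification at `i`. -/
def mapp {l l' : TwoNat F G} (ν : l ⟶ l') (i : I) : l.app i ⟶ l'.app i := Modif.app ν i

theorem mapp_ext {l l' : TwoNat F G} {ν ν' : l ⟶ l'} (h : ∀ i, mapp ν i = mapp ν' i) : ν = ν' :=
  Modif.ext (funext h)

theorem mapp_id (l : TwoNat F G) (i : I) : mapp (𝟙 l) i = 𝟙 (l.app i) := rfl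

theorem mapp_comp {l l' l'' : TwoNat F G} (ν : l ⟶ l') (ν' : l' ⟶ l'') (i : I) :
    mapp (ν ≫ ν') i = mapp ν i ≫ mapp ν' i := rfl

theorem mapp_eqToHom {l l' : TwoNat F G} (h : l = l') (i : I) :
    mapp (eqToHom h) i = eqToHom (by rw [h]) := by
  subst h; rfl

/-- A 2-natural isomorphism: a 2-natural transformation with a 2-natural inverse; in particular each
component is an isomorphism of categories. -/
structure TwoNatIso (F : StrictPseudofunctor I Cat.{w₂, v₂})
    (G : StrictPseudofunctor I Cat.{w₃, v₃}) where
  hom : TwoNat F G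
  inv : TwoNat G F
  hom_inv_id (i : I) : hom.app i ⋙ inv.app i = 𝟭 (F.obj i)
  inv_hom_id (i : I) : inv.app i ⋙ hom.app i = 𝟭 (G.obj i)

end TwoNat

/-! ### Hom 2-functors -/

section Strict

variable {D : Type u} [Bicategory.{w, v} D] [Bicategory.Strict D]

theorem whiskerLeft_comp_strict {a b c d : D} (f : a ⟶ b) (g : b ⟶ c) {h h' : c ⟶ d} (η : h ⟶ h') :
    (f ≫ g) ◁ η = eqToHom (Strict.assoc f g h) ≫ f ◁ g ◁ η ≫ eqToHom (Strict.assoc f g h').symm := by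
  simp [Strict.associator_eqToIso]

theorem whiskerLeft_comp_strict_symm {a b c d : D} (f : a ⟶ b) (g : b ⟶ c) {h h' : c ⟶ d}
    (η : h ⟶ h') :
    f ◁ g ◁ η = eqToHom (Strict.assoc f g h).symm ≫ (f ≫ g) ◁ η ≫ eqToHom (Strict.assoc f g h') := by
  rw [whiskerLeft_comp_strict]; simp

theorem whiskerRight_comp_strict {a b c d : D} {f f' : a ⟶ b} (η : f ⟶ f') (g : b ⟶ c) (h : c ⟶ d) :
    η ▷ (g ≫ h) =
      eqToHom (Strict.assoc f g h).symm ≫ η ▷ g ▷ h ≫ eqToHom (Strict.assoc f' g h) := by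
  simp [Strict.associator_eqToIso]

theorem whiskerRight_comp_strict_symm {a b c d : D} {f f' : a ⟶ b} (η : f ⟶ f') (g : b ⟶ c)
    (h : c ⟶ d) :
    η ▷ g ▷ h =
      eqToHom (Strict.assoc f g h) ≫ η ▷ (g ≫ h) ≫ eqToHom (Strict.assoc f' g h).symm := by
  rw [whiskerRight_comp_strict]; simp

theorem whisker_assoc_strict {a b c d : D} (f : a ⟶ b) {g g' : b ⟶ c} (η : g ⟶ g') (h : c ⟶ d) :
    f ◁ (η ▷ h) =
      eqToHom (Strict.assoc f g h).symm ≫ (f ◁ η) ▷ h ≫ eqToHom (Strict.assoc f g' h) := by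
  simp [Strict.associator_eqToIso]

theorem whisker_assoc_strict_symm {a b c d : D} (f : a ⟶ b) {g g' : b ⟶ c} (η : g ⟶ g')
    (h : c ⟶ d) :
    (f ◁ η) ▷ h = eqToHom (Strict.assoc f g h) ≫ f ◁ (η ▷ h) ≫ eqToHom (Strict.assoc f g' h).symm := by
  rw [whisker_assoc_strict]; simp

theorem whiskerRight_obj_comp_strict {a b c d : D} {f f' : a ⟶ b} (η : f ⟶ f') {g : b ⟶ c}
    {h : c ⟶ d} {r : b ⟶ d} (e : r = g ≫ h) :
    η ▷ r = eqToHom (by rw [e, Strict.assoc]) ≫ η ▷ g ▷ h ≫ eqToHom (by rw [e, Strict.assoc]) := by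
  subst e; exact whiskerRight_comp_strict η g h

theorem id_whiskerLeft_strict {a b : D} {f g : a ⟶ b} (η : f ⟶ g) :
    𝟙 a ◁ η = eqToHom (Strict.id_comp f) ≫ η ≫ eqToHom (Strict.id_comp g).symm := by
  simp [Strict.leftUnitor_eqToIso]

theorem whiskerRight_id_strict {a b : D} {f g : a ⟶ b} (η : f ⟶ g) :
    η ▷ 𝟙 b = eqToHom (Strict.comp_id f) ≫ η ≫ eqToHom (Strict.comp_id g).symm := by
  simp [Strict.rightUnitor_eqToIso]

theorem whiskerLeft_congr' {D : Type u} [Bicategory.{w, v} D] {a b c : D} {f f' : a ⟶ b} (e : f = f') {g h : b ⟶ c} (η : g ⟶ h) :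
    f ◁ η = eqToHom (by rw [e]) ≫ f' ◁ η ≫ eqToHom (by rw [e]) := by
  subst e; simp

theorem unop2_eqToHom {B : Type u} [Bicategory.{w, v} B] {a b : Bᵒᵖ} {f g : a ⟶ b} (h : f = g) :
    (eqToHom h).unop2 = eqToHom (congrArg Quiver.Hom.unop h) := by
  subst h; rfl

theorem hom2_ext {B : Type u} [Bicategory.{w, v} B] {a b : Bᵒᵖ} {f g : a ⟶ b} {x y : f ⟶ g}
    (h : x.unop2 = y.unop2) : x = y :=
  congrArg _root_.Bicategory.Opposite.Hom2.op2' h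

/-- The 1-cell dual of a 2-category is a 2-category. -/
instance opStrict : Bicategory.Strict Dᵒᵖ where
  id_comp f := Quiver.Hom.unop_inj (Strict.comp_id f.unop)
  comp_id f := Quiver.Hom.unop_inj (Strict.id_comp f.unop)
  assoc f g h := Quiver.Hom.unop_inj (Strict.assoc h.unop g.unop f.unop).symm
  leftUnitor_eqToIso f := by
    apply Iso.ext
    apply hom2_ext
    rw [eqToIso.hom, unop2_eqToHom, _root_.Bicategory.Opposite.bicategory_leftUnitor_hom_unop2,
      Strict.rightUnitor_eqToIso]
    rfl
  rightUnitor_eqToIso f := by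
    apply Iso.ext
    apply hom2_ext
    rw [eqToIso.hom, unop2_eqToHom, _root_.Bicategory.Opposite.bicategory_rightUnitor_hom_unop2,
      Strict.leftUnitor_eqToIso]
    rfl
  associator_eqToIso f g h := by
    apply Iso.ext
    apply hom2_ext
    rw [eqToIso.hom, unop2_eqToHom, _root_.Bicategory.Opposite.bicategory_associator_hom_unop2,
      Strict.associator_eqToIso]
    rfl

theorem postcomp_comp (X : D) {a b c : D} (f : a ⟶ b) (g : b ⟶ c) :
    postcomp X (f ≫ g) = postcomp X f ⋙ postcomp X g :=
  CategoryTheory.Functor.ext (fun r => (Strict.assoc r f g).symm)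
    (fun _ _ η => whiskerRight_comp_strict η f g)

theorem postcomp_id (X a : D) : postcomp X (𝟙 a) = 𝟭 (X ⟶ a) :=
  CategoryTheory.Functor.ext Strict.comp_id (fun _ _ η => whiskerRight_id_strict η)

theorem precomp_comp (Z : D) {a b c : D} (f : a ⟶ b) (g : b ⟶ c) :
    precomp Z (f ≫ g) = precomp Z g ⋙ precomp Z f :=
  CategoryTheory.Functor.ext (fun r => Strict.assoc f g r)
    (fun _ _ η => whiskerLeft_comp_strict f g η)

theorem precomp_id (Z a : D) : precomp Z (𝟙 a) = 𝟭 (a ⟶ Z) :=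
  CategoryTheory.Functor.ext Strict.id_comp (fun _ _ η => id_whiskerLeft_strict η)

theorem precomp_postcomp {a b c d : D} (f : a ⟶ b) (h : c ⟶ d) :
    postcomp b h ⋙ precomp d f = precomp c f ⋙ postcomp a h :=
  CategoryTheory.Functor.ext (fun r => (Strict.assoc f r h).symm)
    (fun _ _ η => whisker_assoc_strict f η h)

/-- Whiskering along a 2-cell `β : f ⟶ g`, as a natural transformation `D(X, f) ⟶ D(X, g)`. -/
def postTrans (X : D) {a b : D} {f g : a ⟶ b} (β : f ⟶ g) : postcomp X f ⟶ postcomp X g where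
  app r := r ◁ β
  naturality _ _ η := (whisker_exchange η β).symm

/-- Whiskering along a 2-cell `β : f ⟶ g`, as a natural transformation `D(f, Z) ⟶ D(g, Z)`. -/
def preTrans (Z : D) {a b : D} {f g : a ⟶ b} (β : f ⟶ g) : precomp Z f ⟶ precomp Z g where
  app r := β ▷ r
  naturality _ _ η := whisker_exchange β η

section

variable {A : Type u₁} [Bicategory.{w₁, v₁} A] (F : StrictPseudofunctor A D)

theorem whiskerLeft_map₂_whiskerLeft {X : D} {a b c : A} (r : X ⟶ F.obj a) (f : a ⟶ b)
    {g g' : b ⟶ c} (η : g ⟶ g') :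
    r ◁ F.map₂ (f ◁ η) =
      eqToHom (by rw [F.map_comp, Strict.assoc]) ≫ (r ≫ F.map f) ◁ F.map₂ η ≫
        eqToHom (by rw [F.map_comp, Strict.assoc]) := by
  rw [F.map₂_whisker_left, F.mapComp_eq_eqToIso, F.mapComp_eq_eqToIso, whiskerLeft_comp_strict]
  simp

theorem whiskerLeft_map₂_whiskerRight {X : D} {a b c : A} (r : X ⟶ F.obj a) {f f' : a ⟶ b}
    (η : f ⟶ f') (g : b ⟶ c) :
    r ◁ F.map₂ (η ▷ g) =
      eqToHom (by rw [F.map_comp, Strict.assoc]) ≫ (r ◁ F.map₂ η) ▷ F.map g ≫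
        eqToHom (by rw [F.map_comp, Strict.assoc]) := by
  rw [F.map₂_whisker_right, F.mapComp_eq_eqToIso, F.mapComp_eq_eqToIso, whiskerLeft_comp,
    whiskerLeft_comp, whisker_assoc_strict]
  simp

theorem map₂_whiskerRight_whiskerRight {Z : D} {a b c : A} {f f' : a ⟶ b} (η : f ⟶ f') (g : b ⟶ c)
    (r : F.obj c ⟶ Z) :
    F.map₂ (η ▷ g) ▷ r =
      eqToHom (by rw [F.map_comp, Strict.assoc]) ≫ F.map₂ η ▷ (F.map g ≫ r) ≫
        eqToHom (by rw [F.map_comp, Strict.assoc]) := by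
  rw [F.map₂_whisker_right, F.mapComp_eq_eqToIso, F.mapComp_eq_eqToIso, whiskerRight_comp_strict]
  simp

theorem map₂_whiskerLeft_whiskerRight {Z : D} {a b c : A} (f : a ⟶ b) {g g' : b ⟶ c} (η : g ⟶ g')
    (r : F.obj c ⟶ Z) :
    F.map₂ (f ◁ η) ▷ r =
      eqToHom (by rw [F.map_comp, Strict.assoc]) ≫ F.map f ◁ (F.map₂ η ▷ r) ≫
        eqToHom (by rw [F.map_comp, Strict.assoc]) := by
  rw [F.map₂_whisker_left, F.mapComp_eq_eqToIso, F.mapComp_eq_eqToIso, whisker_assoc_strict]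
  simp

theorem map_id_whiskerLeft {Z : D} (a : A) {r s : F.obj a ⟶ Z} (φ : r ⟶ s) :
    F.map (𝟙 a) ◁ φ =
      eqToHom (by rw [F.map_id, Strict.id_comp]) ≫ φ ≫
        eqToHom (by rw [F.map_id, Strict.id_comp]) := by
  rw [whiskerLeft_congr' (F.map_id a), id_whiskerLeft_strict]
  simp

theorem map_comp_whiskerLeft {Z : D} {a b c : A} (f : a ⟶ b) (g : b ⟶ c) {r s : F.obj c ⟶ Z}
    (φ : r ⟶ s) :
    F.map (f ≫ g) ◁ φ =
      eqToHom (by rw [F.map_comp, Strict.assoc]) ≫ F.map f ◁ F.map g ◁ φ ≫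
        eqToHom (by rw [F.map_comp, Strict.assoc]) := by
  rw [whiskerLeft_congr' (F.map_comp f g), whiskerLeft_comp_strict]
  simp

end

/-- The 2-functor `D(X, 𝐓) : I ⥤ Cat` of "homming into `𝐓`". -/
def homInto {I : Type u₁} [Bicategory.{w₁, v₁} I] [Bicategory.Strict I] (X : D)
    (T : StrictPseudofunctor I D) : StrictPseudofunctor I Cat.{w, v} := StrictPseudofunctor.mk''
  { obj := fun i => Cat.of (X ⟶ T.obj i)
    map := fun f => (postcomp X (T.map f)).toCatHom
    map₂ := fun α => (postTrans X (T.map₂ α)).toCatHom₂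
    map₂_id := by
      intro a b f
      ext r
      exact (congrArg (fun x => r ◁ x) (T.map₂_id f)).trans (whiskerLeft_id _ _)
    map₂_comp := by
      intro a b f g h η θ
      ext r
      exact (congrArg (fun x => r ◁ x) (T.map₂_comp η θ)).trans (whiskerLeft_comp _ _ _)
    map_id := by
      intro a
      apply Cat.ext
      exact (congrArg (postcomp X) (T.map_id a)).trans (postcomp_id X _)
    map_comp := by
      intro a b c f g
      apply Cat.ext
      exact (congrArg (postcomp X) (T.map_comp f g)).trans (postcomp_comp X _ _)
    map₂_whisker_left := by
      intro a b c f g g' η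
      ext r
      simp only [Cat.Hom.toNatTrans_comp, Cat.Hom₂.eqToHom_toNatTrans, NatTrans.comp_app,
        eqToHom_app]
      exact whiskerLeft_map₂_whiskerLeft T r f η
    map₂_whisker_right := by
      intro a b c f f' η g
      ext r
      simp only [Cat.Hom.toNatTrans_comp, Cat.Hom₂.eqToHom_toNatTrans, NatTrans.comp_app,
        eqToHom_app]
      exact whiskerLeft_map₂_whiskerRight T r η g }

/-! ### Building contravariant 2-functors to `Cat` -/

theorem conj_app {C : Type u₁} [Category.{v₁} C] {E : Type u₂} [Category.{v₂} E] {F F' G G' : C ⥤ E}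
    (e : F = F') (t : F' ⟶ G') (e' : G' = G) (x : C) :
    (eqToHom e ≫ t ≫ eqToHom e').app x =
      eqToHom (Functor.congr_obj e x) ≫ t.app x ≫ eqToHom (Functor.congr_obj e' x) := by
  subst e e'; simp

/-- The 2-functor `Aᵒᵖ ⥤ Cat` given by categories `obj X`, functors `map f : obj Y ⥤ obj X` for
`f : X ⟶ Y` and natural transformations `map₂ β`, strictly compatible with all compositions. -/
def mkContra {A : Type u₁} [Bicategory.{w₁, v₁} A] [Bicategory.Strict A] (obj : A → Type v₂)
    [cat : ∀ X, Category.{w₂} (obj X)]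
    (map : ∀ (X Y : A), (X ⟶ Y) → (obj Y ⥤ obj X))
    (map₂ : ∀ (X Y : A) (f g : X ⟶ Y), (f ⟶ g) → (map X Y f ⟶ map X Y g))
    (map₂_id : ∀ (X Y : A) (f : X ⟶ Y) (x : obj Y),
      (map₂ X Y f f (𝟙 f)).app x = 𝟙 ((map X Y f).obj x))
    (map₂_comp : ∀ (X Y : A) (f g h : X ⟶ Y) (β : f ⟶ g) (γ : g ⟶ h) (x : obj Y),
      (map₂ X Y f h (β ≫ γ)).app x = (map₂ X Y f g β).app x ≫ (map₂ X Y g h γ).app x)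
    (id_obj : ∀ (X : A) (x : obj X), (map X X (𝟙 X)).obj x = x)
    (id_map : ∀ (X : A) (x y : obj X) (φ : x ⟶ y),
      (map X X (𝟙 X)).map φ = eqToHom (id_obj X x) ≫ φ ≫ eqToHom (id_obj X y).symm)
    (comp_obj : ∀ (X Y Z : A) (f : X ⟶ Y) (g : Y ⟶ Z) (x : obj Z),
      (map X Z (f ≫ g)).obj x = (map X Y f).obj ((map Y Z g).obj x))
    (comp_map : ∀ (X Y Z : A) (f : X ⟶ Y) (g : Y ⟶ Z) (x y : obj Z) (φ : x ⟶ y),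
      (map X Z (f ≫ g)).map φ =
        eqToHom (comp_obj X Y Z f g x) ≫ (map X Y f).map ((map Y Z g).map φ) ≫
          eqToHom (comp_obj X Y Z f g y).symm)
    (whisker_left : ∀ (X Y Z : A) (f : X ⟶ Y) (g g' : Y ⟶ Z) (β : g ⟶ g') (x : obj Z),
      (map₂ X Z (f ≫ g) (f ≫ g') (f ◁ β)).app x =
        eqToHom (comp_obj X Y Z f g x) ≫ (map X Y f).map ((map₂ Y Z g g' β).app x) ≫
          eqToHom (comp_obj X Y Z f g' x).symm)
    (whisker_right : ∀ (X Y Z : A) (f f' : X ⟶ Y) (β : f ⟶ f') (g : Y ⟶ Z) (x : obj Z),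
      (map₂ X Z (f ≫ g) (f' ≫ g) (β ▷ g)).app x =
        eqToHom (comp_obj X Y Z f g x) ≫ (map₂ X Y f f' β).app ((map Y Z g).obj x) ≫
          eqToHom (comp_obj X Y Z f' g x).symm) :
    StrictPseudofunctor Aᵒᵖ Cat.{w₂, v₂} := StrictPseudofunctor.mk''
  { obj := fun X => Cat.of (obj X.unop)
    map := fun f => (map _ _ f.unop).toCatHom
    map₂ := fun β => (map₂ _ _ _ _ β.unop2).toCatHom₂
    map₂_id := by
      intro a b f
      ext x
      exact map₂_id _ _ f.unop x
    map₂_comp := by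
      intro a b f g h η θ
      ext x
      exact map₂_comp _ _ _ _ _ η.unop2 θ.unop2 x
    map_id := by
      intro a
      apply Cat.ext
      exact CategoryTheory.Functor.ext (id_obj a.unop) (id_map a.unop)
    map_comp := by
      intro x y z f g
      apply Cat.ext
      exact CategoryTheory.Functor.ext (comp_obj _ _ _ g.unop f.unop)
        (comp_map _ _ _ g.unop f.unop)
    map₂_whisker_left := by
      intro x y z f g g' η
      ext r
      simp only [Cat.Hom.toNatTrans_comp, Cat.Hom₂.eqToHom_toNatTrans]
      refine Eq.trans ?_ (conj_app _ _ _ r).symm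
      exact whisker_right _ _ _ _ _ η.unop2 f.unop r
    map₂_whisker_right := by
      intro x y z f f' η g
      ext r
      simp only [Cat.Hom.toNatTrans_comp, Cat.Hom₂.eqToHom_toNatTrans]
      refine Eq.trans ?_ (conj_app _ _ _ r).symm
      exact whisker_left _ _ _ g.unop _ _ η.unop2 r }

/-- The 2-functor `D(F(-), c) : Aᵒᵖ ⥤ Cat`, for a 2-functor `F : A ⥤ D` and a 0-cell `c` of `D`. -/
def homFrom {A : Type u₁} [Bicategory.{w₁, v₁} A] [Bicategory.Strict A]
    (F : StrictPseudofunctor A D) (c : D) : StrictPseudofunctor Aᵒᵖ Cat.{w, v} :=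
  mkContra (fun X => F.obj X ⟶ c) (fun _ _ f => precomp c (F.map f))
    (fun _ _ _ _ β => preTrans c (F.map₂ β))
    (fun _ _ f r => (congrArg (fun x => x ▷ r) (F.map₂_id f)).trans (id_whiskerRight _ _))
    (fun _ _ _ _ _ β γ r =>
      (congrArg (fun x => x ▷ r) (F.map₂_comp β γ)).trans (comp_whiskerRight _ _ _))
    (fun X r => (congrArg (fun x => x ≫ r) (F.map_id X)).trans (Strict.id_comp r))
    (fun X _ _ φ => map_id_whiskerLeft F X φ)
    (fun _ _ _ f g r => (congrArg (fun x => x ≫ r) (F.map_comp f g)).trans (Strict.assoc _ _ r))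
    (fun _ _ _ f g _ _ φ => map_comp_whiskerLeft F f g φ)
    (fun _ _ _ f _ _ β r => map₂_whiskerLeft_whiskerRight F f β r)
    (fun _ _ _ _ _ β g r => map₂_whiskerRight_whiskerRight F β g r)

/-- The representable 2-functor `D(-, L)`. -/
abbrev represented (L : D) : StrictPseudofunctor Dᵒᵖ Cat.{w, v} :=
  homFrom (StrictPseudofunctor.id D) L

end Strict

/-! ### Weighted cones and weighted limits -/

section Cone

theorem mapp_conj {I : Type u₁} [Bicategory.{w₁, v₁} I] {F : StrictPseudofunctor I Cat.{w₂, v₂}}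
    {G : StrictPseudofunctor I Cat.{w₃, v₃}} {k k' l l' : TwoNat F G} (e : k = k') (ν : k' ⟶ l')
    (e' : l' = l) (i : I) :
    mapp (eqToHom e ≫ ν ≫ eqToHom e') i =
      eqToHom (by rw [e]) ≫ mapp ν i ≫ eqToHom (by rw [e']) := by
  subst e e'; simp

variable {I : Type u₁} [Bicategory.{w₁, v₁} I]

namespace TwoNat

variable {F : StrictPseudofunctor I Cat.{w₂, v₂}} {G : StrictPseudofunctor I Cat.{w₃, v₃}}
  {H : StrictPseudofunctor I Cat.{w, v}}

/-- Composition of 2-natural transformations. -/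
def comp (l : TwoNat F G) (m : TwoNat G H) : TwoNat F H where
  app i := l.app i ⋙ m.app i
  naturality {i j} f := by
    rw [← Functor.assoc, l.naturality, Functor.assoc, m.naturality, Functor.assoc]
  naturality₂ {i j f g} α := by
    ext x
    have h₁ := congrArg (fun t => (m.app j).map (t.app x)) (l.naturality₂ α)
    have h₂ := congrArg (fun t => t.app ((l.app i).obj x)) (m.naturality₂ α)
    simp only [NatTrans.comp_app, eqToHom_app, Functor.whiskerRight_app, Functor.whiskerLeft_app,
      Functor.map_comp, eqToHom_map] at h₁ h₂ ⊢
    refine h₁.trans ?_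
    rw [h₂]
    simp

/-- Postcomposition with a fixed 2-natural transformation, as a functor. -/
def compFunctor (m : TwoNat G H) : TwoNat F G ⥤ TwoNat F H where
  obj l := l.comp m
  map {l l'} ν := Modif.mk (fun i => Functor.whiskerRight (mapp ν i) (m.app i)) (by
    intro i j f
    ext x
    have h₁ := congrArg (fun t => (m.app j).map (t.app x)) (Modif.naturality ν f)
    have h₂ := Functor.congr_hom (m.naturality f) ((mapp ν i).app x)
    simp only [NatTrans.comp_app, eqToHom_app, Functor.whiskerRight_app, Functor.whiskerLeft_app,
      Functor.map_comp, eqToHom_map, Functor.comp_map] at h₁ h₂ ⊢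
    refine h₁.trans ?_
    refine (congrArg (fun t => eqToHom _ ≫ t ≫ eqToHom _) h₂).trans ?_
    simp
    rfl)
  map_id l := mapp_ext fun i => Functor.whiskerRight_id _
  map_comp ν ν' := mapp_ext fun i => Functor.whiskerRight_comp _ _ _

end TwoNat

variable [Bicategory.Strict I] {D : Type u} [Bicategory.{w, v} D] [Bicategory.Strict D]

/-- The 2-natural transformation `D(F, 𝐓) : D(Y, 𝐓) ⟶ D(X, 𝐓)` induced by `F : X ⟶ Y`. -/
def homPre (T : StrictPseudofunctor I D) {X Y : D} (F : X ⟶ Y) :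
    TwoNat (homInto Y T) (homInto X T) where
  app i := precomp (T.obj i) F
  naturality f := precomp_postcomp F (T.map f)
  naturality₂ {i j f g} α := by
    ext r
    refine Eq.trans ?_ (conj_app _ _ _ r).symm
    exact whiskerLeft_comp_strict_symm F r (T.map₂ α)

/-- The modification `D(β, 𝐓) : D(F, 𝐓) ⟶ D(G, 𝐓)` induced by `β : F ⟶ G`. -/
def homPre₂ (T : StrictPseudofunctor I D) {X Y : D} {F G : X ⟶ Y} (β : F ⟶ G) :
    homPre T F ⟶ homPre T G :=
  Modif.mk (fun i => preTrans (T.obj i) β) (by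
    intro i j f
    ext r
    refine Eq.trans ?_ (conj_app _ _ _ r).symm
    exact whiskerRight_comp_strict β r (T.map f))

variable (W : StrictPseudofunctor I Cat.{w₂, v₂}) (T : StrictPseudofunctor I D)

/-- Cones with vertex `X`: 2-natural transformations `W ⟶ D(X, 𝐓)`, with modifications as
morphisms. -/
def ConeCat (X : D) := TwoNat W (homInto X T)

/-- The category of cones with vertex `X`. -/
instance coneCategory (X : D) : Category.{max u₁ v₂ w} (ConeCat W T X) :=
  inferInstanceAs (Category (TwoNat W (homInto X T)))

/-- The 1-cell `X ⟶ 𝐓 i` of a cone belonging to an object `x` of `W i`. -/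
def ConeCat.leg {W : StrictPseudofunctor I Cat.{w₂, v₂}} {T : StrictPseudofunctor I D} {X : D}
    (l : ConeCat W T X) (i : I) (x : W.obj i) : X ⟶ T.obj i := (TwoNat.app l i).obj x

/-- The 2-cell of a morphism of cones belonging to an object `x` of `W i`. -/
def ConeCat.cell {W : StrictPseudofunctor I Cat.{w₂, v₂}} {T : StrictPseudofunctor I D} {X : D}
    {l l' : ConeCat W T X} (ν : l ⟶ l') (i : I) (x : W.obj i) : l.leg i x ⟶ l'.leg i x :=
  (Modif.app ν i).app x

/-- The functor `Cone_W(𝐓)(F)`, sending `l` to `D(F, 𝐓) ∘ l`. -/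
def coneMap {X Y : D} (F : X ⟶ Y) : ConeCat W T Y ⥤ ConeCat W T X :=
  TwoNat.compFunctor (homPre T F)

/-- The natural transformation `Cone_W(𝐓)(β)`, whose component at `l` is `D(β, 𝐓) ∘ l`. -/
def coneMap₂ {X Y : D} {F G : X ⟶ Y} (β : F ⟶ G) : coneMap W T F ⟶ coneMap W T G where
  app l := Modif.mk (fun i => Functor.whiskerLeft (TwoNat.app l i) (mapp (homPre₂ T β) i)) (by
    intro i j f
    ext x
    refine Eq.trans ?_ (conj_app _ _ _ x).symm
    exact whiskerRight_obj_comp_strict β (Functor.congr_obj (TwoNat.naturality l f) x))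
  naturality l l' ν := Modif.ext (funext fun i => NatTrans.ext (funext fun x =>
    (mapp (homPre₂ T β) i).naturality ((Modif.app ν i).app x)))

namespace ConeCat

variable {W T}

theorem hom_ext {X : D} {l l' : ConeCat W T X} {ν ν' : l ⟶ l'}
    (h : ∀ i x, cell ν i x = cell ν' i x) : ν = ν' :=
  Modif.ext (funext fun i => NatTrans.ext (funext fun x => h i x))

theorem cell_id {X : D} (l : ConeCat W T X) (i : I) (x : W.obj i) :
    cell (𝟙 l) i x = 𝟙 (l.leg i x) := rfl

theorem cell_comp {X : D} {l l' l'' : ConeCat W T X} (ν : l ⟶ l') (ν' : l' ⟶ l'') (i : I)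
    (x : W.obj i) : cell (ν ≫ ν') i x = cell ν i x ≫ cell ν' i x := rfl

theorem cell_conj {X : D} {k k' l l' : ConeCat W T X} (e : k = k') (ν : k' ⟶ l') (e' : l' = l)
    (i : I) (x : W.obj i) :
    cell (eqToHom e ≫ ν ≫ eqToHom e') i x =
      eqToHom (by rw [e]) ≫ cell ν i x ≫ eqToHom (by rw [e']) := by
  subst e e'; simp

theorem cell_coneMap {X Y : D} (F : X ⟶ Y) {l l' : ConeCat W T Y} (ν : l ⟶ l') (i : I)
    (x : W.obj i) : cell ((coneMap W T F).map ν) i x = F ◁ cell ν i x := rfl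

theorem cell_coneMap₂ {X Y : D} {F G : X ⟶ Y} (β : F ⟶ G) (l : ConeCat W T Y) (i : I)
    (x : W.obj i) : cell ((coneMap₂ W T β).app l) i x = β ▷ l.leg i x := rfl

end ConeCat

open ConeCat

theorem coneMap_id_obj (X : D) (l : ConeCat W T X) : (coneMap W T (𝟙 X)).obj l = l :=
  TwoNat.ext (funext fun i =>
    (congrArg (TwoNat.app l i ⋙ ·) (precomp_id (T.obj i) X)).trans (Functor.comp_id _))

theorem coneMap_comp_obj {X Y Z : D} (F : X ⟶ Y) (G : Y ⟶ Z) (l : ConeCat W T Z) :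
    (coneMap W T (F ≫ G)).obj l = (coneMap W T F).obj ((coneMap W T G).obj l) :=
  TwoNat.ext (funext fun i => congrArg (TwoNat.app l i ⋙ ·) (precomp_comp (T.obj i) F G))

theorem coneMap_id_map (X : D) {l l' : ConeCat W T X} (ν : l ⟶ l') :
    (coneMap W T (𝟙 X)).map ν =
      eqToHom (coneMap_id_obj W T X l) ≫ ν ≫ eqToHom (coneMap_id_obj W T X l').symm := by
  refine hom_ext fun i x => ?_
  rw [cell_conj, cell_coneMap]
  exact id_whiskerLeft_strict _

theorem coneMap_comp_map {X Y Z : D} (F : X ⟶ Y) (G : Y ⟶ Z) {l l' : ConeCat W T Z} (ν : l ⟶ l') :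
    (coneMap W T (F ≫ G)).map ν =
      eqToHom (coneMap_comp_obj W T F G l) ≫ (coneMap W T F).map ((coneMap W T G).map ν) ≫
        eqToHom (coneMap_comp_obj W T F G l').symm := by
  refine hom_ext fun i x => ?_
  rw [cell_conj, cell_coneMap, cell_coneMap]
  exact whiskerLeft_comp_strict F G _

theorem coneMap₂_whiskerRight {X Y Z : D} {F F' : X ⟶ Y} (β : F ⟶ F') (G : Y ⟶ Z)
    (l : ConeCat W T Z) :
    (coneMap₂ W T (β ▷ G)).app l =
      eqToHom (coneMap_comp_obj W T F G l) ≫ (coneMap₂ W T β).app ((coneMap W T G).obj l) ≫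
        eqToHom (coneMap_comp_obj W T F' G l).symm := by
  refine hom_ext fun i x => ?_
  rw [cell_conj, cell_coneMap₂, cell_coneMap₂]
  exact whiskerRight_comp_strict_symm β G _

theorem coneMap₂_whiskerLeft {X Y Z : D} (F : X ⟶ Y) {G G' : Y ⟶ Z} (β : G ⟶ G')
    (l : ConeCat W T Z) :
    (coneMap₂ W T (F ◁ β)).app l =
      eqToHom (coneMap_comp_obj W T F G l) ≫ (coneMap W T F).map ((coneMap₂ W T β).app l) ≫
        eqToHom (coneMap_comp_obj W T F G' l).symm := by
  refine hom_ext fun i x => ?_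
  rw [cell_conj, cell_coneMap₂, cell_coneMap]
  exact whisker_assoc_strict_symm F β _

theorem coneMap₂_id {X Y : D} (F : X ⟶ Y) (l : ConeCat W T Y) :
    (coneMap₂ W T (𝟙 F)).app l = 𝟙 ((coneMap W T F).obj l) := by
  refine hom_ext fun i x => ?_
  rw [cell_coneMap₂]
  exact id_whiskerRight _ _

theorem coneMap₂_comp {X Y : D} {F G H : X ⟶ Y} (β : F ⟶ G) (γ : G ⟶ H) (l : ConeCat W T Y) :
    (coneMap₂ W T (β ≫ γ)).app l = (coneMap₂ W T β).app l ≫ (coneMap₂ W T γ).app l := by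
  refine hom_ext fun i x => ?_
  rw [cell_coneMap₂]
  exact comp_whiskerRight _ _ _

/-- The 2-functor `Cone_W(𝐓) : Dᵒᵖ ⥤ Cat` of `W`-weighted cones over `𝐓`. -/
def Cone : StrictPseudofunctor Dᵒᵖ Cat.{max u₁ v₂ w, max u₁ v₂ v w₂ w} :=
  mkContra (ConeCat W T) (@coneMap _ _ _ _ _ _ W T)
    (@coneMap₂ _ _ _ _ _ _ W T) (@coneMap₂_id _ _ _ _ _ _ W T) (@coneMap₂_comp _ _ _ _ _ _ W T)
    (@coneMap_id_obj _ _ _ _ _ _ W T) (@coneMap_id_map _ _ _ _ _ _ W T)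
    (@coneMap_comp_obj _ _ _ _ _ _ W T) (@coneMap_comp_map _ _ _ _ _ _ W T)
    (@coneMap₂_whiskerLeft _ _ _ _ _ _ W T) (@coneMap₂_whiskerRight _ _ _ _ _ _ W T)

end Cone

/-! ### Monads, lax morphisms of monads, Eilenberg-Moore objects -/

/-- A monad in a 2-category. -/
@[ext]
structure Mnd (D : Type u) [Bicategory.{w, v} D] where
  /-- the underlying 0-cell -/
  obj : D
  /-- the underlying 1-cell -/
  t : obj ⟶ obj
  /-- the unit -/
  η : 𝟙 obj ⟶ t
  /-- the multiplication -/
  μ : t ≫ t ⟶ t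
  left_unit : η ▷ t ≫ μ = (λ_ t).hom
  right_unit : t ◁ η ≫ μ = (ρ_ t).hom
  assoc : μ ▷ t ≫ μ = (α_ t t t).hom ≫ t ◁ μ ≫ μ

namespace Mnd

section

variable {D : Type u} [Bicategory.{w, v} D]

/-- A (lax) morphism of monads: a 1-cell `f : S.obj ⟶ T.obj` with a 2-cell `φ : T f ⟶ f S`
(in the order of composition of functions) compatible with the units and the multiplications. -/
@[ext]
structure Hom (S T : Mnd D) where
  f : S.obj ⟶ T.obj
  φ : f ≫ T.t ⟶ S.t ≫ f
  unit : (ρ_ f).inv ≫ f ◁ T.η ≫ φ = (λ_ f).inv ≫ S.η ▷ f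
  mult : f ◁ T.μ ≫ φ =
    (α_ f T.t T.t).inv ≫ φ ▷ T.t ≫ (α_ S.t f T.t).hom ≫ S.t ◁ φ ≫ (α_ S.t S.t f).inv ≫ S.μ ▷ f

/-- A 2-cell between morphisms of monads: a 2-cell between the underlying 1-cells that commutes with
the structural 2-cells. -/
@[ext]
structure Hom₂ {S T : Mnd D} (a b : Hom S T) where
  τ : a.f ⟶ b.f
  comm : τ ▷ T.t ≫ b.φ = a.φ ≫ S.t ◁ τ

/-- The identity morphism of monads. -/
def Hom.id (S : Mnd D) : Hom S S where
  f := 𝟙 S.obj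
  φ := (λ_ S.t).hom ≫ (ρ_ S.t).inv
  unit := by simp
  mult := by simp

/-- Composition of morphisms of monads. -/
def Hom.comp {S T R : Mnd D} (a : Hom S T) (b : Hom T R) : Hom S R where
  f := a.f ≫ b.f
  φ := (α_ a.f b.f R.t).hom ≫ a.f ◁ b.φ ≫ (α_ a.f T.t b.f).inv ≫ a.φ ▷ b.f ≫ (α_ S.t a.f b.f).hom
  unit := by
    calc
      _ = a.f ◁ ((ρ_ b.f).inv ≫ b.f ◁ R.η ≫ b.φ) ≫ (α_ a.f T.t b.f).inv ≫ a.φ ▷ b.f ≫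
          (α_ S.t a.f b.f).hom := by bicategory
      _ = a.f ◁ ((λ_ b.f).inv ≫ T.η ▷ b.f) ≫ (α_ a.f T.t b.f).inv ≫ a.φ ▷ b.f ≫
          (α_ S.t a.f b.f).hom := by rw [b.unit]
      _ = ((ρ_ a.f).inv ≫ a.f ◁ T.η ≫ a.φ) ▷ b.f ≫ (α_ S.t a.f b.f).hom := by bicategory
      _ = ((λ_ a.f).inv ≫ S.η ▷ a.f) ▷ b.f ≫ (α_ S.t a.f b.f).hom := by rw [a.unit]
      _ = _ := by bicategory
  mult := by
    calc
      _ = (α_ a.f b.f (R.t ≫ R.t)).hom ≫ a.f ◁ (b.f ◁ R.μ ≫ b.φ) ≫ (α_ a.f T.t b.f).inv ≫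
          a.φ ▷ b.f ≫ (α_ S.t a.f b.f).hom := by bicategory
      _ = (α_ a.f b.f (R.t ≫ R.t)).hom ≫ a.f ◁ ((α_ b.f R.t R.t).inv ≫ b.φ ▷ R.t ≫
          (α_ T.t b.f R.t).hom ≫ T.t ◁ b.φ ≫ (α_ T.t T.t b.f).inv ≫ T.μ ▷ b.f) ≫
          (α_ a.f T.t b.f).inv ≫ a.φ ▷ b.f ≫ (α_ S.t a.f b.f).hom := by rw [b.mult]
      _ = (α_ a.f b.f (R.t ≫ R.t)).hom ≫ a.f ◁ ((α_ b.f R.t R.t).inv ≫ b.φ ▷ R.t ≫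
          (α_ T.t b.f R.t).hom ≫ T.t ◁ b.φ ≫ (α_ T.t T.t b.f).inv) ≫
          (α_ a.f (T.t ≫ T.t) b.f).inv ≫ (a.f ◁ T.μ ≫ a.φ) ▷ b.f ≫ (α_ S.t a.f b.f).hom := by
        bicategory
      _ = (α_ a.f b.f (R.t ≫ R.t)).hom ≫ a.f ◁ ((α_ b.f R.t R.t).inv ≫ b.φ ▷ R.t ≫
          (α_ T.t b.f R.t).hom ≫ T.t ◁ b.φ ≫ (α_ T.t T.t b.f).inv) ≫
          (α_ a.f (T.t ≫ T.t) b.f).inv ≫ ((α_ a.f T.t T.t).inv ≫ a.φ ▷ T.t ≫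
          (α_ S.t a.f T.t).hom ≫ S.t ◁ a.φ ≫ (α_ S.t S.t a.f).inv ≫ S.μ ▷ a.f) ▷ b.f ≫
          (α_ S.t a.f b.f).hom := by rw [a.mult]
      _ = (α_ a.f b.f (R.t ≫ R.t)).hom ≫ a.f ◁ ((α_ b.f R.t R.t).inv ≫ b.φ ▷ R.t ≫
          (α_ T.t b.f R.t).hom) ≫ (α_ a.f T.t (b.f ≫ R.t)).inv ≫
          ((a.f ≫ T.t) ◁ b.φ ≫ a.φ ▷ (T.t ≫ b.f)) ≫ (α_ S.t a.f (T.t ≫ b.f)).hom ≫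
          S.t ◁ ((α_ a.f T.t b.f).inv ≫ a.φ ▷ b.f ≫ (α_ S.t a.f b.f).hom) ≫
          (α_ S.t S.t (a.f ≫ b.f)).inv ≫ S.μ ▷ (a.f ≫ b.f) := by bicategory
      _ = (α_ a.f b.f (R.t ≫ R.t)).hom ≫ a.f ◁ ((α_ b.f R.t R.t).inv ≫ b.φ ▷ R.t ≫
          (α_ T.t b.f R.t).hom) ≫ (α_ a.f T.t (b.f ≫ R.t)).inv ≫
          (a.φ ▷ (b.f ≫ R.t) ≫ (S.t ≫ a.f) ◁ b.φ) ≫ (α_ S.t a.f (T.t ≫ b.f)).hom ≫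
          S.t ◁ ((α_ a.f T.t b.f).inv ≫ a.φ ▷ b.f ≫ (α_ S.t a.f b.f).hom) ≫
          (α_ S.t S.t (a.f ≫ b.f)).inv ≫ S.μ ▷ (a.f ≫ b.f) := by rw [whisker_exchange]
      _ = _ := by bicategory

instance : CategoryStruct (Mnd D) where
  Hom := Hom
  id := Hom.id
  comp := Hom.comp

theorem id_f (S : Mnd D) : Hom.f (𝟙 S) = 𝟙 S.obj := rfl
theorem id_φ (S : Mnd D) : Hom.φ (𝟙 S) = (λ_ S.t).hom ≫ (ρ_ S.t).inv := rfl
theorem comp_f {S T R : Mnd D} (a : S ⟶ T) (b : T ⟶ R) : Hom.f (a ≫ b) = a.f ≫ b.f := rfl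
theorem comp_φ {S T R : Mnd D} (a : S ⟶ T) (b : T ⟶ R) :
    Hom.φ (a ≫ b) = (α_ a.f b.f R.t).hom ≫ a.f ◁ b.φ ≫ (α_ a.f T.t b.f).inv ≫ a.φ ▷ b.f ≫
      (α_ S.t a.f b.f).hom := rfl

instance (S T : Mnd D) : Category (S ⟶ T) where
  Hom a b := Hom₂ a b
  id a := { τ := 𝟙 a.f, comm := by simp }
  comp x y :=
    { τ := x.τ ≫ y.τ
      comm := by
        rw [comp_whiskerRight, Category.assoc, y.comm, ← Category.assoc, x.comm, Category.assoc,
          whiskerLeft_comp] }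
  id_comp _ := Hom₂.ext (Category.id_comp _)
  comp_id _ := Hom₂.ext (Category.comp_id _)
  assoc _ _ _ := Hom₂.ext (Category.assoc _ _ _)

/-- The underlying 2-cell of a 2-cell between morphisms of monads. -/
def cell {S T : Mnd D} {a b : S ⟶ T} (x : a ⟶ b) : a.f ⟶ b.f := Hom₂.τ x

theorem cell_comm {S T : Mnd D} {a b : S ⟶ T} (x : a ⟶ b) :
    cell x ▷ T.t ≫ b.φ = a.φ ≫ S.t ◁ cell x := Hom₂.comm x

theorem cell_ext {S T : Mnd D} {a b : S ⟶ T} {x y : a ⟶ b} (h : cell x = cell y) : x = y :=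
  Hom₂.ext h

theorem cell_id {S T : Mnd D} (a : S ⟶ T) : cell (𝟙 a) = 𝟙 a.f := rfl

theorem cell_comp {S T : Mnd D} {a b c : S ⟶ T} (x : a ⟶ b) (y : b ⟶ c) :
    cell (x ≫ y) = cell x ≫ cell y := rfl

/-- An invertible 2-cell between the underlying 1-cells that commutes with the structural 2-cells. -/
def isoMk {S T : Mnd D} {a b : S ⟶ T} (e : a.f ≅ b.f) (h : e.hom ▷ T.t ≫ b.φ = a.φ ≫ S.t ◁ e.hom) :
    a ≅ b where
  hom := Hom₂.mk e.hom h
  inv := Hom₂.mk e.inv (by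
    rw [← cancel_epi (e.hom ▷ T.t), ← Category.assoc, ← comp_whiskerRight, e.hom_inv_id,
      id_whiskerRight, Category.id_comp, ← Category.assoc, h, Category.assoc, ← whiskerLeft_comp,
      e.hom_inv_id, whiskerLeft_id, Category.comp_id])
  hom_inv_id := cell_ext e.hom_inv_id
  inv_hom_id := cell_ext e.inv_hom_id

/-- Left whiskering. -/
def wl {S T R : Mnd D} (a : S ⟶ T) {b b' : T ⟶ R} (x : b ⟶ b') : a ≫ b ⟶ a ≫ b' :=
  Hom₂.mk (a.f ◁ cell x) (by
    calc
      (a.f ◁ cell x) ▷ R.t ≫ (α_ a.f b'.f R.t).hom ≫ a.f ◁ b'.φ ≫ (α_ a.f T.t b'.f).inv ≫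
          a.φ ▷ b'.f ≫ (α_ S.t a.f b'.f).hom
        = (α_ a.f b.f R.t).hom ≫ a.f ◁ (cell x ▷ R.t ≫ b'.φ) ≫ (α_ a.f T.t b'.f).inv ≫
          a.φ ▷ b'.f ≫ (α_ S.t a.f b'.f).hom := by bicategory
      _ = (α_ a.f b.f R.t).hom ≫ a.f ◁ (b.φ ≫ T.t ◁ cell x) ≫ (α_ a.f T.t b'.f).inv ≫
          a.φ ▷ b'.f ≫ (α_ S.t a.f b'.f).hom := by rw [cell_comm]
      _ = (α_ a.f b.f R.t).hom ≫ a.f ◁ b.φ ≫ (α_ a.f T.t b.f).inv ≫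
          ((a.f ≫ T.t) ◁ cell x ≫ a.φ ▷ b'.f) ≫ (α_ S.t a.f b'.f).hom := by bicategory
      _ = (α_ a.f b.f R.t).hom ≫ a.f ◁ b.φ ≫ (α_ a.f T.t b.f).inv ≫
          (a.φ ▷ b.f ≫ (S.t ≫ a.f) ◁ cell x) ≫ (α_ S.t a.f b'.f).hom := by rw [whisker_exchange]
      _ = ((α_ a.f b.f R.t).hom ≫ a.f ◁ b.φ ≫ (α_ a.f T.t b.f).inv ≫ a.φ ▷ b.f ≫
          (α_ S.t a.f b.f).hom) ≫ S.t ◁ a.f ◁ cell x := by bicategory)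

/-- Right whiskering. -/
def wr {S T R : Mnd D} {a a' : S ⟶ T} (x : a ⟶ a') (b : T ⟶ R) : a ≫ b ⟶ a' ≫ b :=
  Hom₂.mk (cell x ▷ b.f) (by
    calc
      (cell x ▷ b.f) ▷ R.t ≫ (α_ a'.f b.f R.t).hom ≫ a'.f ◁ b.φ ≫ (α_ a'.f T.t b.f).inv ≫
          a'.φ ▷ b.f ≫ (α_ S.t a'.f b.f).hom
        = (α_ a.f b.f R.t).hom ≫ (cell x ▷ (b.f ≫ R.t) ≫ a'.f ◁ b.φ) ≫ (α_ a'.f T.t b.f).inv ≫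
          a'.φ ▷ b.f ≫ (α_ S.t a'.f b.f).hom := by bicategory
      _ = (α_ a.f b.f R.t).hom ≫ (a.f ◁ b.φ ≫ cell x ▷ (T.t ≫ b.f)) ≫ (α_ a'.f T.t b.f).inv ≫
          a'.φ ▷ b.f ≫ (α_ S.t a'.f b.f).hom := by rw [whisker_exchange]
      _ = (α_ a.f b.f R.t).hom ≫ a.f ◁ b.φ ≫ (α_ a.f T.t b.f).inv ≫
          (cell x ▷ T.t ≫ a'.φ) ▷ b.f ≫ (α_ S.t a'.f b.f).hom := by bicategory
      _ = (α_ a.f b.f R.t).hom ≫ a.f ◁ b.φ ≫ (α_ a.f T.t b.f).inv ≫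
          (a.φ ≫ S.t ◁ cell x) ▷ b.f ≫ (α_ S.t a'.f b.f).hom := by rw [cell_comm]
      _ = ((α_ a.f b.f R.t).hom ≫ a.f ◁ b.φ ≫ (α_ a.f T.t b.f).inv ≫ a.φ ▷ b.f ≫
          (α_ S.t a.f b.f).hom) ≫ S.t ◁ cell x ▷ b.f := by bicategory)

/-- The associator. -/
def associatorIso {S T Q R : Mnd D} (a : S ⟶ T) (b : T ⟶ Q) (c : Q ⟶ R) :
    (a ≫ b) ≫ c ≅ a ≫ b ≫ c :=
  isoMk (a := (a ≫ b) ≫ c) (b := a ≫ b ≫ c) (α_ a.f b.f c.f) (by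
    show (α_ a.f b.f c.f).hom ▷ R.t ≫ (α_ a.f (b.f ≫ c.f) R.t).hom ≫
        a.f ◁ ((α_ b.f c.f R.t).hom ≫ b.f ◁ c.φ ≫ (α_ _ _ _).inv ≫ b.φ ▷ c.f ≫ (α_ _ _ _).hom) ≫
        (α_ _ _ _).inv ≫ a.φ ▷ (b.f ≫ c.f) ≫ (α_ _ _ _).hom =
      ((α_ (a.f ≫ b.f) c.f R.t).hom ≫ (a.f ≫ b.f) ◁ c.φ ≫ (α_ _ _ _).inv ≫
        ((α_ _ _ _).hom ≫ a.f ◁ b.φ ≫ (α_ _ _ _).inv ≫ a.φ ▷ b.f ≫ (α_ _ _ _).hom) ▷ c.f ≫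
        (α_ _ _ _).hom) ≫ S.t ◁ (α_ a.f b.f c.f).hom
    bicategory)

/-- The left unitor. -/
def leftUnitorIso {S T : Mnd D} (a : S ⟶ T) : 𝟙 S ≫ a ≅ a :=
  isoMk (a := 𝟙 S ≫ a) (b := a) (λ_ a.f) (by
    show (λ_ a.f).hom ▷ T.t ≫ a.φ =
      ((α_ _ _ _).hom ≫ 𝟙 S.obj ◁ a.φ ≫ (α_ _ _ _).inv ≫ ((λ_ S.t).hom ≫ (ρ_ S.t).inv) ▷ a.f ≫
        (α_ _ _ _).hom) ≫ S.t ◁ (λ_ a.f).hom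
    bicategory)

/-- The right unitor. -/
def rightUnitorIso {S T : Mnd D} (a : S ⟶ T) : a ≫ 𝟙 T ≅ a :=
  isoMk (a := a ≫ 𝟙 T) (b := a) (ρ_ a.f) (by
    show (ρ_ a.f).hom ▷ T.t ≫ a.φ =
      ((α_ _ _ _).hom ≫ a.f ◁ ((λ_ T.t).hom ≫ (ρ_ T.t).inv) ≫ (α_ _ _ _).inv ≫ a.φ ▷ 𝟙 T.obj ≫
        (α_ _ _ _).hom) ≫ S.t ◁ (ρ_ a.f).hom
    bicategory)

/-- The 2-category of monads in a 2-category, their lax morphisms and 2-cells between these. -/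
instance : Bicategory (Mnd D) where
  whiskerLeft a _ _ x := wl a x
  whiskerRight x b := wr x b
  associator a b c := associatorIso a b c
  leftUnitor a := leftUnitorIso a
  rightUnitor a := rightUnitorIso a
  whiskerLeft_id a b := by apply cell_ext; exact whiskerLeft_id a.f b.f
  whiskerLeft_comp a _ _ _ x y := by apply cell_ext; exact whiskerLeft_comp a.f (cell x) (cell y)
  id_whiskerLeft x := by apply cell_ext; exact id_whiskerLeft (cell x)
  comp_whiskerLeft a b _ _ x := by apply cell_ext; exact comp_whiskerLeft a.f b.f (cell x)
  id_whiskerRight a b := by apply cell_ext; exact id_whiskerRight a.f b.f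
  comp_whiskerRight x y b := by apply cell_ext; exact comp_whiskerRight (cell x) (cell y) b.f
  whiskerRight_id x := by apply cell_ext; exact whiskerRight_id (cell x)
  whiskerRight_comp x a b := by apply cell_ext; exact whiskerRight_comp (cell x) a.f b.f
  whisker_assoc a _ _ x b := by apply cell_ext; exact whisker_assoc a.f (cell x) b.f
  whisker_exchange x y := by apply cell_ext; exact whisker_exchange (cell x) (cell y)
  pentagon a b c d := by apply cell_ext; exact pentagon a.f b.f c.f d.f
  triangle a b := by apply cell_ext; exact triangle a.f b.f

theorem hom_eq {S T : Mnd D} {a b : S ⟶ T} (x : a ⟶ b) (h : a.f = b.f) (hx : cell x = eqToHom h) :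
    a = b := by
  have hc := cell_comm x
  rw [hx] at hc
  clear hx x
  obtain ⟨f, φ, h₁, h₂⟩ := a
  obtain ⟨g, ψ, h₃, h₄⟩ := b
  obtain rfl : f = g := h
  simp at hc
  subst hc
  rfl

theorem cell_eqToHom {S T : Mnd D} {a b : S ⟶ T} (h : a = b) :
    cell (eqToHom h) = eqToHom (congrArg Hom.f h) := by
  subst h; rfl

theorem iso_eq {S T : Mnd D} {a b : S ⟶ T} (e : a ≅ b) (h : a = b)
    (he : cell e.hom = eqToHom (congrArg Hom.f h)) : e = eqToIso h := by
  apply Iso.ext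
  apply cell_ext
  rw [he, eqToIso.hom, cell_eqToHom]

/-- The identity monad on a 0-cell. -/
def idMonad (X : D) : Mnd D where
  obj := X
  t := 𝟙 X
  η := 𝟙 (𝟙 X)
  μ := (λ_ (𝟙 X)).hom
  left_unit := by simp
  right_unit := by simp [unitors_equal]
  assoc := by bicategory

/-- The morphism of identity monads given by a 1-cell. -/
def idMonadMap {X Y : D} (F : X ⟶ Y) : idMonad X ⟶ idMonad Y :=
  Hom.mk (S := idMonad X) (T := idMonad Y) F ((ρ_ F).hom ≫ (λ_ F).inv)
    (by
      show (ρ_ F).inv ≫ F ◁ 𝟙 (𝟙 Y) ≫ (ρ_ F).hom ≫ (λ_ F).inv = (λ_ F).inv ≫ 𝟙 (𝟙 X) ▷ F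
      simp) (by simp only [idMonad]; bicategory)

/-- The 2-cell between morphisms of identity monads given by a 2-cell. -/
def idMonadMap₂ {X Y : D} {F G : X ⟶ Y} (β : F ⟶ G) : idMonadMap F ⟶ idMonadMap G :=
  Hom₂.mk (a := idMonadMap F) (b := idMonadMap G) β (by
    show β ▷ 𝟙 Y ≫ (ρ_ G).hom ≫ (λ_ G).inv = ((ρ_ F).hom ≫ (λ_ F).inv) ≫ 𝟙 X ◁ β
    simp)

theorem idMonadMap_id (X : D) : idMonadMap (𝟙 X) = 𝟙 (idMonad X) :=
  hom_eq (a := idMonadMap (𝟙 X)) (b := 𝟙 (idMonad X))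
    (Hom₂.mk (a := idMonadMap (𝟙 X)) (b := 𝟙 (idMonad X)) (𝟙 (𝟙 X)) (by
      show 𝟙 (𝟙 X) ▷ 𝟙 X ≫ (λ_ (𝟙 X)).hom ≫ (ρ_ (𝟙 X)).inv =
        ((ρ_ (𝟙 X)).hom ≫ (λ_ (𝟙 X)).inv) ≫ 𝟙 X ◁ 𝟙 (𝟙 X)
      bicategory)) rfl rfl

theorem idMonadMap_comp {X Y Z : D} (F : X ⟶ Y) (G : Y ⟶ Z) :
    idMonadMap (F ≫ G) = idMonadMap F ≫ idMonadMap G :=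
  hom_eq (a := idMonadMap (F ≫ G)) (b := idMonadMap F ≫ idMonadMap G)
    (Hom₂.mk (a := idMonadMap (F ≫ G)) (b := idMonadMap F ≫ idMonadMap G) (𝟙 (F ≫ G)) (by
      show 𝟙 (F ≫ G) ▷ 𝟙 Z ≫ (α_ _ _ _).hom ≫ F ◁ ((ρ_ G).hom ≫ (λ_ G).inv) ≫ (α_ _ _ _).inv ≫
          ((ρ_ F).hom ≫ (λ_ F).inv) ▷ G ≫ (α_ _ _ _).hom =
        ((ρ_ (F ≫ G)).hom ≫ (λ_ (F ≫ G)).inv) ≫ 𝟙 X ◁ 𝟙 (F ≫ G)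
      bicategory)) rfl rfl

end

section

variable {D : Type u} [Bicategory.{w, v} D] [Bicategory.Strict D]

theorem cell_associator {S T Q R : Mnd D} (a : S ⟶ T) (b : T ⟶ Q) (c : Q ⟶ R) :
    cell (α_ a b c).hom = eqToHom (Strict.assoc a.f b.f c.f) :=
  congrArg Iso.hom (Strict.associator_eqToIso a.f b.f c.f)

theorem cell_leftUnitor {S T : Mnd D} (a : S ⟶ T) :
    cell (λ_ a).hom = eqToHom (Strict.id_comp a.f) :=
  congrArg Iso.hom (Strict.leftUnitor_eqToIso a.f)

theorem cell_rightUnitor {S T : Mnd D} (a : S ⟶ T) :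
    cell (ρ_ a).hom = eqToHom (Strict.comp_id a.f) :=
  congrArg Iso.hom (Strict.rightUnitor_eqToIso a.f)

instance : Bicategory.Strict (Mnd D) where
  id_comp a := hom_eq (λ_ a).hom _ (cell_leftUnitor a)
  comp_id a := hom_eq (ρ_ a).hom _ (cell_rightUnitor a)
  assoc a b c := hom_eq (α_ a b c).hom _ (cell_associator a b c)
  leftUnitor_eqToIso a := iso_eq _ _ (cell_leftUnitor a)
  rightUnitor_eqToIso a := iso_eq _ _ (cell_rightUnitor a)
  associator_eqToIso a b c := iso_eq _ _ (cell_associator a b c)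

/-- The 2-functor `ι : D ⥤ Mnd(D)` sending a 0-cell to the identity monad on it. -/
def iota : StrictPseudofunctor D (Mnd D) := StrictPseudofunctor.mk''
  { obj := idMonad
    map := idMonadMap
    map₂ := idMonadMap₂
    map₂_id := by
      intro a b f
      apply cell_ext
      rfl
    map₂_comp := by
      intro a b f g h x y
      apply cell_ext
      rfl
    map_id := idMonadMap_id
    map_comp := idMonadMap_comp
    map₂_whisker_left := by
      intro a b c f g g' x
      apply cell_ext
      rw [cell_comp, cell_comp, cell_eqToHom, cell_eqToHom]
      exact ((Category.id_comp _).trans (Category.comp_id _)).symm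
    map₂_whisker_right := by
      intro a b c f g x h
      apply cell_ext
      rw [cell_comp, cell_comp, cell_eqToHom, cell_eqToHom]
      exact ((Category.id_comp _).trans (Category.comp_id _)).symm }

end

end Mnd

/-! ### The monad of a 2-functor `𝚫 ⥤ D` -/

/-- The image of a monad under a 2-functor. -/
def Mnd.image {A : Type u₁} [Bicategory.{w₁, v₁} A] {D : Type u} [Bicategory.{w, v} D]
    (F : StrictPseudofunctor A D) (M : Mnd A) : Mnd D where
  obj := F.obj M.obj
  t := F.map M.t
  η := eqToHom (F.map_id M.obj).symm ≫ F.map₂ M.η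
  μ := eqToHom (F.map_comp M.t M.t).symm ≫ F.map₂ M.μ
  left_unit := by
    have h := congrArg F.map₂ M.left_unit
    rw [F.map₂_comp, F.map₂_left_unitor, F.map₂_whisker_right, F.mapComp_eq_eqToIso,
      F.mapComp_eq_eqToIso, F.mapId_eq_eqToIso, eqToIso.hom, eqToIso.hom, eqToIso.inv] at h
    rw [← cancel_epi (eqToHom (F.map_id M.obj) ▷ F.map M.t),
      ← cancel_epi (eqToHom (F.map_comp (𝟙 M.obj) M.t)), ← h]
    simp
  right_unit := by
    have h := congrArg F.map₂ M.right_unit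
    rw [F.map₂_comp, F.map₂_right_unitor, F.map₂_whisker_left, F.mapComp_eq_eqToIso,
      F.mapComp_eq_eqToIso, F.mapId_eq_eqToIso, eqToIso.hom, eqToIso.hom, eqToIso.inv] at h
    rw [← cancel_epi (F.map M.t ◁ eqToHom (F.map_id M.obj)),
      ← cancel_epi (eqToHom (F.map_comp M.t (𝟙 M.obj))), ← h]
    simp
  assoc := by
    have h := congrArg F.map₂ M.assoc
    rw [F.map₂_comp, F.map₂_comp, F.map₂_comp, F.map₂_associator, F.map₂_whisker_right,
      F.map₂_whisker_left] at h
    simp only [F.mapComp_eq_eqToIso, eqToIso.hom, eqToIso.inv] at h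
    rw [← cancel_epi (eqToHom (F.map_comp M.t M.t) ▷ F.map M.t),
      ← cancel_epi (eqToHom (F.map_comp (M.t ≫ M.t) M.t))]
    simp at h ⊢
    exact h

namespace Del

theorem hom_one_unique {m : Simp} (f g : m ⟶ (⟨1⟩ : Simp)) : f = g :=
  Simp.hom_ext fun i => by
    have h₁ : (Simp.fn f i).val < 1 := (Simp.fn f i).is_lt
    have h₂ : (Simp.fn g i).val < 1 := (Simp.fn g i).is_lt
    omega

/-- The generic monad in `𝚫`: the 1-cell `1` with `δ : 0 ⟶ 1` and `σ : 1 + 1 ⟶ 1`, the unique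
monotone functions. -/
def genericMonad : Mnd Del where
  obj := star
  t := (⟨1⟩ : Simp)
  η := show (⟨0⟩ : Simp) ⟶ ⟨1⟩ from
    (⟨fun _ => 0, fun _ _ _ => le_refl _⟩ : Fin 0 →o Fin 1)
  μ := show (⟨1 + 1⟩ : Simp) ⟶ ⟨1⟩ from
    (⟨fun _ => 0, fun _ _ _ => le_refl _⟩ : Fin (1 + 1) →o Fin 1)
  left_unit := hom_one_unique _ _
  right_unit := hom_one_unique _ _
  assoc := hom_one_unique _ _

end Del

/-- The monad `(𝐓(*), 𝐓(1), 𝐓(δ), 𝐓(σ))` corresponding to a 2-functor `𝐓 : 𝚫 ⥤ D`. -/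
def monadOf {D : Type u} [Bicategory.{w, v} D] (T : StrictPseudofunctor Del D) : Mnd D :=
  Mnd.image T Del.genericMonad

/-! ### The 2-functor `Subeq_T` -/

section Subeq

section

variable {D : Type u} [Bicategory.{w, v} D]

/-- A pair `(U, ξ)` subequalizing the monad `T`, i.e. a `T`-algebra with domain `X`. -/
@[ext]
structure SubeqCat (T : Mnd D) (X : D) where
  U : X ⟶ T.obj
  ξ : U ≫ T.t ⟶ U
  unit : U ◁ T.η ≫ ξ = (ρ_ U).hom
  mult : U ◁ T.μ ≫ ξ = (α_ U T.t T.t).inv ≫ ξ ▷ T.t ≫ ξ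

namespace SubeqCat

variable {T : Mnd D}

/-- A morphism of subequalizing pairs. -/
@[ext]
structure Hom {X : D} (x y : SubeqCat T X) where
  τ : x.U ⟶ y.U
  comm : x.ξ ≫ τ = τ ▷ T.t ≫ y.ξ

instance (X : D) : Category (SubeqCat T X) where
  Hom := Hom
  id x := { τ := 𝟙 x.U, comm := by simp }
  comp f g :=
    { τ := f.τ ≫ g.τ
      comm := by
        rw [← Category.assoc, f.comm, Category.assoc, g.comm, comp_whiskerRight, Category.assoc] }
  id_comp _ := Hom.ext (Category.id_comp _)
  comp_id _ := Hom.ext (Category.comp_id _)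
  assoc _ _ _ := Hom.ext (Category.assoc _ _ _)

/-- The underlying 2-cell. -/
def cell {X : D} {x y : SubeqCat T X} (f : x ⟶ y) : x.U ⟶ y.U := Hom.τ f

theorem cell_comm {X : D} {x y : SubeqCat T X} (f : x ⟶ y) :
    x.ξ ≫ cell f = cell f ▷ T.t ≫ y.ξ := Hom.comm f

theorem cell_ext {X : D} {x y : SubeqCat T X} {f g : x ⟶ y} (h : cell f = cell g) : f = g :=
  Hom.ext h

theorem cell_comp {X : D} {x y z : SubeqCat T X} (f : x ⟶ y) (g : y ⟶ z) :
    cell (f ≫ g) = cell f ≫ cell g := rfl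

theorem cell_eqToHom {X : D} {x y : SubeqCat T X} (h : x = y) :
    cell (eqToHom h) = eqToHom (congrArg U h) := by
  subst h; rfl

theorem cell_conj {X : D} {x x' y y' : SubeqCat T X} (e : x = x') (f : x' ⟶ y') (e' : y' = y) :
    cell (eqToHom e ≫ f ≫ eqToHom e') =
      eqToHom (congrArg U e) ≫ cell f ≫ eqToHom (congrArg U e') := by
  subst e e'; simp

theorem obj_ext {X : D} {x y : SubeqCat T X} (h : x.U = y.U)
    (hξ : x.ξ ≫ eqToHom h = eqToHom h ▷ T.t ≫ y.ξ) : x = y := by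
  obtain ⟨U, ξ, h₁, h₂⟩ := x
  obtain ⟨V, ζ, h₃, h₄⟩ := y
  obtain rfl : U = V := h
  simp at hξ
  subst hξ
  rfl

/-- Composition of a subequalizing pair with a 1-cell. -/
def pre {X Y : D} (F : X ⟶ Y) (x : SubeqCat T Y) : SubeqCat T X where
  U := F ≫ x.U
  ξ := (α_ F x.U T.t).hom ≫ F ◁ x.ξ
  unit := by
    calc
      _ = (α_ F x.U (𝟙 T.obj)).hom ≫ F ◁ (x.U ◁ T.η ≫ x.ξ) := by bicategory
      _ = (α_ F x.U (𝟙 T.obj)).hom ≫ F ◁ (ρ_ x.U).hom := by rw [x.unit]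
      _ = _ := by bicategory
  mult := by
    calc
      _ = (α_ F x.U (T.t ≫ T.t)).hom ≫ F ◁ (x.U ◁ T.μ ≫ x.ξ) := by bicategory
      _ = (α_ F x.U (T.t ≫ T.t)).hom ≫ F ◁ ((α_ x.U T.t T.t).inv ≫ x.ξ ▷ T.t ≫ x.ξ) := by
        rw [x.mult]
      _ = _ := by bicategory

/-- The functor `Subeq_T(F)`. -/
def map {X Y : D} (F : X ⟶ Y) : SubeqCat T Y ⥤ SubeqCat T X where
  obj x := pre F x
  map {x y} f := Hom.mk (x := pre F x) (y := pre F y) (F ◁ cell f) (by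
    calc
      ((α_ F x.U T.t).hom ≫ F ◁ x.ξ) ≫ F ◁ cell f
        = (α_ F x.U T.t).hom ≫ F ◁ (x.ξ ≫ cell f) := by simp
      _ = (α_ F x.U T.t).hom ≫ F ◁ (cell f ▷ T.t ≫ y.ξ) := by rw [cell_comm]
      _ = (F ◁ cell f) ▷ T.t ≫ (α_ F y.U T.t).hom ≫ F ◁ y.ξ := by bicategory)
  map_id x := by apply cell_ext; exact whiskerLeft_id _ _
  map_comp f g := by apply cell_ext; exact whiskerLeft_comp _ _ _

/-- The natural transformation `Subeq_T(β)`. -/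
def map₂ {X Y : D} {F G : X ⟶ Y} (β : F ⟶ G) : map (T := T) F ⟶ map G where
  app x := Hom.mk (x := pre F x) (y := pre G x) (β ▷ x.U) (by
    calc
      ((α_ F x.U T.t).hom ≫ F ◁ x.ξ) ≫ β ▷ x.U
        = (α_ F x.U T.t).hom ≫ F ◁ x.ξ ≫ β ▷ x.U := by simp
      _ = (α_ F x.U T.t).hom ≫ β ▷ (x.U ≫ T.t) ≫ G ◁ x.ξ := by rw [whisker_exchange]
      _ = β ▷ x.U ▷ T.t ≫ (α_ G x.U T.t).hom ≫ G ◁ x.ξ := by bicategory)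
  naturality x y f := by
    apply cell_ext
    exact whisker_exchange β (cell f)

theorem cell_map {X Y : D} (F : X ⟶ Y) {x y : SubeqCat T Y} (f : x ⟶ y) :
    cell ((map F).map f) = F ◁ cell f := rfl

theorem cell_map₂ {X Y : D} {F G : X ⟶ Y} (β : F ⟶ G) (x : SubeqCat T Y) :
    cell ((map₂ β).app x) = β ▷ x.U := rfl

theorem map₂_id {X Y : D} (F : X ⟶ Y) (x : SubeqCat T Y) :
    (map₂ (𝟙 F)).app x = 𝟙 ((map F).obj x) := by
  apply cell_ext
  exact id_whiskerRight _ _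

theorem map₂_comp {X Y : D} {F G H : X ⟶ Y} (β : F ⟶ G) (γ : G ⟶ H) (x : SubeqCat T Y) :
    (map₂ (β ≫ γ)).app x = (map₂ β).app x ≫ (map₂ γ).app x := by
  apply cell_ext
  exact comp_whiskerRight _ _ _

end SubeqCat

end

variable {D : Type u} [Bicategory.{w, v} D] [Bicategory.Strict D]

namespace SubeqCat

variable {T : Mnd D}

theorem map_id_obj (X : D) (x : SubeqCat T X) : (map (𝟙 X)).obj x = x :=
  obj_ext (Strict.id_comp x.U) (by
    have h : ((α_ (𝟙 X) x.U T.t).hom ≫ 𝟙 X ◁ x.ξ) ≫ (λ_ x.U).hom =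
        (λ_ x.U).hom ▷ T.t ≫ x.ξ := by bicategory
    rw [Strict.leftUnitor_eqToIso x.U] at h
    exact h)

theorem map_comp_obj {X Y Z : D} (F : X ⟶ Y) (G : Y ⟶ Z) (x : SubeqCat T Z) :
    (map (F ≫ G)).obj x = (map F).obj ((map G).obj x) :=
  obj_ext (Strict.assoc F G x.U) (by
    have h : ((α_ (F ≫ G) x.U T.t).hom ≫ (F ≫ G) ◁ x.ξ) ≫ (α_ F G x.U).hom =
        (α_ F G x.U).hom ▷ T.t ≫ (α_ F (G ≫ x.U) T.t).hom ≫
          F ◁ ((α_ G x.U T.t).hom ≫ G ◁ x.ξ) := by bicategory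
    rw [Strict.associator_eqToIso F G x.U] at h
    exact h)

theorem map_id_map (X : D) {x y : SubeqCat T X} (f : x ⟶ y) :
    (map (𝟙 X)).map f = eqToHom (map_id_obj X x) ≫ f ≫ eqToHom (map_id_obj X y).symm := by
  apply cell_ext
  rw [cell_conj, cell_map]
  exact id_whiskerLeft_strict _

theorem map_comp_map {X Y Z : D} (F : X ⟶ Y) (G : Y ⟶ Z) {x y : SubeqCat T Z} (f : x ⟶ y) :
    (map (F ≫ G)).map f = eqToHom (map_comp_obj F G x) ≫ (map F).map ((map G).map f) ≫
      eqToHom (map_comp_obj F G y).symm := by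
  apply cell_ext
  rw [cell_conj, cell_map, cell_map]
  exact whiskerLeft_comp_strict F G _

theorem map₂_whiskerLeft {X Y Z : D} (F : X ⟶ Y) {G G' : Y ⟶ Z} (β : G ⟶ G')
    (x : SubeqCat T Z) :
    (map₂ (F ◁ β)).app x = eqToHom (map_comp_obj F G x) ≫ (map F).map ((map₂ β).app x) ≫
      eqToHom (map_comp_obj F G' x).symm := by
  apply cell_ext
  rw [cell_conj, cell_map₂, cell_map, cell_map₂]
  exact whisker_assoc_strict_symm F β _

theorem map₂_whiskerRight {X Y Z : D} {F F' : X ⟶ Y} (β : F ⟶ F') (G : Y ⟶ Z)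
    (x : SubeqCat T Z) :
    (map₂ (β ▷ G)).app x = eqToHom (map_comp_obj F G x) ≫ (map₂ β).app ((map G).obj x) ≫
      eqToHom (map_comp_obj F' G x).symm := by
  apply cell_ext
  rw [cell_conj, cell_map₂, cell_map₂]
  exact whiskerRight_comp_strict_symm β G _

end SubeqCat

open SubeqCat in
/-- The 2-functor `Subeq_T : Dᵒᵖ ⥤ Cat`. -/
def Subeq (T : Mnd D) : StrictPseudofunctor Dᵒᵖ Cat.{w, max v w} :=
  mkContra (SubeqCat T) (@map _ _ T) (@map₂ _ _ T) (@map₂_id _ _ T) (@map₂_comp _ _ T)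
    (@map_id_obj _ _ _ T) (@map_id_map _ _ _ T) (@map_comp_obj _ _ _ T) (@map_comp_map _ _ _ T)
    (@map₂_whiskerLeft _ _ _ T) (@map₂_whiskerRight _ _ _ T)

end Subeq

/-! ### Eilenberg-Moore objects and weighted limits -/

section Limits

variable {D : Type u} [Bicategory.{w, v} D] [Bicategory.Strict D]

/-- The 2-functor `Mnd(ι(-), T) : Dᵒᵖ ⥤ Cat`. -/
abbrev MndIota (T : Mnd D) : StrictPseudofunctor Dᵒᵖ Cat.{w, max v w} := homFrom Mnd.iota T

/-- `E` is an Eilenberg-Moore object of `T`: it represents `Mnd(ι(-), T)`. -/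
def IsEMObject (T : Mnd D) (E : D) : Prop := Nonempty (TwoNatIso (represented E) (MndIota T))

/-- `T` admits an Eilenberg-Moore object: the 2-functor `Mnd(ι(-), T)` is representable. -/
def AdmitsEMObject (T : Mnd D) : Prop := ∃ E : D, IsEMObject T E

variable {I : Type u₁} [Bicategory.{w₁, v₁} I] [Bicategory.Strict I]

/-- `L` is a `W`-weighted limit of `𝐓`: it represents `Cone_W(𝐓)`. -/
def IsWeightedLimit (W : StrictPseudofunctor I Cat.{w₂, v₂}) (T : StrictPseudofunctor I D) (L : D) :
    Prop := Nonempty (TwoNatIso (represented L) (Cone W T))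

/-- `𝐓` has a `W`-weighted limit: the 2-functor `Cone_W(𝐓)` is representable. -/
def HasWeightedLimit (W : StrictPseudofunctor I Cat.{w₂, v₂}) (T : StrictPseudofunctor I D) :
    Prop := ∃ L : D, IsWeightedLimit W T L

end Limits

end EilenbergMoore

/-! The weight `Wl` is the free algebra-like object that makes the theorem true. A partial monotone
map `k → k'` defined on an initial segment is the same as a total monotone map `k → k' + 1`
(undefined points go to the new top), so `Π_l` is the Kleisli category of the monad `(-) + 1` on
`Δ`. Under the left action of `Δ` it is generated by the object `0` and the nowhere defined map
`counit : 1 + 0 → 0`: every `f` factors as `total f + 0` followed by `k' + counit` (`actHom_total`).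
Since maps into `0` are unique, `counit` satisfies the axioms of an algebra structure on `0`.

Because `𝚫` has one 0-cell, a cone with vertex `X` is a functor `Φ : Π_l → D(X, C)` strictly
compatible with the action. It yields the pair `U = Φ(0)`, `ξ = Φ(counit)`, and the factorization
above shows that this pair determines `Φ` (`toAlg_map`, `ofAlg_toAlg`). Conversely a pair `(U, ξ)`
defines `k ↦ T(k) ∘ U`, with `f` acting by `T(total f)` followed by `ξ`; the Kleisli formulas
`total_id` and `total_comp` turn functoriality into the two axioms on `ξ`. A modification is
likewise determined by its component at `0` (`cell_act`). This gives `Cone ≅ Subeq`. A lax morphism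
out of an identity monad has a structural 2-cell `T ∘ F ⇒ F ∘ 1`, which is again such a `ξ`; this
gives `Subeq ≅ Mnd(ι(-), T)`. The statements on representing objects follow by composing 2-natural
isomorphisms and by the Yoneda lemma (`isoOfRepresented`).

For the existence of a 2-functor corresponding to `T`, a monotone function is read from its top as a
lattice path of steps `skip` and `hit`, which are interpreted by `η` and `μ` (`interp`). The monad
laws give functoriality (`interp_comp`, `interp_id`), and `interp_sum_id`, `interp_id_sum` give
compatibility with whiskering.

Strict equations between 1-cells are often only propositional, so equations between 2-cells appear
conjugated by `eqToHom`; the lemmas ending in `_conj` move between the two sides of such equations.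
-/

namespace EilenbergMoore

open Bicategory

/-! ### Lattice path decomposition of monotone functions -/

namespace Simp

/-- A monotone function followed by the inclusion `n ⟶ n + 1` missing the top element. -/
def skip {m n : ℕ} (f : (⟨m⟩ : Simp) ⟶ ⟨n⟩) : (⟨m⟩ : Simp) ⟶ ⟨n + 1⟩ :=
  show Fin m →o Fin (n + 1) from
  { toFun := fun i => (fn f i).castSucc
    monotone' := fun _ _ h => (fn f).monotone h }

/-- The extension of a monotone function sending a new top element to the top element. -/
def hit {m n : ℕ} (f : (⟨m⟩ : Simp) ⟶ ⟨n + 1⟩) : (⟨m + 1⟩ : Simp) ⟶ ⟨n + 1⟩ :=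
  show Fin (m + 1) →o Fin (n + 1) from
  { toFun := fun i => if h : i.val < m then fn f ⟨i.val, h⟩ else Fin.last n
    monotone' := by
      intro i j hij
      have hij' : i.val ≤ j.val := hij
      dsimp only
      by_cases hj : j.val < m
      · rw [dif_pos hj, dif_pos (by omega)]
        exact (fn f).monotone hij'
      · rw [dif_neg hj]
        exact Fin.le_last _ }

/-- The corestriction of a monotone function that misses the top element. -/
def lower {m n : ℕ} (f : (⟨m⟩ : Simp) ⟶ ⟨n + 1⟩) (h : ∀ i, (fn f i).val < n) :
    (⟨m⟩ : Simp) ⟶ ⟨n⟩ :=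
  show Fin m →o Fin n from
  { toFun := fun i => ⟨(fn f i).val, h i⟩
    monotone' := fun _ _ h => (fn f).monotone h }

/-- The restriction of a monotone function to the complement of the top element. -/
def restrict {m n : ℕ} (f : (⟨m + 1⟩ : Simp) ⟶ ⟨n⟩) : (⟨m⟩ : Simp) ⟶ ⟨n⟩ :=
  show Fin m →o Fin n from
  { toFun := fun i => fn f (Fin.castSucc i)
    monotone' := fun _ _ h => (fn f).monotone h }

theorem fn_skip {m n : ℕ} (f : (⟨m⟩ : Simp) ⟶ ⟨n⟩) (i : Fin m) :
    (fn (skip f) i).val = (fn f i).val := rfl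

theorem fn_hit_of_lt {m n : ℕ} (f : (⟨m⟩ : Simp) ⟶ ⟨n + 1⟩) (i : Fin (m + 1)) (h : i.val < m) :
    (fn (hit f) i).val = (fn f ⟨i.val, h⟩).val :=
  congrArg Fin.val (dif_pos h)

theorem fn_hit_of_not_lt {m n : ℕ} (f : (⟨m⟩ : Simp) ⟶ ⟨n + 1⟩) (i : Fin (m + 1))
    (h : ¬ i.val < m) : (fn (hit f) i).val = n :=
  congrArg Fin.val (dif_neg h)

theorem skip_lower {m n : ℕ} (f : (⟨m⟩ : Simp) ⟶ ⟨n + 1⟩) (h : ∀ i, (fn f i).val < n) :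
    skip (lower f h) = f := hom_ext fun _ => rfl

theorem lower_skip {m n : ℕ} (f : (⟨m⟩ : Simp) ⟶ ⟨n⟩) (h : ∀ i, (fn (skip f) i).val < n) :
    lower (skip f) h = f := hom_ext fun _ => rfl

theorem restrict_hit {m n : ℕ} (f : (⟨m⟩ : Simp) ⟶ ⟨n + 1⟩) : restrict (hit f) = f :=
  hom_ext fun i => fn_hit_of_lt f (Fin.castSucc i) i.is_lt

theorem hit_restrict {m n : ℕ} (f : (⟨m + 1⟩ : Simp) ⟶ ⟨n + 1⟩)
    (h : (fn f (Fin.last m)).val = n) : hit (restrict f) = f := by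
  refine hom_ext fun i => ?_
  change Fin (m + 1) at i
  by_cases hi : i.val < m
  · rw [fn_hit_of_lt _ _ hi]; rfl
  · rw [fn_hit_of_not_lt _ _ hi]
    exact h.symm.trans (fn_congr f (by simp only [Fin.val_last]; have := i.is_lt; omega))

/-- By monotonicity the value at the last point is the largest one, so missing the top there means
missing it everywhere. -/
theorem lt_of_last_ne {m n : ℕ} (f : (⟨m + 1⟩ : Simp) ⟶ ⟨n + 1⟩)
    (h : (fn f (Fin.last m)).val ≠ n) (i : Fin (m + 1)) : (fn f i).val < n := by
  have h₁ : (fn f i).val ≤ (fn f (Fin.last m)).val := (fn f).monotone (Fin.le_last i)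
  have h₂ : (fn f (Fin.last m)).val < n + 1 := (fn f (Fin.last m)).is_lt
  omega

/-- A monotone function into `n + 1` either misses the top element or sends the top element to the
top element. -/
theorem eq_skip_or_eq_hit {m n : ℕ} (f : (⟨m + 1⟩ : Simp) ⟶ ⟨n + 1⟩) :
    (∃ g, f = skip g) ∨ ∃ g, f = hit g := by
  by_cases h : (fn f (Fin.last m)).val = n
  · exact Or.inr ⟨_, (hit_restrict f h).symm⟩
  · exact Or.inl ⟨_, (skip_lower f (lt_of_last_ne f h)).symm⟩

theorem eq_skip_of_zero {n : ℕ} (f : (⟨0⟩ : Simp) ⟶ ⟨n + 1⟩) : ∃ g, f = skip g :=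
  ⟨_, (skip_lower f fun i => i.elim0).symm⟩

/-- Induction along the lattice path of a monotone function. -/
theorem path_induction {motive : ∀ m n : ℕ, ((⟨m⟩ : Simp) ⟶ ⟨n⟩) → Prop}
    (nil : motive 0 0 (𝟙 _)) (skip : ∀ m n f, motive m n f → motive m (n + 1) (skip f))
    (hit : ∀ m n f, motive m (n + 1) f → motive (m + 1) (n + 1) (hit f)) :
    ∀ m n f, motive m n f
  | 0, 0, f => by
    rw [show f = 𝟙 _ from hom_ext fun i => i.elim0]; exact nil
  | m + 1, 0, f => (fn f 0).elim0
  | 0, n + 1, f => by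
    obtain ⟨g, rfl⟩ := eq_skip_of_zero f
    exact skip _ _ g (path_induction nil skip hit 0 n g)
  | m + 1, n + 1, f => by
    obtain ⟨g, rfl⟩ | ⟨g, rfl⟩ := eq_skip_or_eq_hit f
    · exact skip _ _ g (path_induction nil skip hit (m + 1) n g)
    · exact hit _ _ g (path_induction nil skip hit m (n + 1) g)

/-! ### Composites and ordinal sums of lattice paths -/

theorem comp_skip {m n k : ℕ} (f : (⟨m⟩ : Simp) ⟶ ⟨n⟩) (g : (⟨n⟩ : Simp) ⟶ ⟨k⟩) :
    f ≫ skip g = skip (f ≫ g) := rfl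

/-- The point added by `hit` is the one avoided by `skip`. Interpreted in a monad, this cancellation
is a unit law. -/
theorem skip_comp_hit {m n k : ℕ} (f : (⟨m⟩ : Simp) ⟶ ⟨n⟩) (g : (⟨n⟩ : Simp) ⟶ ⟨k + 1⟩) :
    skip f ≫ hit g = f ≫ g :=
  hom_ext fun i => fn_hit_of_lt g (fn f i).castSucc (fn f i).is_lt

/-- Both maps send top to top, hence so does the composite. Interpreted in a monad, this is
associativity. -/
theorem hit_comp_hit {m n k : ℕ} (f : (⟨m⟩ : Simp) ⟶ ⟨n + 1⟩) (g : (⟨n⟩ : Simp) ⟶ ⟨k + 1⟩) :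
    hit f ≫ hit g = hit (f ≫ hit g) := by
  refine hom_ext fun i => ?_
  change Fin (m + 1) at i
  by_cases hi : i.val < m
  · rw [fn_hit_of_lt _ _ hi, fn_comp, fn_comp]
    exact fn_congr _ (fn_hit_of_lt f i hi)
  · rw [fn_hit_of_not_lt _ _ hi, fn_comp]
    exact fn_hit_of_not_lt g _ (by rw [fn_hit_of_not_lt f i hi]; omega)

/-- The ordinal sum of monotone functions between standard finite ordinals. -/
def sum {m m' n n' : ℕ} (f : (⟨m⟩ : Simp) ⟶ ⟨m'⟩) (g : (⟨n⟩ : Simp) ⟶ ⟨n'⟩) :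
    (⟨m + n⟩ : Simp) ⟶ ⟨m' + n'⟩ := addHom f g

theorem fn_sum_of_lt {m m' n n' : ℕ} (f : (⟨m⟩ : Simp) ⟶ ⟨m'⟩) (g : (⟨n⟩ : Simp) ⟶ ⟨n'⟩)
    (i : Fin (m + n)) (h : i.val < m) : (fn (sum f g) i).val = (fn f ⟨i.val, h⟩).val :=
  (fn_addHom_val f g i).trans (dif_pos h)

theorem fn_sum_of_not_lt {m m' n n' : ℕ} (f : (⟨m⟩ : Simp) ⟶ ⟨m'⟩) (g : (⟨n⟩ : Simp) ⟶ ⟨n'⟩)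
    (i : Fin (m + n)) (h : ¬ i.val < m) :
    (fn (sum f g) i).val = m' + (fn g ⟨i.val - m, by dsimp only; omega⟩).val :=
  (fn_addHom_val f g i).trans (dif_neg h)

theorem sum_id_zero {m n : ℕ} (f : (⟨m⟩ : Simp) ⟶ ⟨n⟩) : sum f (𝟙 (⟨0⟩ : Simp)) = f :=
  hom_ext fun i => fn_sum_of_lt f (𝟙 (⟨0⟩ : Simp)) i i.is_lt

/-- An identity strand on top costs two steps of the path: a new target point (`skip`), then a new
source point sent to it (`hit`). -/
theorem sum_id_succ {m n : ℕ} (f : (⟨m⟩ : Simp) ⟶ ⟨n⟩) (k : ℕ) :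
    sum f (𝟙 (⟨k + 1⟩ : Simp)) =
      hit (m := m + k) (n := n + k) (skip (sum f (𝟙 (⟨k⟩ : Simp)))) := by
  refine hom_ext fun (i : Fin (m + k + 1)) => ?_
  have hi := i.is_lt
  by_cases h₁ : i.val < m
  · refine (fn_sum_of_lt f (𝟙 (⟨k + 1⟩ : Simp)) i h₁).trans (Eq.trans ?_ (fn_hit_of_lt _ i (by omega)).symm)
    exact (fn_sum_of_lt f (𝟙 (⟨k⟩ : Simp)) ⟨i.val, by omega⟩ h₁).symm
  · refine (fn_sum_of_not_lt f (𝟙 (⟨k + 1⟩ : Simp)) i h₁).trans ?_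
    rw [fn_id]
    by_cases h₂ : i.val < m + k
    · refine Eq.trans ?_ (fn_hit_of_lt _ i h₂).symm
      exact (fn_sum_of_not_lt f (𝟙 (⟨k⟩ : Simp)) ⟨i.val, h₂⟩ h₁).symm
    · refine Eq.trans ?_ (fn_hit_of_not_lt _ i h₂).symm
      dsimp only
      omega

theorem sum_id_id (m n : ℕ) : sum (𝟙 (⟨m⟩ : Simp)) (𝟙 (⟨n⟩ : Simp)) = 𝟙 (⟨m + n⟩ : Simp) :=
  addHom_id _ _

/-- Paths are read from the top, so a block added below leaves their steps unchanged; the same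
reason gives `id_sum_hit`. -/
theorem id_sum_skip (k : ℕ) {m n : ℕ} (f : (⟨m⟩ : Simp) ⟶ ⟨n⟩) :
    sum (𝟙 (⟨k⟩ : Simp)) (skip f) = skip (n := k + n) (sum (𝟙 (⟨k⟩ : Simp)) f) := by
  refine hom_ext fun (i : Fin (k + m)) => ?_
  refine Eq.trans ?_ (fn_skip (n := k + n) _ i).symm
  by_cases h : i.val < k
  · exact (fn_sum_of_lt _ _ i h).trans (fn_sum_of_lt (𝟙 (⟨k⟩ : Simp)) f i h).symm
  · exact (fn_sum_of_not_lt _ _ i h).trans (fn_sum_of_not_lt (𝟙 (⟨k⟩ : Simp)) f i h).symm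

theorem id_sum_hit (k : ℕ) {m n : ℕ} (f : (⟨m⟩ : Simp) ⟶ ⟨n + 1⟩) :
    sum (𝟙 (⟨k⟩ : Simp)) (hit f) =
      hit (m := k + m) (n := k + n) (sum (n' := n + 1) (𝟙 (⟨k⟩ : Simp)) f) := by
  refine hom_ext fun (i : Fin (k + m + 1)) => ?_
  have hi := i.is_lt
  by_cases h₁ : i.val < k
  · refine (fn_sum_of_lt (𝟙 (⟨k⟩ : Simp)) (hit f) i h₁).trans (Eq.trans ?_ (fn_hit_of_lt _ i (by omega)).symm)
    exact (fn_sum_of_lt (𝟙 (⟨k⟩ : Simp)) f ⟨i.val, by omega⟩ h₁).symm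
  · refine (fn_sum_of_not_lt (𝟙 (⟨k⟩ : Simp)) (hit f) i h₁).trans ?_
    by_cases h₂ : i.val < k + m
    · refine Eq.trans ?_ (fn_hit_of_lt _ i h₂).symm
      rw [fn_hit_of_lt _ _ (by dsimp only; omega)]
      exact (fn_sum_of_not_lt (𝟙 (⟨k⟩ : Simp)) f ⟨i.val, h₂⟩ h₁).symm
    · refine Eq.trans ?_ (fn_hit_of_not_lt _ i h₂).symm
      rw [fn_hit_of_not_lt _ _ (by dsimp only; omega)]

end Simp

/-! ### The 2-functor corresponding to a monad -/

namespace Mnd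

section

variable {D : Type u} [Bicategory.{w, v} D] (T : Mnd D)

/-- The unit of a monad, whiskered by a 1-cell. -/
def unitAt {Y : D} (p : T.obj ⟶ Y) : p ⟶ T.t ≫ p :=
  (λ_ p).inv ≫ whiskerRight (f := 𝟙 T.obj) (g := T.t) T.η p

/-- The multiplication of a monad, whiskered by a 1-cell. -/
def multAt {Y : D} (p : T.obj ⟶ Y) : T.t ≫ T.t ≫ p ⟶ T.t ≫ p :=
  (α_ T.t T.t p).inv ≫ whiskerRight (f := T.t ≫ T.t) (g := T.t) T.μ p

/-- `unitAt` and `multAt` are the unit and multiplication of the monad `T.t ≫ -` on the category of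
1-cells `T.obj ⟶ Y`. The two naturalities and the three laws that follow are all that `interp_comp`
and `interp_id` need from `T`. -/
theorem unitAt_naturality {Y : D} {p q : T.obj ⟶ Y} (x : p ⟶ q) :
    T.unitAt p ≫ T.t ◁ x = x ≫ T.unitAt q := by
  simp only [unitAt]
  rw [Category.assoc, ← whisker_exchange]
  simp

theorem multAt_naturality {Y : D} {p q : T.obj ⟶ Y} (x : p ⟶ q) :
    T.multAt p ≫ T.t ◁ x = T.t ◁ T.t ◁ x ≫ T.multAt q := by
  simp only [multAt]
  rw [Category.assoc, ← whisker_exchange]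
  simp

theorem unitAt_multAt {Y : D} (p : T.obj ⟶ Y) : T.unitAt (T.t ≫ p) ≫ T.multAt p = 𝟙 _ := by
  have h : whiskerRight (f := 𝟙 T.obj) (g := T.t) T.η T.t ≫ T.μ = (λ_ T.t).hom := T.left_unit
  calc
    _ = (λ_ (T.t ≫ p)).inv ≫ (α_ (𝟙 _) T.t p).inv ≫
        (whiskerRight (f := 𝟙 T.obj) (g := T.t) T.η T.t ≫ T.μ) ▷ p := by
      simp only [unitAt, multAt]; bicategory
    _ = _ := by rw [h]; bicategory

theorem whiskerLeft_unitAt_multAt {Y : D} (p : T.obj ⟶ Y) :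
    T.t ◁ T.unitAt p ≫ T.multAt p = 𝟙 _ := by
  have h : whiskerLeft T.t (g := 𝟙 T.obj) (h := T.t) T.η ≫ T.μ = (ρ_ T.t).hom := T.right_unit
  calc
    _ = T.t ◁ (λ_ p).inv ≫ (α_ T.t (𝟙 _) p).inv ≫
        (whiskerLeft T.t (g := 𝟙 T.obj) (h := T.t) T.η ≫ T.μ) ▷ p := by
      simp only [unitAt, multAt]; bicategory
    _ = _ := by rw [h]; bicategory

theorem multAt_multAt {Y : D} (p : T.obj ⟶ Y) :
    T.multAt (T.t ≫ p) ≫ T.multAt p = T.t ◁ T.multAt p ≫ T.multAt p := by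
  have h : whiskerRight (f := T.t ≫ T.t) (g := T.t) T.μ T.t ≫ T.μ =
    (α_ T.t T.t T.t).hom ≫ whiskerLeft T.t (g := T.t ≫ T.t) (h := T.t) T.μ ≫ T.μ := T.assoc
  calc
    _ = (α_ T.t T.t (T.t ≫ p)).inv ≫ (α_ (T.t ≫ T.t) T.t p).inv ≫
        (whiskerRight (f := T.t ≫ T.t) (g := T.t) T.μ T.t ≫ T.μ) ▷ p := by
      simp only [multAt]; bicategory
    _ = _ := by rw [h]; simp only [multAt]; bicategory

/-! ### Powers of a monad and the interpretation of monotone functions -/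

/-- The powers of the underlying 1-cell of a monad. -/
def pow : ℕ → (T.obj ⟶ T.obj)
  | 0 => 𝟙 T.obj
  | n + 1 => T.t ≫ pow n

/-- Whiskering a 2-cell between powers with the monad. -/
def lift {m n : ℕ} (x : T.pow m ⟶ T.pow n) : T.pow (m + 1) ⟶ T.pow (n + 1) := T.t ◁ x

/-- The unit, as a 2-cell between powers. -/
def powUnit (n : ℕ) : T.pow n ⟶ T.pow (n + 1) := T.unitAt (T.pow n)

/-- The multiplication, as a 2-cell between powers. -/
def powMult (n : ℕ) : T.pow (n + 1 + 1) ⟶ T.pow (n + 1) := T.multAt (T.pow n)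

theorem lift_comp {m n k : ℕ} (x : T.pow m ⟶ T.pow n) (y : T.pow n ⟶ T.pow k) :
    T.lift (x ≫ y) = T.lift x ≫ T.lift y := whiskerLeft_comp _ _ _

theorem powUnit_naturality {m n : ℕ} (x : T.pow m ⟶ T.pow n) :
    T.powUnit m ≫ T.lift x = x ≫ T.powUnit n := T.unitAt_naturality x

theorem powMult_naturality {m n : ℕ} (x : T.pow m ⟶ T.pow n) :
    T.powMult m ≫ T.lift x = T.lift (T.lift x) ≫ T.powMult n := T.multAt_naturality x

theorem powUnit_powMult (n : ℕ) : T.powUnit (n + 1) ≫ T.powMult n = 𝟙 (T.pow (n + 1)) :=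
  T.unitAt_multAt (T.pow n)

theorem lift_powUnit_powMult (n : ℕ) :
    T.lift (T.powUnit n) ≫ T.powMult n = 𝟙 (T.pow (n + 1)) :=
  T.whiskerLeft_unitAt_multAt (T.pow n)

theorem powMult_powMult (n : ℕ) :
    T.powMult (n + 1) ≫ T.powMult n = T.lift (T.powMult n) ≫ T.powMult n :=
  T.multAt_multAt (T.pow n)

/-- The 2-cell between powers of a monad given by a monotone function. -/
def interp : (m n : ℕ) → ((⟨m⟩ : Simp) ⟶ ⟨n⟩) → (T.pow m ⟶ T.pow n)
  | 0, 0, _ => 𝟙 _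
  | _ + 1, 0, f => (Simp.fn f 0).elim0
  | 0, n + 1, f => interp 0 n (Simp.lower f fun i => i.elim0) ≫ T.powUnit n
  -- If the last point goes to the top, the path ends in a `hit` and the two innermost factors are
  -- multiplied; otherwise it ends in a `skip` and the innermost factor is inserted by the unit.
  | m + 1, n + 1, f =>
    if h : (Simp.fn f (Fin.last m)).val = n then T.lift (interp m (n + 1) (Simp.restrict f)) ≫ T.powMult n
    else interp (m + 1) n (Simp.lower f (Simp.lt_of_last_ne f h)) ≫ T.powUnit n

theorem interp_zero_zero (f : (⟨0⟩ : Simp) ⟶ ⟨0⟩) : T.interp 0 0 f = 𝟙 _ := by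
  rw [interp]

theorem interp_skip {m n : ℕ} (f : (⟨m⟩ : Simp) ⟶ ⟨n⟩) :
    T.interp m (n + 1) (Simp.skip f) = T.interp m n f ≫ T.powUnit n := by
  cases m with
  | zero => rw [interp, Simp.lower_skip]
  | succ m =>
    have h : ¬ (Simp.fn (Simp.skip f) (Fin.last m)).val = n := by
      rw [Simp.fn_skip]; exact Nat.ne_of_lt (Simp.fn f _).is_lt
    rw [interp, dif_neg h, Simp.lower_skip]

theorem interp_hit {m n : ℕ} (f : (⟨m⟩ : Simp) ⟶ ⟨n + 1⟩) :
    T.interp (m + 1) (n + 1) (Simp.hit f) = T.lift (T.interp m (n + 1) f) ≫ T.powMult n := by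
  rw [interp, dif_pos (Simp.fn_hit_of_not_lt f (Fin.last m) (by simp)), Simp.restrict_hit]

/-- Induction along the path of `g`, for all `f` at once. Only a final `hit` of `g` is a real case:
it meets either a `skip` of `f`, settled by the left unit law, or a `hit` of `f`, settled by
associativity. -/
theorem interp_comp {m n k : ℕ} (f : (⟨m⟩ : Simp) ⟶ ⟨n⟩) (g : (⟨n⟩ : Simp) ⟶ ⟨k⟩) :
    T.interp m k (f ≫ g) = T.interp m n f ≫ T.interp n k g := by
  revert m
  refine Simp.path_induction (motive := fun n k g => ∀ {m : ℕ} (f : (⟨m⟩ : Simp) ⟶ ⟨n⟩),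
    T.interp m k (f ≫ g) = T.interp m n f ≫ T.interp n k g) ?_ ?_ ?_ n k g
  · intro m f
    rw [interp_zero_zero, Category.comp_id, Category.comp_id]
  · intro n k g ih m f
    rw [Simp.comp_skip, interp_skip, interp_skip, ih, Category.assoc]
  · intro n k g ih m
    -- The inserted unit slides past the interpretation of `g` by naturality and is then absorbed by
    -- the multiplication.
    have key : ∀ {m : ℕ} (f : (⟨m⟩ : Simp) ⟶ ⟨n⟩), T.interp m (k + 1) (Simp.skip f ≫ Simp.hit g) =
        T.interp m (n + 1) (Simp.skip f) ≫ T.interp (n + 1) (k + 1) (Simp.hit g) := by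
      intro m f
      rw [Simp.skip_comp_hit, ih, interp_skip, interp_hit, Category.assoc,
        ← Category.assoc (T.powUnit n), powUnit_naturality, Category.assoc, powUnit_powMult,
        Category.comp_id]
    induction m with
    | zero =>
      intro f
      obtain ⟨f, rfl⟩ := Simp.eq_skip_of_zero f
      exact key f
    | succ m ihm =>
      intro f
      obtain ⟨f, rfl⟩ | ⟨f, rfl⟩ := Simp.eq_skip_or_eq_hit f
      · exact key f
      -- Here the composite keeps `hit g` as its second factor while the first loses a point, which
      -- is why an inner induction on `m` is needed.
      · rw [Simp.hit_comp_hit, interp_hit, interp_hit, ihm, interp_hit, Category.assoc,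
          ← Category.assoc (T.powMult n), powMult_naturality, Category.assoc, powMult_powMult,
          lift_comp, lift_comp]
        simp only [Category.assoc]

theorem lift_id (n : ℕ) : T.lift (𝟙 (T.pow n)) = 𝟙 (T.pow (n + 1)) := whiskerLeft_id _ _

/-- The path of an identity alternates `skip` and `hit`, so each strand contributes a unit followed
by a multiplication; these cancel by the right unit law, the one not used in `interp_comp`. -/
theorem interp_id (n : ℕ) : T.interp n n (𝟙 _) = 𝟙 _ := by
  induction n with
  | zero => exact T.interp_zero_zero _
  | succ n ih =>
    have h : 𝟙 (⟨n + 1⟩ : Simp) = Simp.hit (Simp.skip (𝟙 (⟨n⟩ : Simp))) := by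
      refine Simp.hom_ext fun (i : Fin (n + 1)) => ?_
      by_cases hi : i.val < n
      · exact (Simp.fn_hit_of_lt (Simp.skip (𝟙 (⟨n⟩ : Simp))) i hi).symm
      · refine Eq.trans ?_ (Simp.fn_hit_of_not_lt _ i hi).symm
        rw [Simp.fn_id]
        have := i.is_lt
        omega
    rw [h, interp_hit, interp_skip, ih, Category.id_comp, lift_powUnit_powMult]

/-- Needed because `T.pow 1` is `T.t ≫ 𝟙 T.obj`, which strictness identifies with `T.t` only
propositionally. -/
theorem eq_of_conj {a : D} {t t' : a ⟶ a} (h : t = t') {η : 𝟙 a ⟶ t} {η' : 𝟙 a ⟶ t'}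
    {μ : t ≫ t ⟶ t} {μ' : t' ≫ t' ⟶ t'} (hη : η ≫ eqToHom h = η')
    (hμ : μ ≫ eqToHom h = eqToHom (congrArg₂ (· ≫ ·) h h) ≫ μ') (h₁ h₂ h₃ h₁' h₂' h₃') :
    (⟨a, t, η, μ, h₁, h₂, h₃⟩ : Mnd D) = ⟨a, t', η', μ', h₁', h₂', h₃'⟩ := by
  subst h
  obtain rfl : η = η' := by simpa using hη
  obtain rfl : μ = μ' := by simpa using hμ
  rfl

theorem interp_zero_one (f : (⟨0⟩ : Simp) ⟶ ⟨1⟩) : T.interp 0 1 f = T.powUnit 0 := by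
  rw [Del.hom_one_unique f (Simp.skip (𝟙 _)), interp_skip, interp_id, Category.id_comp]

theorem interp_two_one (f : (⟨1 + 1⟩ : Simp) ⟶ ⟨1⟩) : T.interp (1 + 1) 1 f = T.powMult 0 := by
  have h : f = Simp.hit (m := 1) (n := 0) (𝟙 (⟨1⟩ : Simp)) := Del.hom_one_unique _ _
  rw [h]
  refine (T.interp_hit (m := 1) (n := 0) _).trans ?_
  refine (congrArg (fun x => T.lift x ≫ _) (T.interp_id 1)).trans ?_
  rw [lift_id, Category.id_comp]

end

/-! ### Compatibility with ordinal sums and the resulting 2-functor -/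

section Strict

variable {D : Type u} [Bicategory.{w, v} D] [Bicategory.Strict D] (T : Mnd D)

/-- The 1-cell `q` is kept free so that it can be `T.pow (k + m)`, whose factorization `T.pow_add`
is a propositional equality. -/
theorem unitAt_comp {Y Z : D} (p : T.obj ⟶ Y) (r : Y ⟶ Z) {q : T.obj ⟶ Z} (h : q = p ≫ r) :
    T.unitAt q = eqToHom h ≫ T.unitAt p ▷ r ≫
      eqToHom ((Strict.assoc _ _ _).trans (congrArg (T.t ≫ ·) h.symm)) := by
  subst h
  simp [unitAt, Strict.associator_eqToIso, Strict.leftUnitor_eqToIso]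

theorem multAt_comp {Y Z : D} (p : T.obj ⟶ Y) (r : Y ⟶ Z) {q : T.obj ⟶ Z} (h : q = p ≫ r) :
    T.multAt q = eqToHom (by rw [h]; simp only [Strict.assoc]) ≫ T.multAt p ▷ r ≫
      eqToHom ((Strict.assoc _ _ _).trans (congrArg (T.t ≫ ·) h.symm)) := by
  subst h
  simp [multAt, Strict.associator_eqToIso]

theorem whiskerLeft_conj_whiskerRight {X Y Z V : D} (t : X ⟶ Y) {p p' : Y ⟶ Z} (x : p ⟶ p')
    (r : Z ⟶ V) {q q' : Y ⟶ V} (h : q = p ≫ r) (h' : q' = p' ≫ r) :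
    t ◁ (eqToHom h ≫ x ▷ r ≫ eqToHom h'.symm) =
      eqToHom ((congrArg (t ≫ ·) h).trans (Strict.assoc _ _ _).symm) ≫ (t ◁ x) ▷ r ≫
        eqToHom ((Strict.assoc _ _ _).trans (congrArg (t ≫ ·) h'.symm)) := by
  subst h h'
  simp [Strict.associator_eqToIso]

/-- The order is reversed because the upper summand is the 1-cell applied first, in agreement with
`g ∘ f = g + f` in `𝚫`. -/
theorem pow_add (m n : ℕ) : T.pow (m + n) = T.pow n ≫ T.pow m := by
  induction n with
  | zero => exact (Strict.id_comp _).symm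
  | succ n ih => exact (congrArg (T.t ≫ ·) ih).trans (Strict.assoc _ _ _).symm

theorem powUnit_add (k m : ℕ) : T.powUnit (k + m) = eqToHom (T.pow_add k m) ≫
    T.powUnit m ▷ T.pow k ≫ eqToHom (T.pow_add k (m + 1)).symm :=
  T.unitAt_comp (T.pow m) (T.pow k) (T.pow_add k m)

theorem powMult_add (k m : ℕ) : T.powMult (k + m) = eqToHom (T.pow_add k (m + 1 + 1)) ≫
    T.powMult m ▷ T.pow k ≫ eqToHom (T.pow_add k (m + 1)).symm :=
  T.multAt_comp (T.pow m) (T.pow k) (T.pow_add k m)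

theorem lift_conj {m n k : ℕ} (x : T.pow m ⟶ T.pow n) :
    T.lift (m := k + m) (n := k + n)
        (eqToHom (T.pow_add k m) ≫ x ▷ T.pow k ≫ eqToHom (T.pow_add k n).symm) =
      eqToHom (T.pow_add k (m + 1)) ≫ T.lift x ▷ T.pow k ≫ eqToHom (T.pow_add k (n + 1)).symm :=
  whiskerLeft_conj_whiskerRight _ _ _ (T.pow_add k m) (T.pow_add k n)

theorem whiskerLeft_conj_whiskerLeft {X Y Z V : D} (t : X ⟶ Y) (r : Y ⟶ Z) {p p' : Z ⟶ V}
    (x : p ⟶ p') {q q' : Y ⟶ V} (h : q = r ≫ p) (h' : q' = r ≫ p') :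
    t ◁ (eqToHom h ≫ r ◁ x ≫ eqToHom h'.symm) =
      eqToHom ((congrArg (t ≫ ·) h).trans (Strict.assoc _ _ _).symm) ≫ (t ≫ r) ◁ x ≫
        eqToHom ((Strict.assoc _ _ _).trans (congrArg (t ≫ ·) h'.symm)) := by
  subst h h'
  simp [Strict.associator_eqToIso]

theorem conj_id_whiskerLeft {X Y : D} {p p' : X ⟶ Y} (x : p ⟶ p') :
    x = eqToHom (Strict.id_comp p).symm ≫ 𝟙 X ◁ x ≫ eqToHom (Strict.id_comp p') := by
  simp [Strict.leftUnitor_eqToIso]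

/-- By `sum_id_succ` each strand added on top contributes a unit and a multiplication around one
`lift`; the right unit law leaves just the `lift`, that is, one more whiskering by `T.t`. -/
theorem interp_sum_id {m n : ℕ} (f : (⟨m⟩ : Simp) ⟶ ⟨n⟩) (k : ℕ) :
    T.interp (m + k) (n + k) (Simp.sum f (𝟙 (⟨k⟩ : Simp))) =
      eqToHom (T.pow_add m k) ≫ T.pow k ◁ T.interp m n f ≫ eqToHom (T.pow_add n k).symm := by
  induction k with
  | zero =>
    exact (congrArg (T.interp m n) (Simp.sum_id_zero f)).trans (conj_id_whiskerLeft (T.interp m n f))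
  | succ k ih =>
    refine (congrArg (T.interp (m + k + 1) (n + k + 1)) (Simp.sum_id_succ f k)).trans ?_
    rw [interp_hit, interp_skip, lift_comp, Category.assoc, lift_powUnit_powMult, Category.comp_id, ih]
    exact whiskerLeft_conj_whiskerLeft T.t (T.pow k) (T.interp m n f) (T.pow_add m k) (T.pow_add n k)

/-- The block added below does not alter the path of `f`, and each `powUnit`, `powMult` or `lift`
acts on the innermost factors, hence commutes with whiskering by `T.pow k` on the outside. -/
theorem interp_id_sum (k : ℕ) {m n : ℕ} (f : (⟨m⟩ : Simp) ⟶ ⟨n⟩) :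
    T.interp (k + m) (k + n) (Simp.sum (𝟙 (⟨k⟩ : Simp)) f) =
      eqToHom (T.pow_add k m) ≫ T.interp m n f ▷ T.pow k ≫ eqToHom (T.pow_add k n).symm := by
  refine Simp.path_induction (motive := fun m n f =>
    T.interp (k + m) (k + n) (Simp.sum (𝟙 (⟨k⟩ : Simp)) f) =
      eqToHom (T.pow_add k m) ≫ T.interp m n f ▷ T.pow k ≫ eqToHom (T.pow_add k n).symm)
      ?_ ?_ ?_ m n f
  · rw [Simp.sum_id_id, interp_zero_zero, id_whiskerRight, Category.id_comp, eqToHom_trans,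
      eqToHom_refl]
    exact T.interp_id k
  · intro m n f ih
    refine (congrArg (T.interp (k + m) (k + n + 1)) (Simp.id_sum_skip k f)).trans ?_
    rw [interp_skip, interp_skip, ih, powUnit_add, comp_whiskerRight]
    simp only [Category.assoc, eqToHom_trans_assoc, eqToHom_refl, Category.id_comp]
  · intro m n f ih
    refine (congrArg (T.interp (k + m + 1) (k + n + 1)) (Simp.id_sum_hit k f)).trans ?_
    rw [interp_hit, interp_hit, comp_whiskerRight, powMult_add]
    refine (congrArg (fun x => T.lift (m := k + m) (n := k + (n + 1)) x ≫ _) ih).trans ?_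
    rw [lift_conj]
    simp only [Category.assoc]
    rw [eqToHom_trans_assoc, eqToHom_refl, Category.id_comp]

/-- The 2-functor `𝚫 ⥤ D` corresponding to a monad. -/
def functor : StrictPseudofunctor Del D := StrictPseudofunctor.mk''
  { obj := fun _ => T.obj
    map := fun n => T.pow (Simp.len n)
    map₂ := fun {_ _ f g} x => T.interp (Simp.len f) (Simp.len g) x
    map₂_id := fun f => T.interp_id (Simp.len f)
    map₂_comp := fun x y => T.interp_comp x y
    map_id := fun _ => rfl
    map_comp := fun f g => T.pow_add (Simp.len g) (Simp.len f)
    map₂_whisker_left := fun f _ _ x => T.interp_sum_id x (Simp.len f)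
    map₂_whisker_right := fun x g => T.interp_id_sum (Simp.len g) x }

theorem unitAt_id : T.unitAt (𝟙 T.obj) ≫ eqToHom (Strict.comp_id T.t) = T.η := by
  simp only [unitAt]
  rw [whiskerRight_id_strict, Strict.leftUnitor_eqToIso]
  simp

theorem multAt_id : T.multAt (𝟙 T.obj) ≫ eqToHom (Strict.comp_id T.t) =
    eqToHom (congrArg (T.t ≫ ·) (Strict.comp_id T.t)) ≫ T.μ := by
  simp only [multAt]
  rw [whiskerRight_id_strict, Strict.associator_eqToIso]
  simp

/-- The maps `0 → 1` and `2 → 1` are interpreted as `powUnit 0` and `powMult 0`, which are `η` and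
`μ` whiskered by an identity 1-cell. -/
theorem monadOf_functor : monadOf T.functor = T := by
  refine eq_of_conj (D := D) (a := T.obj) (Strict.comp_id T.t) (η' := T.η) (μ' := T.μ) ?_ ?_ _ _ _
    T.left_unit T.right_unit T.assoc
  · refine Eq.trans ?_ T.unitAt_id
    refine congrArg (· ≫ eqToHom _) ?_
    refine Eq.trans ?_ (T.interp_zero_one Del.genericMonad.η)
    exact Category.id_comp _
  · refine (congrArg (fun x => (eqToHom _ ≫ x) ≫ eqToHom _) (T.interp_two_one _)).trans ?_
    refine (Category.assoc _ _ _).trans ?_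
    refine (congrArg (eqToHom _ ≫ ·) T.multAt_id).trans ?_
    exact eqToHom_trans_assoc _ _ _

end Strict

end Mnd

/-! ### Operations on 2-natural isomorphisms -/

namespace TwoNatIso

section

variable {I : Type u₁} [Bicategory.{w₁, v₁} I] {F : StrictPseudofunctor I Cat.{w₂, v₂}}
  {G : StrictPseudofunctor I Cat.{w₃, v₃}} {H : StrictPseudofunctor I Cat.{w, v}}

/-- The inverse of a 2-natural isomorphism. -/
def symm (e : TwoNatIso F G) : TwoNatIso G F where
  hom := e.inv
  inv := e.hom
  hom_inv_id := e.inv_hom_id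
  inv_hom_id := e.hom_inv_id

/-- The composite of 2-natural isomorphisms. -/
def trans (e : TwoNatIso F G) (e' : TwoNatIso G H) : TwoNatIso F H where
  hom := e.hom.comp e'.hom
  inv := e'.inv.comp e.inv
  hom_inv_id i := by
    show e.hom.app i ⋙ (e'.hom.app i ⋙ e'.inv.app i) ⋙ e.inv.app i = _
    rw [e'.hom_inv_id, Functor.id_comp, e.hom_inv_id]
  inv_hom_id i := by
    show e'.inv.app i ⋙ (e.inv.app i ⋙ e.hom.app i) ⋙ e'.hom.app i = _
    rw [e.inv_hom_id, Functor.id_comp, e'.inv_hom_id]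

theorem inverse_naturality (l : TwoNat F G) (inv : ∀ i, G.obj i ⥤ F.obj i)
    (h : ∀ i, l.app i ⋙ inv i = 𝟭 _) (h' : ∀ i, inv i ⋙ l.app i = 𝟭 _) {i j : I} (f : i ⟶ j) :
    (G.map f).toFunctor ⋙ inv j = inv i ⋙ (F.map f).toFunctor := by
  calc
    _ = (inv i ⋙ l.app i) ⋙ (G.map f).toFunctor ⋙ inv j := by rw [h', Functor.id_comp]
    _ = inv i ⋙ (l.app i ⋙ (G.map f).toFunctor) ⋙ inv j := rfl
    _ = inv i ⋙ (F.map f).toFunctor ⋙ l.app j ⋙ inv j := by rw [← l.naturality]; rfl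
    _ = _ := by rw [h, Functor.comp_id]

theorem app_congr_obj {A : Type u₁} [Category.{v₁} A] {B : Type u₂} [Category.{v₂} B] {P Q : A ⥤ B}
    (θ : P ⟶ Q) {x y : A} (h : x = y) :
    θ.app x = eqToHom (congrArg P.obj h) ≫ θ.app y ≫ eqToHom (congrArg Q.obj h.symm) := by
  subst h; simp

/-- Compatibility of a 2-natural transformation with 2-cells passes to componentwise inverses:
conjugate the square `h` by the inverses `K` and `K'`. -/
theorem inverse_naturality₂ {A : Type u₁} [Category.{v₁} A] {A' : Type u₂} [Category.{v₂} A']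
    {B : Type u₃} [Category.{v₃} B] {B' : Type u} [Category.{v} B'] {H : A ⥤ B} {H' : A' ⥤ B'}
    {K : B ⥤ A} {K' : B' ⥤ A'} (hK : K ⋙ H = 𝟭 _) (hK' : H' ⋙ K' = 𝟭 _) {P P' : A ⥤ A'}
    {Q Q' : B ⥤ B'} (e : P ⋙ H' = H ⋙ Q) (e' : P' ⋙ H' = H ⋙ Q') (θ : P ⟶ P') (ω : Q ⟶ Q')
    (h : Functor.whiskerRight θ H' = eqToHom e ≫ Functor.whiskerLeft H ω ≫ eqToHom e'.symm)
    (k : Q ⋙ K' = K ⋙ P) (k' : Q' ⋙ K' = K ⋙ P') :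
    Functor.whiskerRight ω K' = eqToHom k ≫ Functor.whiskerLeft K θ ≫ eqToHom k'.symm := by
  ext y
  -- The square is evaluated at `K.obj y` and mapped by `K'`. Then `h₂` replaces `H (K y)` by `y`,
  -- and `h₃` cancels `K'` against `H'`; what remains is bookkeeping of `eqToHom`.
  have h₁ := congrArg (fun t => K'.map (t.app (K.obj y))) h
  have h₂ := app_congr_obj ω (Functor.congr_obj hK y).symm
  have h₃ := Functor.congr_hom hK' (θ.app (K.obj y))
  simp only [Functor.comp_map, Functor.id_map, Functor.comp_obj, Functor.id_obj] at h₂ h₃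
  simp only [Functor.whiskerRight_app, NatTrans.comp_app, eqToHom_app, Functor.whiskerLeft_app,
    Functor.map_comp, eqToHom_map, h₃] at h₁ ⊢
  rw [h₂]
  simp only [Functor.map_comp, eqToHom_map]
  rw [← cancel_epi (eqToHom (Functor.congr_obj k y).symm),
    ← cancel_mono (eqToHom (Functor.congr_obj k' y))]
  have h₄ := congrArg (fun t => eqToHom (Functor.congr_obj hK' _).symm ≫ t ≫
    eqToHom (Functor.congr_obj hK' _)) h₁
  simp only [Functor.comp_obj, Functor.id_obj, Category.assoc, eqToHom_trans, eqToHom_trans_assoc,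
    eqToHom_refl, Category.comp_id, Category.id_comp] at h₄ ⊢
  exact h₄.symm

/-- A 2-natural transformation whose components are isomorphisms of categories is a 2-natural
isomorphism. -/
def ofComponents (l : TwoNat F G) (inv : ∀ i, G.obj i ⥤ F.obj i)
    (h : ∀ i, l.app i ⋙ inv i = 𝟭 _) (h' : ∀ i, inv i ⋙ l.app i = 𝟭 _) : TwoNatIso F G where
  hom := l
  inv :=
    { app := inv
      naturality := inverse_naturality l inv h h'
      naturality₂ := fun {i j _ _} α => inverse_naturality₂ (h' i) (h j) (l.naturality _)
        (l.naturality _) _ _ (l.naturality₂ α)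
        (inverse_naturality l inv h h' _) (inverse_naturality l inv h h' _) }
  hom_inv_id := h
  inv_hom_id := h'

end

/-! ### Uniqueness of representing objects -/

section

variable {D : Type u} [Bicategory.{w, v} D] [Bicategory.Strict D]

/-- The Yoneda argument: naturality of `e.inv` along `f = e.hom (𝟙 E)`, evaluated at `𝟙 L`, gives `f
≫ e.inv (𝟙 L) = e.inv f`, and `e.inv f = 𝟙 E`. -/
theorem comp_eq_id {E L : D} (e : TwoNatIso (represented E) (represented L)) :
    (show E ⟶ L from (e.hom.app (.op E)).obj (𝟙 E)) ≫
      (show L ⟶ E from (e.inv.app (.op L)).obj (𝟙 L)) = 𝟙 E := by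
  have h₁ := Functor.congr_obj
    (e.inv.naturality (show E ⟶ L from (e.hom.app (.op E)).obj (𝟙 E)).op) (𝟙 L)
  have h₂ := Functor.congr_obj (e.hom_inv_id (.op E)) (𝟙 E)
  refine Eq.trans h₁.symm (Eq.trans ?_ h₂)
  exact congrArg (e.inv.app (.op E)).obj (Strict.comp_id _)

/-- Two 0-cells representing the same 2-functor are isomorphic. -/
def isoOfRepresented {E L : D} (e : TwoNatIso (represented E) (represented L)) : E ≅ L where
  hom := show E ⟶ L from (e.hom.app (.op E)).obj (𝟙 E)
  inv := show L ⟶ E from (e.inv.app (.op L)).obj (𝟙 L)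
  hom_inv_id := comp_eq_id e
  inv_hom_id := comp_eq_id e.symm

end

end TwoNatIso

/-! ### Subequalizing pairs and morphisms from identity monads -/

/-- Reduces an equation in `Mnd D` to one in `D`. Where it is applied below, the underlying 1-cells
agree definitionally, so the `eqToHom`s in `h` are identities. -/
theorem Mnd.eq_conj {D : Type u} [Bicategory.{w, v} D] {S T : Mnd D} {a a' b b' : S ⟶ T}
    (e : a = a') (x : a ⟶ b) (x' : a' ⟶ b') (e' : b' = b)
    (h : Mnd.cell x = eqToHom (congrArg Mnd.Hom.f e) ≫ Mnd.cell x' ≫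
      eqToHom (congrArg Mnd.Hom.f e')) : x = eqToHom e ≫ x' ≫ eqToHom e' := by
  subst e e'
  apply Mnd.cell_ext
  simpa using h

namespace SubeqCat

theorem eq_conj {D : Type u} [Bicategory.{w, v} D] {T : Mnd D} {X : D} {x x' y y' : SubeqCat T X}
    (e : x = x') (f : x ⟶ y) (f' : x' ⟶ y') (e' : y' = y)
    (h : cell f = eqToHom (congrArg U e) ≫ cell f' ≫ eqToHom (congrArg U e')) :
    f = eqToHom e ≫ f' ≫ eqToHom e' :=
  cell_ext (h.trans (cell_conj e f' e').symm)

section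

variable {D : Type u} [Bicategory.{w, v} D] {T : Mnd D} {X : D}

/-- The morphism of monads from an identity monad given by a subequalizing pair. -/
def toMnd (x : SubeqCat T X) : Mnd.idMonad X ⟶ T :=
  Mnd.Hom.mk (S := Mnd.idMonad X) x.U (x.ξ ≫ (λ_ x.U).inv)
    (by
      show (ρ_ x.U).inv ≫ x.U ◁ T.η ≫ x.ξ ≫ (λ_ x.U).inv = (λ_ x.U).inv ≫ 𝟙 (𝟙 X) ▷ x.U
      rw [← Category.assoc (x.U ◁ T.η), x.unit]
      simp)
    (by
      show x.U ◁ T.μ ≫ x.ξ ≫ (λ_ x.U).inv = (α_ x.U T.t T.t).inv ≫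
        (x.ξ ≫ (λ_ x.U).inv) ▷ T.t ≫ (α_ (𝟙 X) x.U T.t).hom ≫ 𝟙 X ◁ (x.ξ ≫ (λ_ x.U).inv) ≫
          (α_ (𝟙 X) (𝟙 X) x.U).inv ≫ (λ_ (𝟙 X)).hom ▷ x.U
      rw [← Category.assoc (x.U ◁ T.μ), x.mult]
      bicategory)

/-- The subequalizing pair given by a morphism of monads from an identity monad, in unbundled form. -/
def ofCell (U : X ⟶ T.obj) (φ : U ≫ T.t ⟶ 𝟙 X ≫ U)
    (unit : (ρ_ U).inv ≫ U ◁ T.η ≫ φ = (λ_ U).inv ≫ 𝟙 (𝟙 X) ▷ U)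
    (mult : U ◁ T.μ ≫ φ = (α_ U T.t T.t).inv ≫ φ ▷ T.t ≫ (α_ (𝟙 X) U T.t).hom ≫ 𝟙 X ◁ φ ≫
      (α_ (𝟙 X) (𝟙 X) U).inv ≫ (λ_ (𝟙 X)).hom ▷ U) : SubeqCat T X where
  U := U
  ξ := φ ≫ (λ_ U).hom
  unit := by
    rw [← cancel_epi (ρ_ U).inv, ← Category.assoc (U ◁ T.η), ← Category.assoc (ρ_ U).inv, unit]
    simp
  mult := by
    rw [← Category.assoc (U ◁ T.μ), mult]
    bicategory

/-- The subequalizing pair given by a morphism of monads from an identity monad. -/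
def ofMnd (a : Mnd.idMonad X ⟶ T) : SubeqCat T X := ofCell a.f a.φ a.unit a.mult

theorem cancel_leftUnitor (U : X ⟶ T.obj) (φ : U ≫ T.t ⟶ 𝟙 X ≫ U) :
    (φ ≫ (λ_ U).hom) ≫ (λ_ U).inv = φ := by simp

theorem toMnd_ofMnd (a : Mnd.idMonad X ⟶ T) : toMnd (ofMnd a) = a := by
  obtain ⟨U, φ, _, _⟩ := a
  refine Mnd.Hom.ext (S := Mnd.idMonad X) rfl (heq_of_eq ?_)
  exact cancel_leftUnitor U φ

theorem comm_leftUnitor {U V : X ⟶ T.obj} {φ : U ≫ T.t ⟶ 𝟙 X ≫ U} {ψ : V ≫ T.t ⟶ 𝟙 X ≫ V}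
    {τ : U ⟶ V} (h : τ ▷ T.t ≫ ψ = φ ≫ 𝟙 X ◁ τ) :
    (φ ≫ (λ_ U).hom) ≫ τ = τ ▷ T.t ≫ ψ ≫ (λ_ V).hom := by
  rw [← Category.assoc (τ ▷ T.t), h]
  simp

theorem ofMnd_toMnd (x : SubeqCat T X) : ofMnd (toMnd x) = x := by
  refine obj_ext rfl ?_
  show ((x.ξ ≫ (λ_ x.U).inv) ≫ (λ_ x.U).hom) ≫ 𝟙 x.U = 𝟙 x.U ▷ T.t ≫ x.ξ
  simp

/-- The functor sending a subequalizing pair to a morphism of monads from an identity monad. -/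
def toMndFunctor (T : Mnd D) (X : D) : SubeqCat T X ⥤ (Mnd.idMonad X ⟶ T) where
  obj := toMnd
  map {x y} f := Mnd.Hom₂.mk (a := toMnd x) (b := toMnd y) (cell f) (by
    show cell f ▷ T.t ≫ y.ξ ≫ (λ_ y.U).inv = (x.ξ ≫ (λ_ x.U).inv) ≫ 𝟙 X ◁ cell f
    rw [← Category.assoc, ← cell_comm]
    simp)
  map_id _ := rfl
  map_comp _ _ := rfl

/-- The functor sending a morphism of monads from an identity monad to a subequalizing pair. -/
def ofMndFunctor (T : Mnd D) (X : D) : (Mnd.idMonad X ⟶ T) ⥤ SubeqCat T X where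
  obj := ofMnd
  map {a b} f := Hom.mk (x := ofMnd a) (y := ofMnd b) (Mnd.cell f) (comm_leftUnitor (Mnd.cell_comm f))
  map_id _ := rfl
  map_comp _ _ := rfl

theorem toMndFunctor_comp (T : Mnd D) (X : D) :
    toMndFunctor T X ⋙ ofMndFunctor T X = 𝟭 _ :=
  CategoryTheory.Functor.ext ofMnd_toMnd fun x y f => by
    refine eq_conj (ofMnd_toMnd x) _ _ (ofMnd_toMnd y).symm ?_
    exact ((Category.id_comp _).trans (Category.comp_id _)).symm

theorem ofMndFunctor_comp (T : Mnd D) (X : D) :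
    ofMndFunctor T X ⋙ toMndFunctor T X = 𝟭 _ :=
  CategoryTheory.Functor.ext toMnd_ofMnd fun x y f => by
    refine Mnd.eq_conj (toMnd_ofMnd x) _ _ (toMnd_ofMnd y).symm ?_
    exact ((Category.id_comp _).trans (Category.comp_id _)).symm

/-- Both structural 2-cells are `F ◁ x.ξ` up to associators and unitors, since the 2-cell of
`idMonadMap F` consists of unitors only; coherence does the rest. -/
theorem toMnd_pre {Y : D} (F : X ⟶ Y) (x : SubeqCat T Y) :
    toMnd (pre F x) = Mnd.idMonadMap F ≫ toMnd x := by
  refine Mnd.Hom.ext (S := Mnd.idMonad X) rfl (heq_of_eq ?_)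
  show ((α_ F x.U T.t).hom ≫ F ◁ x.ξ) ≫ (λ_ (F ≫ x.U)).inv =
    (α_ F x.U T.t).hom ≫ F ◁ (x.ξ ≫ (λ_ x.U).inv) ≫ (α_ F (𝟙 Y) x.U).inv ≫
      ((ρ_ F).hom ≫ (λ_ F).inv) ▷ x.U ≫ (α_ (𝟙 X) F x.U).hom
  bicategory

end

variable {D : Type u} [Bicategory.{w, v} D] [Bicategory.Strict D]

/-- The 2-natural transformation from `Subeq_T` to `Mnd(ι(-), T)`. -/
def toMndTwoNat (T : Mnd D) : TwoNat (Subeq T) (MndIota T) where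
  app X := toMndFunctor T X.unop
  naturality {X Y} F := CategoryTheory.Functor.ext (fun x => toMnd_pre F.unop x) fun x y f => by
    refine Mnd.eq_conj (toMnd_pre F.unop x) _ _ (toMnd_pre F.unop y).symm ?_
    exact ((Category.id_comp _).trans (Category.comp_id _)).symm
  naturality₂ {X Y F G} β := by
    ext x
    refine Eq.trans ?_ (conj_app _ _ _ _).symm
    refine Mnd.eq_conj (toMnd_pre F.unop x) _ _ (toMnd_pre G.unop x).symm ?_
    exact ((Category.id_comp _).trans (Category.comp_id _)).symm

/-- The 2-natural isomorphism between `Subeq_T` and `Mnd(ι(-), T)`. -/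
def isoMnd (T : Mnd D) : TwoNatIso (Subeq T) (MndIota T) :=
  TwoNatIso.ofComponents (toMndTwoNat T) (fun X => ofMndFunctor T X.unop)
    (fun X => toMndFunctor_comp T X.unop) (fun X => ofMndFunctor_comp T X.unop)

end SubeqCat

/-! ### Partial functions as monotone functions with an added top element -/

/-- The unit of the generic monad. -/
def Simp.δ : (⟨0⟩ : Simp) ⟶ ⟨1⟩ := Del.genericMonad.η

/-- The multiplication of the generic monad. -/
def Simp.σ : Simp.add ⟨1⟩ ⟨1⟩ ⟶ ⟨1⟩ := Del.genericMonad.μ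

namespace Simp

/-- The function underlying a morphism, on natural numbers. -/
def val {m n : Simp} (f : m ⟶ n) (i : ℕ) : ℕ :=
  if h : i < m.len then (fn f ⟨i, h⟩).val else 0

theorem hom_ext_val {m n : Simp} {f g : m ⟶ n} (h : ∀ i, i < m.len → val f i = val g i) :
    f = g := by
  refine hom_ext fun i => ?_
  have := h i.val i.is_lt
  unfold val at this
  rwa [dif_pos i.is_lt, dif_pos i.is_lt] at this

theorem val_lt {m n : Simp} (f : m ⟶ n) {i : ℕ} (h : i < m.len) : val f i < n.len := by
  unfold val
  rw [dif_pos h]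
  exact Fin.is_lt _

theorem val_id {m : Simp} {i : ℕ} (h : i < m.len) : val (𝟙 m) i = i := dif_pos h

theorem val_comp {m n k : Simp} (f : m ⟶ n) (g : n ⟶ k) {i : ℕ} (h : i < m.len) :
    val (f ≫ g) i = val g (val f i) := by
  unfold val
  rw [dif_pos h, dif_pos h, dif_pos (Fin.is_lt _)]
  rfl

theorem val_eqToHom {m n : Simp} (e : m = n) {i : ℕ} (h : i < m.len) : val (eqToHom e) i = i := by
  subst e; exact val_id h

theorem val_addHom_left {m m' n n' : Simp} (f : m ⟶ m') (g : n ⟶ n') {i : ℕ} (h : i < m.len) :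
    val (addHom f g) i = val f i := by
  unfold val
  rw [dif_pos h, dif_pos (show i < (add m n).len from Nat.lt_add_right _ h), fn_addHom_val,
    dif_pos h]

theorem val_addHom_right {m m' n n' : Simp} (f : m ⟶ m') (g : n ⟶ n') {j : ℕ} (h : j < n.len) :
    val (addHom f g) (m.len + j) = m'.len + val g j := by
  unfold val
  rw [dif_pos h, dif_pos (show m.len + j < (add m n).len from Nat.add_lt_add_left h _),
    fn_addHom_val, dif_neg (by dsimp only; omega)]
  congr 1
  exact fn_congr g (Nat.add_sub_cancel_left _ _)

end Simp

namespace PiL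

/-- The ordinal underlying an object of `Π_l`. -/
def ord (k : PiL) : Simp := ⟨k.len⟩

theorem act_ord (k : PiL) : act (ord k) ⟨0⟩ = k := rfl

/-- The nowhere defined function `1 ⟶ 0`. -/
def counit : act ⟨1⟩ ⟨0⟩ ⟶ (⟨0⟩ : PiL) :=
  Hom.mk (fun _ => none) (fun _ _ _ _ _ h => nomatch h) (fun _ _ _ h => h)

/-- A map into the empty ordinal can only be undefined everywhere. This alone makes `counit` an
algebra structure on `0`, as used in `toAlg`. -/
theorem hom_zero_unique {k : PiL} (f g : k ⟶ ⟨0⟩) : f = g := by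
  apply Hom.ext
  funext i
  rcases h : Hom.toFun f i with _ | a
  · rcases h' : Hom.toFun g i with _ | b
    · rfl
    · exact b.elim0
  · exact a.elim0

/-- The domain is an initial segment, so undefinedness propagates upwards; hence sending the
undefined points to a new top is monotone. -/
theorem val_eq_none_of_le {k k' : PiL} (f : k ⟶ k') {i j : ℕ} (h : i ≤ j) (hi : val f i = none) :
    val f j = none := by
  unfold val at hi ⊢
  split
  · next hj =>
    rw [dif_pos (lt_of_le_of_lt h hj), Option.map_eq_none_iff] at hi
    rw [Option.map_eq_none_iff]
    by_contra hn
    have := Hom.defined_of_le f ⟨i, lt_of_le_of_lt h hj⟩ ⟨j, hj⟩ h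
      (Option.isSome_iff_ne_none.2 hn)
    exact Option.isSome_iff_ne_none.1 this hi
  · rfl

theorem val_monotone {k k' : PiL} (f : k ⟶ k') {i j a b : ℕ} (h : i ≤ j) (hi : val f i = some a)
    (hj : val f j = some b) : a ≤ b := by
  unfold val at hi hj
  split at hi
  · split at hj
    · obtain ⟨x, hx, rfl⟩ := Option.map_eq_some_iff.1 hi
      obtain ⟨y, hy, rfl⟩ := Option.map_eq_some_iff.1 hj
      exact Hom.monotone f _ _ x y h hx hy
    · cases hj
  · cases hi

/-- The values of the total function corresponding to a partial function. -/
def totalVal {k k' : PiL} (f : k ⟶ k') (i : ℕ) : ℕ := (val f i).getD k'.len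

theorem totalVal_lt {k k' : PiL} (f : k ⟶ k') (i : ℕ) : totalVal f i < k'.len + 1 := by
  unfold totalVal
  cases h : val f i with
  | none => exact Nat.lt_succ_self _
  | some a => exact Nat.lt_succ_of_lt (val_lt f h)

theorem totalVal_mono {k k' : PiL} (f : k ⟶ k') {i j : ℕ} (h : i ≤ j) :
    totalVal f i ≤ totalVal f j := by
  unfold totalVal
  cases hj : val f j with
  | none =>
    cases hi : val f i with
    | none => exact le_rfl
    | some a => exact le_of_lt (val_lt f hi)
  | some b =>
    cases hi : val f i with
    | none => rw [val_eq_none_of_le f h hi] at hj; cases hj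
    | some a => exact val_monotone f h hi hj

/-- The total monotone function corresponding to a partial function, whose value is the added top
element where the partial function is undefined. -/
def total {k k' : PiL} (f : k ⟶ k') : ord k ⟶ Simp.add (ord k') ⟨1⟩ :=
  show Fin k.len →o Fin (k'.len + 1) from
  { toFun := fun i => ⟨totalVal f i, totalVal_lt f i⟩
    monotone' := fun _ _ h => totalVal_mono f h }

theorem val_total {k k' : PiL} (f : k ⟶ k') {i : ℕ} (h : i < k.len) :
    Simp.val (total f) i = (val f i).getD k'.len := dif_pos h

/-- The identity of the Kleisli category of `(-) + 1`, whose unit at `k` is `k + δ`. -/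
theorem total_id (k : PiL) : total (𝟙 k) =
    eqToHom (Simp.add_zero' (ord k)).symm ≫ Simp.addHom (𝟙 (ord k)) Simp.δ := by
  refine Simp.hom_ext_val fun i hi => ?_
  have hi' : i < k.len := hi
  rw [val_total _ hi', val_id hi', Simp.val_comp _ _ hi, Simp.val_eqToHom _ hi,
    Simp.val_addHom_left _ _ hi, Simp.val_id hi, Option.getD_some]

/-- Kleisli composition: `total g` is extended to the added top, and the two tops so obtained are
merged by the multiplication `k'' + σ`. -/
theorem total_comp {k k' k'' : PiL} (f : k ⟶ k') (g : k' ⟶ k'') : total (f ≫ g) =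
    total f ≫ Simp.addHom (total g) (𝟙 (⟨1⟩ : Simp)) ≫ eqToHom (Simp.add_assoc' _ _ _) ≫
      Simp.addHom (𝟙 (ord k'')) Simp.σ := by
  refine Simp.hom_ext_val fun i hi => ?_
  have hi' : i < k.len := hi
  -- On values, `k'' + σ` fixes the points of `k''` and sends both added tops, `k''.len` and
  -- `k''.len + 1`, to `k''.len`.
  have key : ∀ j, j < k''.len + 1 + 1 →
      Simp.val (eqToHom (Simp.add_assoc' (ord k'') ⟨1⟩ ⟨1⟩) ≫ Simp.addHom (𝟙 (ord k'')) Simp.σ) j =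
        min j k''.len := by
    intro j hj
    have hj' : j < (Simp.add (Simp.add (ord k'') ⟨1⟩) ⟨1⟩).len := hj
    rw [Simp.val_comp _ _ hj', Simp.val_eqToHom _ hj']
    by_cases h : j < k''.len
    · rw [Simp.val_addHom_left _ _ h, Simp.val_id h]
      omega
    · obtain ⟨r, rfl⟩ := Nat.exists_eq_add_of_le (Nat.le_of_not_lt h)
      have hr : r < 1 + 1 := by omega
      have h₁ : Simp.val Simp.σ r < 1 := Simp.val_lt Simp.σ hr
      refine (Simp.val_addHom_right (𝟙 (ord k'')) Simp.σ hr).trans ?_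
      have h₂ : (ord k'').len = k''.len := rfl
      omega
  have ht : (val f i).getD k'.len < (Simp.add (ord k') ⟨1⟩).len := totalVal_lt f i
  have hl : Simp.val (Simp.addHom (total g) (𝟙 (⟨1⟩ : Simp))) ((val f i).getD k'.len) <
    k''.len + 1 + 1 := Simp.val_lt _ ht
  rw [val_total _ hi', val_comp, Simp.val_comp _ _ hi, val_total _ hi', Simp.val_comp _ _ ht,
    key _ hl]
  cases h : val f i with
  | none =>
    have h₁ := Simp.val_addHom_right (total g) (𝟙 (⟨1⟩ : Simp)) (j := 0) Nat.one_pos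
    rw [Simp.val_id Nat.one_pos] at h₁
    have h₂ : (ord k').len + 0 = k'.len := rfl
    have h₃ : (Simp.add (ord k'') ⟨1⟩).len + 0 = k''.len + 1 := rfl
    rw [h₂, h₃] at h₁
    rw [Option.getD_none, h₁, Option.bind_none, Option.getD_none]
    omega
  | some a =>
    have ha : a < k'.len := val_lt f h
    rw [Option.getD_some, Simp.val_addHom_left _ _ ha, val_total _ ha, Option.bind_some]
    have := totalVal_lt g a
    unfold totalVal at this
    omega

/-! ### Total functions and the left action -/

theorem ord_act (n : Simp) (k : PiL) : ord (act n k) = Simp.add n (ord k) := rfl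

theorem add_add_one (n : Simp) (k : PiL) :
    Simp.add n (Simp.add (ord k) ⟨1⟩) = Simp.add (ord (act n k)) ⟨1⟩ := rfl

/-- The block `n` is added below and the extra point on top, so the two operations do not interfere.
-/
theorem total_id_actHom (n : Simp) {k k' : PiL} (g : k ⟶ k') : total (actHom (𝟙 n) g) =
    eqToHom (ord_act n k) ≫ Simp.addHom (𝟙 n) (total g) ≫
      eqToHom (add_add_one n k') := by
  refine Simp.hom_ext_val fun i hi => ?_
  have hi' : i < (act n k).len := hi
  have hi'' : i < (Simp.add n (ord k)).len := hi
  rw [Simp.val_comp _ _ hi, Simp.val_eqToHom _ hi, Simp.val_comp _ _ hi'']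
  refine (val_total _ hi').trans (Eq.trans ?_ (Simp.val_eqToHom _ (Simp.val_lt _ hi'')).symm)
  by_cases h : i < n.len
  · rw [val_actHom_left _ _ h, Simp.val_addHom_left _ _ h, Simp.val_id h]
    rfl
  · obtain ⟨r, rfl⟩ := Nat.exists_eq_add_of_le (Nat.le_of_not_lt h)
    have hr : r < k.len := Nat.lt_of_add_lt_add_left hi'
    rw [val_actHom_right, Simp.val_addHom_right _ _ (show r < (ord k).len from hr), val_total _ hr]
    cases val g r <;> rfl

/-- The partial map `f + k` is defined everywhere, so its total version never takes the added top as
a value and factors through the unit. -/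
theorem total_actHom_id {m n : Simp} (f : m ⟶ n) (k : PiL) : total (actHom f (𝟙 k)) =
    eqToHom (ord_act m k) ≫ Simp.addHom f (𝟙 (ord k)) ≫
      eqToHom ((ord_act n k).symm.trans (Simp.add_zero' (ord (act n k))).symm) ≫
        Simp.addHom (𝟙 (ord (act n k))) Simp.δ := by
  refine Simp.hom_ext_val fun i hi => ?_
  have hi' : i < (act m k).len := hi
  have hi'' : i < (Simp.add m (ord k)).len := hi
  have hf : Simp.val (Simp.addHom f (𝟙 (ord k))) i < (Simp.add n (ord k)).len :=
    Simp.val_lt _ hi''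
  have hf' : Simp.val (Simp.addHom f (𝟙 (ord k))) i < (ord (act n k)).len := hf
  rw [val_total _ hi', Simp.val_comp _ _ hi, Simp.val_eqToHom _ hi, Simp.val_comp _ _ hi'',
    Simp.val_comp _ _ hf, Simp.val_eqToHom _ hf, Simp.val_addHom_left _ _ hf', Simp.val_id hf']
  by_cases h : i < m.len
  · rw [val_actHom_left _ _ h, Simp.val_addHom_left _ _ h, Option.getD_some]
    unfold Simp.val
    rw [dif_pos h]
  · obtain ⟨r, rfl⟩ := Nat.exists_eq_add_of_le (Nat.le_of_not_lt h)
    have hr : r < k.len := Nat.lt_of_add_lt_add_left hi'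
    have hr' : r < (ord k).len := hr
    rw [val_actHom_right, Simp.val_addHom_right _ _ hr', val_id hr, Simp.val_id hr']
    rfl

theorem ord_act_one_zero : ord (act ⟨1⟩ ⟨0⟩) = Simp.add (ord ⟨0⟩) ⟨1⟩ := rfl

theorem total_counit : total counit = eqToHom ord_act_one_zero := Del.hom_one_unique _ _

/-- Sending the undefined points to an extra point and then discarding that point by `counit`
recovers `f`. Thus `0` and `counit` generate `Π_l` under the action, which is why a cone is
determined by its value on them. -/
theorem actHom_total {k k' : PiL} (f : k ⟶ k') :
    actHom (total f) (𝟙 (⟨0⟩ : PiL)) ≫ eqToHom (act_add _ _ _) ≫ actHom (𝟙 (ord k')) counit =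
      eqToHom (act_ord k) ≫ f ≫ eqToHom (act_ord k').symm := by
  apply hom_ext
  intro i hi
  have hi' : i < (ord k).len := hi
  have e := val_total f hi'
  have e' : Simp.val (total f) i = (Simp.fn (total f) ⟨i, hi'⟩).val := dif_pos hi'
  have h' : (val f i).getD k'.len < (act (Simp.add (ord k') ⟨1⟩) ⟨0⟩).len := totalVal_lt f i
  rw [val_conj, val_comp, val_actHom_left _ _ hi', Option.bind_some, val_comp, ← e', e,
    val_eqToHom _ h', Option.bind_some]
  cases h : val f i with
  | none =>
    have h₁ := val_actHom_right (𝟙 (ord k')) counit 0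
    exact h₁
  | some a =>
    have ha : a < k'.len := val_lt f h
    exact (val_actHom_left (𝟙 (ord k')) counit ha)

end PiL

/-! ### The 1-cells and 2-cells of a 2-functor on `𝚫` -/

section Powers

variable {D : Type u} [Bicategory.{w, v} D] (F : StrictPseudofunctor Del D)

/-- The 1-cell `𝐓(n)`. -/
def pw (n : Simp) : F.obj Del.star ⟶ F.obj Del.star := F.map (X := Del.star) (Y := Del.star) n

/-- The 2-cell `𝐓(f)`. -/
def pw₂ {m n : Simp} (f : m ⟶ n) : pw F m ⟶ pw F n :=
  F.map₂ (a := Del.star) (b := Del.star) (f := m) (g := n) f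

theorem pw_zero : pw F ⟨0⟩ = 𝟙 (F.obj Del.star) := F.map_id Del.star

theorem pw_ord_zero : pw F (PiL.ord ⟨0⟩) = 𝟙 (F.obj Del.star) := pw_zero F

theorem pw_add (m n : Simp) : pw F (Simp.add m n) = pw F n ≫ pw F m :=
  F.map_comp (a := Del.star) (b := Del.star) (c := Del.star) n m

theorem pw₂_id (n : Simp) : pw₂ F (𝟙 n) = 𝟙 (pw F n) :=
  F.map₂_id (a := Del.star) (b := Del.star) n

theorem pw₂_comp {m n k : Simp} (f : m ⟶ n) (g : n ⟶ k) : pw₂ F (f ≫ g) = pw₂ F f ≫ pw₂ F g :=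
  F.map₂_comp (a := Del.star) (b := Del.star) (f := m) (g := n) (h := k) f g

theorem pw₂_eqToHom {m n : Simp} (h : m = n) : pw₂ F (eqToHom h) = eqToHom (congrArg (pw F) h) := by
  subst h; exact pw₂_id F m

theorem pw₂_addHom_id {m n : Simp} (f : m ⟶ n) (k : Simp) :
    pw₂ F (Simp.addHom f (𝟙 k)) =
      eqToHom (pw_add F m k) ≫ pw F k ◁ pw₂ F f ≫ eqToHom (pw_add F n k).symm := by
  have h := F.map₂_whisker_left (a := Del.star) (b := Del.star) (c := Del.star) k (g := m) (h := n) f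
  rw [F.mapComp_eq_eqToIso, F.mapComp_eq_eqToIso] at h
  exact h

theorem pw₂_id_addHom (k : Simp) {m n : Simp} (f : m ⟶ n) :
    pw₂ F (Simp.addHom (𝟙 k) f) =
      eqToHom (pw_add F k m) ≫ pw₂ F f ▷ pw F k ≫ eqToHom (pw_add F k n).symm := by
  have h := F.map₂_whisker_right (a := Del.star) (b := Del.star) (c := Del.star) (f := m) (g := n) f k
  rw [F.mapComp_eq_eqToIso, F.mapComp_eq_eqToIso] at h
  exact h

end Powers

/-! ### Algebras for a 2-functor on `𝚫` -/

theorem whiskerRight_conj {D : Type u} [Bicategory.{w, v} D] {X Y Z : D} {p q : X ⟶ Y} (x : p ⟶ q) {r s : Y ⟶ Z} (h : r = s) :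
    x ▷ r = eqToHom (congrArg (p ≫ ·) h) ≫ x ▷ s ≫ eqToHom (congrArg (q ≫ ·) h.symm) := by
  subst h; simp

variable {D : Type u} [Bicategory.{w, v} D] [Bicategory.Strict D]

theorem comp_pw_zero (F : StrictPseudofunctor Del D) {X : D} (U : X ⟶ F.obj Del.star) :
    U ≫ pw F ⟨0⟩ = U := by rw [pw_zero, Strict.comp_id]

theorem comp_pw_add (F : StrictPseudofunctor Del D) {X : D} (U : X ⟶ F.obj Del.star) (m n : Simp) :
    U ≫ pw F (Simp.add m n) = (U ≫ pw F n) ≫ pw F m := by rw [pw_add, Strict.assoc]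

/-- A pair subequalizing the monad of a 2-functor `𝐓` on `𝚫`, expressed in terms of `𝐓`. -/
structure Alg (F : StrictPseudofunctor Del D) (X : D) where
  U : X ⟶ F.obj Del.star
  ξ : U ≫ pw F ⟨1⟩ ⟶ U
  unit : U ◁ pw₂ F Simp.δ ≫ ξ = eqToHom (comp_pw_zero F U)
  mult : U ◁ pw₂ F Simp.σ ≫ ξ = eqToHom (comp_pw_add F U ⟨1⟩ ⟨1⟩) ≫ ξ ▷ pw F ⟨1⟩ ≫ ξ

namespace Alg

variable {F : StrictPseudofunctor Del D} {X : D}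

/-- The subequalizing pair of an algebra. -/
def toSubeq (x : Alg F X) : SubeqCat (monadOf F) X where
  U := x.U
  ξ := x.ξ
  unit := by
    show x.U ◁ (eqToHom (pw_zero F).symm ≫ pw₂ F Simp.δ) ≫ x.ξ = (ρ_ x.U).hom
    rw [whiskerLeft_comp, Category.assoc, x.unit, Strict.rightUnitor_eqToIso]
    simp
  mult := by
    show x.U ◁ (eqToHom (pw_add F ⟨1⟩ ⟨1⟩).symm ≫ pw₂ F Simp.σ) ≫ x.ξ =
      (α_ x.U (pw F ⟨1⟩) (pw F ⟨1⟩)).inv ≫ x.ξ ▷ pw F ⟨1⟩ ≫ x.ξ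
    rw [whiskerLeft_comp, Category.assoc, x.mult, Strict.associator_eqToIso]
    simp

/-- The algebra of a pair satisfying the equations of a subequalizing pair. -/
def ofCell (U : X ⟶ F.obj Del.star) (ξ : U ≫ pw F ⟨1⟩ ⟶ U)
    (unit : U ◁ (eqToHom (pw_zero F).symm ≫ pw₂ F Simp.δ) ≫ ξ = (ρ_ U).hom)
    (mult : U ◁ (eqToHom (pw_add F ⟨1⟩ ⟨1⟩).symm ≫ pw₂ F Simp.σ) ≫ ξ =
      (α_ U (pw F ⟨1⟩) (pw F ⟨1⟩)).inv ≫ ξ ▷ pw F ⟨1⟩ ≫ ξ) : Alg F X where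
  U := U
  ξ := ξ
  unit := by
    rw [whiskerLeft_comp, Category.assoc, Strict.rightUnitor_eqToIso] at unit
    rw [← cancel_epi (U ◁ eqToHom (pw_zero F).symm), unit]
    simp
  mult := by
    rw [whiskerLeft_comp, Category.assoc, Strict.associator_eqToIso] at mult
    rw [← cancel_epi (U ◁ eqToHom (pw_add F ⟨1⟩ ⟨1⟩).symm), mult]
    simp

/-- The algebra of a subequalizing pair. -/
def ofSubeq (x : SubeqCat (monadOf F) X) : Alg F X := ofCell x.U x.ξ x.unit x.mult

/-- The action `U 𝐓(n + 1) ⟶ U 𝐓(n)` of an algebra. -/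
def action (x : Alg F X) (n : Simp) : x.U ≫ pw F (Simp.add n ⟨1⟩) ⟶ x.U ≫ pw F n :=
  eqToHom (comp_pw_add F x.U n ⟨1⟩) ≫ x.ξ ▷ pw F n

/-- This is the unit axiom of `x` whiskered by `𝐓(n)`; it matches `total_id`. -/
theorem whiskerLeft_unit_action (x : Alg F X) (n : Simp) :
    x.U ◁ pw₂ F (Simp.addHom (𝟙 n) Simp.δ) ≫ x.action n =
      eqToHom (congrArg (x.U ≫ pw F ·) (Simp.add_zero' n)) := by
  have h := congrArg (· ▷ pw F n) x.unit
  simp only [comp_whiskerRight] at h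
  rw [pw₂_id_addHom, whiskerLeft_comp, whiskerLeft_comp, whisker_assoc_strict, action]
  simp only [Category.assoc, whiskerLeft_eqToHom, eqToHom_trans_assoc, eqToHom_refl,
    Category.id_comp, h, eqToHom_whiskerRight, eqToHom_trans]

/-- Interchange: `ξ` acts on the innermost factor and `f` on the outer ones. -/
theorem action_naturality (x : Alg F X) {m n : Simp} (f : m ⟶ n) :
    x.action m ≫ x.U ◁ pw₂ F f = x.U ◁ pw₂ F (Simp.addHom f (𝟙 (⟨1⟩ : Simp))) ≫ x.action n := by
  rw [pw₂_addHom_id, whiskerLeft_comp, whiskerLeft_comp, whiskerLeft_comp_strict_symm, action,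
    action, Category.assoc, ← whisker_exchange]
  simp only [Category.assoc, whiskerLeft_eqToHom, eqToHom_trans_assoc, eqToHom_refl,
    Category.id_comp]

/-- This is the multiplication axiom of `x` whiskered by `𝐓(n)`; it matches the merging of the two
tops in `total_comp`. -/
theorem action_action (x : Alg F X) (n : Simp) :
    x.action (Simp.add n ⟨1⟩) ≫ x.action n =
      eqToHom (congrArg (x.U ≫ pw F ·) (Simp.add_assoc' n ⟨1⟩ ⟨1⟩)) ≫
        x.U ◁ pw₂ F (Simp.addHom (𝟙 n) Simp.σ) ≫ x.action n := by
  have h := congrArg (· ▷ pw F n) x.mult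
  simp only [comp_whiskerRight] at h
  rw [pw₂_id_addHom, whiskerLeft_comp, whiskerLeft_comp, whisker_assoc_strict, action, action,
    whiskerRight_conj x.ξ (pw_add F n ⟨1⟩), whiskerRight_comp_strict]
  simp only [Category.assoc, whiskerLeft_eqToHom, eqToHom_trans_assoc, eqToHom_refl,
    Category.id_comp, h, eqToHom_whiskerRight, eqToHom_trans]

theorem action_add (x : Alg F X) (m n : Simp) :
    x.action (Simp.add m n) = eqToHom (by simp only [pw_add, Strict.assoc]) ≫
      x.action n ▷ pw F m ≫ eqToHom (comp_pw_add F x.U m n).symm := by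
  rw [action, action, whiskerRight_conj x.ξ (pw_add F m n), whiskerRight_comp_strict,
    comp_whiskerRight]
  simp only [Category.assoc, eqToHom_trans_assoc, eqToHom_whiskerRight, eqToHom_trans]

theorem comp_pw_ord_act_add_one (x : Alg F X) (n : Simp) (k : PiL) :
    x.U ≫ pw F (Simp.add (PiL.ord (PiL.act n k)) ⟨1⟩) =
      (x.U ≫ pw F (Simp.add (PiL.ord k) ⟨1⟩)) ≫ pw F n :=
  comp_pw_add F x.U n (Simp.add (PiL.ord k) ⟨1⟩)

theorem comp_pw_ord_act (x : Alg F X) (n : Simp) (k : PiL) :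
    x.U ≫ pw F (PiL.ord (PiL.act n k)) = (x.U ≫ pw F (PiL.ord k)) ≫ pw F n :=
  comp_pw_add F x.U n (PiL.ord k)

theorem action_ord_act (x : Alg F X) (n : Simp) (k : PiL) :
    x.action (PiL.ord (PiL.act n k)) =
      eqToHom (x.comp_pw_ord_act_add_one n k) ≫ x.action (PiL.ord k) ▷ pw F n ≫
        eqToHom (x.comp_pw_ord_act n k).symm :=
  x.action_add n (PiL.ord k)

/-- The 2-cell given by an algebra and a morphism of `Π_l`. -/
def cellMap (x : Alg F X) {k k' : PiL} (f : k ⟶ k') :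
    x.U ≫ pw F (PiL.ord k) ⟶ x.U ≫ pw F (PiL.ord k') :=
  x.U ◁ pw₂ F (PiL.total f) ≫ x.action (PiL.ord k')

theorem cellMap_id_actHom (x : Alg F X) (n : Simp) {k k' : PiL} (g : k ⟶ k') :
    x.cellMap (PiL.actHom (𝟙 n) g) = eqToHom (x.comp_pw_ord_act n k) ≫
      x.cellMap g ▷ pw F n ≫ eqToHom (x.comp_pw_ord_act n k').symm := by
  rw [cellMap, cellMap, PiL.total_id_actHom, action_ord_act]
  simp only [pw₂_comp, pw₂_eqToHom, pw₂_id_addHom, whiskerLeft_comp, comp_whiskerRight,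
    whiskerLeft_eqToHom, Category.assoc]
  rw [whisker_assoc_strict]
  simp only [Category.assoc, eqToHom_trans_assoc, eqToHom_refl, Category.id_comp]

/-- The total version of `f + k` ends with the unit, which the action cancels, so that `ξ`
disappears. -/
theorem cellMap_actHom_id (x : Alg F X) {m n : Simp} (f : m ⟶ n) (k : PiL) :
    x.cellMap (PiL.actHom f (𝟙 k)) = eqToHom (x.comp_pw_ord_act m k) ≫
      (x.U ≫ pw F (PiL.ord k)) ◁ pw₂ F f ≫ eqToHom (x.comp_pw_ord_act n k).symm := by
  rw [cellMap, PiL.total_actHom_id, whiskerLeft_comp_strict]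
  simp only [pw₂_comp, pw₂_eqToHom, pw₂_addHom_id, whiskerLeft_comp, whiskerLeft_eqToHom,
    Category.assoc, whiskerLeft_unit_action, eqToHom_trans_assoc, eqToHom_trans]

/-- The functor on `Π_l` given by an algebra. -/
def functor (x : Alg F X) : PiL ⥤ (X ⟶ F.obj Del.star) where
  obj k := x.U ≫ pw F (PiL.ord k)
  map f := x.cellMap f
  map_id k := by
    rw [cellMap, PiL.total_id, pw₂_comp, whiskerLeft_comp, Category.assoc,
      whiskerLeft_unit_action, pw₂_eqToHom, whiskerLeft_eqToHom, eqToHom_trans, eqToHom_refl]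
  map_comp {k k' k''} f g := by
    rw [cellMap, PiL.total_comp]
    simp only [pw₂_comp, whiskerLeft_comp, Category.assoc, pw₂_eqToHom, whiskerLeft_eqToHom]
    -- The merging of tops becomes two successive actions, and naturality moves the first of them in
    -- front of `total g`.
    rw [← action_action, ← Category.assoc (x.U ◁ _) (x.action _),
      ← action_naturality]
    simp only [cellMap, Category.assoc]

end Alg

/-! ### Cones as equivariant functors on `Π_l` -/

/-- A functor on `Π_l` compatible with the actions of `Δ`. -/
@[ext]
structure EquivariantFunctor (F : StrictPseudofunctor Del D) (X : D) where
  Φ : PiL ⥤ (X ⟶ F.obj Del.star)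
  obj_act (n : Simp) (k : PiL) : Φ.obj (PiL.act n k) = Φ.obj k ≫ pw F n
  map_id_actHom (n : Simp) {k k' : PiL} (g : k ⟶ k') : Φ.map (PiL.actHom (𝟙 n) g) =
    eqToHom (obj_act n k) ≫ Φ.map g ▷ pw F n ≫ eqToHom (obj_act n k').symm
  map_actHom_id {m n : Simp} (f : m ⟶ n) (k : PiL) : Φ.map (PiL.actHom f (𝟙 k)) =
    eqToHom (obj_act m k) ≫ Φ.obj k ◁ pw₂ F f ≫ eqToHom (obj_act n k).symm

namespace EquivariantFunctor

variable {F : StrictPseudofunctor Del D} {X : D}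

/-- The equivariant functor of a cone. -/
def ofCone (l : ConeCat Wl F X) : EquivariantFunctor F X where
  Φ := TwoNat.app l Del.star
  obj_act n k := Functor.congr_obj (TwoNat.naturality l (i := Del.star) (j := Del.star) n) k
  map_id_actHom n _ _ g :=
    Functor.congr_hom (TwoNat.naturality l (i := Del.star) (j := Del.star) n) g
  map_actHom_id {m n} f k :=
    (congrArg (fun t => t.app k)
      (TwoNat.naturality₂ l (i := Del.star) (j := Del.star) (f := m) (g := n) f)).trans
      (conj_app _ _ _ k)

/-- The components of the cone of an equivariant functor. -/
def coneApp (L : EquivariantFunctor F X) : (i : Del) → (Wl.obj i ⥤ (homInto X F).obj i)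
  | .star => L.Φ

/-- The cone of an equivariant functor. -/
def toCone (L : EquivariantFunctor F X) : ConeCat Wl F X :=
  TwoNat.mk (coneApp L)
    (by
      rintro ⟨⟩ ⟨⟩ n
      exact CategoryTheory.Functor.ext (fun k => L.obj_act n k) (fun _ _ g => L.map_id_actHom n g))
    (by
      rintro ⟨⟩ ⟨⟩ m n f
      ext k
      refine Eq.trans ?_ (conj_app _ _ _ k).symm
      exact L.map_actHom_id f k)

/-- `𝚫` has a single 0-cell, so a cone is its component there together with propositions. -/
theorem toCone_ofCone (l : ConeCat Wl F X) : toCone (ofCone l) = l :=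
  TwoNat.ext (funext fun i => by cases i; rfl)

/-- The algebra of an equivariant functor. -/
def toAlg (L : EquivariantFunctor F X) : Alg F X where
  U := L.Φ.obj ⟨0⟩
  ξ := eqToHom (L.obj_act ⟨1⟩ ⟨0⟩).symm ≫ L.Φ.map PiL.counit
  unit := by
    -- The unit axiom already holds in `Π_l`, where maps into `0` are unique; `Φ` transports it.
    have h : PiL.actHom Simp.δ (𝟙 (⟨0⟩ : PiL)) ≫ PiL.counit = eqToHom (PiL.act_zero ⟨0⟩) :=
      PiL.hom_zero_unique _ _
    have h₁ := congrArg L.Φ.map h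
    rw [L.Φ.map_comp, L.map_actHom_id, eqToHom_map] at h₁
    rw [← cancel_epi (eqToHom (L.obj_act ⟨0⟩ ⟨0⟩)), eqToHom_trans, ← h₁]
    simp only [Category.assoc]
  mult := by
    have h : PiL.actHom Simp.σ (𝟙 (⟨0⟩ : PiL)) ≫ PiL.counit =
        eqToHom (PiL.act_add ⟨1⟩ ⟨1⟩ ⟨0⟩) ≫ PiL.actHom (𝟙 (⟨1⟩ : Simp)) PiL.counit ≫ PiL.counit :=
      PiL.hom_zero_unique _ _
    have h₁ := congrArg L.Φ.map h
    rw [L.Φ.map_comp, L.Φ.map_comp, L.Φ.map_comp, L.map_actHom_id, L.map_id_actHom,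
      eqToHom_map] at h₁
    rw [← cancel_epi (eqToHom (L.obj_act (Simp.add ⟨1⟩ ⟨1⟩) ⟨0⟩)), comp_whiskerRight,
      eqToHom_whiskerRight]
    simp only [Category.assoc, eqToHom_trans_assoc] at h₁ ⊢
    exact h₁

/-- The equivariant functor of an algebra. -/
def ofAlg (x : Alg F X) : EquivariantFunctor F X where
  Φ := x.functor
  obj_act := x.comp_pw_ord_act
  map_id_actHom n _ _ g := x.cellMap_id_actHom n g
  map_actHom_id f k := x.cellMap_actHom_id f k

/-- Applying `Φ` to the factorization `actHom_total`, equivariance turns its first factor into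
`𝐓(total f)` whiskered by `U` and its second into `ξ` whiskered by `𝐓(k')`: exactly `cellMap`. -/
theorem toAlg_map (L : EquivariantFunctor F X) {k k' : PiL} (f : k ⟶ k') :
    (toAlg L).cellMap f = eqToHom (L.obj_act (PiL.ord k) ⟨0⟩).symm ≫
      L.Φ.map (eqToHom (PiL.act_ord k) ≫ f ≫ eqToHom (PiL.act_ord k').symm) ≫
        eqToHom (L.obj_act (PiL.ord k') ⟨0⟩) := by
  rw [← PiL.actHom_total, L.Φ.map_comp, L.Φ.map_comp, L.map_actHom_id, L.map_id_actHom,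
    eqToHom_map]
  show L.Φ.obj ⟨0⟩ ◁ pw₂ F (PiL.total f) ≫ eqToHom (comp_pw_add F (L.Φ.obj ⟨0⟩) _ ⟨1⟩) ≫
    (eqToHom (L.obj_act ⟨1⟩ ⟨0⟩).symm ≫ L.Φ.map PiL.counit) ▷ pw F (PiL.ord k') = _
  rw [comp_whiskerRight, eqToHom_whiskerRight]
  simp only [Category.assoc, eqToHom_trans_assoc, eqToHom_trans, eqToHom_refl, Category.id_comp,
    Category.comp_id]

theorem ofAlg_toAlg (L : EquivariantFunctor F X) : ofAlg (toAlg L) = L := by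
  refine EquivariantFunctor.ext (CategoryTheory.Functor.ext (fun k => (L.obj_act (PiL.ord k) ⟨0⟩).symm) ?_)
  intro k k' f
  refine (L.toAlg_map f).trans ?_
  refine congrArg (fun t => eqToHom _ ≫ t ≫ eqToHom _) ?_
  exact congrArg L.Φ.map ((Category.id_comp _).trans (Category.comp_id _))

end EquivariantFunctor

namespace Alg

variable {F : StrictPseudofunctor Del D} {X : D}

theorem ext_conj {x y : Alg F X} (h : x.U = y.U)
    (hξ : x.ξ ≫ eqToHom h = eqToHom h ▷ pw F ⟨1⟩ ≫ y.ξ) : x = y := by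
  obtain ⟨U, ξ, h₁, h₂⟩ := x
  obtain ⟨V, ζ, h₃, h₄⟩ := y
  obtain rfl : U = V := h
  obtain rfl : ξ = ζ := by simpa using hξ
  rfl

theorem comp_pw_ord_zero (U : X ⟶ F.obj Del.star) : U ≫ pw F (PiL.ord ⟨0⟩) = U :=
  comp_pw_zero F U

/-- The total version of `counit` is the identity of `1`, so only `ξ` whiskered by `𝐓(0)` is left.
The value at `0` is `U ≫ pw F ⟨0⟩`, equal to `U` only propositionally, which accounts for the
conjugation. -/
theorem cellMap_counit (x : Alg F X) :
    (eqToHom (x.comp_pw_ord_act ⟨1⟩ ⟨0⟩).symm ≫ x.cellMap PiL.counit) ≫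
        eqToHom (comp_pw_ord_zero x.U) =
      eqToHom (comp_pw_ord_zero x.U) ▷ pw F ⟨1⟩ ≫ x.ξ := by
  rw [cellMap, action, PiL.total_counit, pw₂_eqToHom, whiskerRight_conj x.ξ (pw_ord_zero F),
    whiskerRight_id_strict]
  simp only [whiskerLeft_eqToHom, eqToHom_whiskerRight, Category.assoc, eqToHom_trans_assoc,
    eqToHom_trans, eqToHom_refl, Category.comp_id]

theorem toAlg_ofAlg (x : Alg F X) : EquivariantFunctor.toAlg (EquivariantFunctor.ofAlg x) = x :=
  ext_conj (comp_pw_zero F x.U) x.cellMap_counit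

/-- `τ` passes `𝐓(total f)` by interchange and passes the action by `h` whiskered with `𝐓(k')`. -/
theorem cellMap_naturality {x y : Alg F X} {τ : x.U ⟶ y.U} (h : x.ξ ≫ τ = τ ▷ pw F ⟨1⟩ ≫ y.ξ)
    {k k' : PiL} (f : k ⟶ k') :
    x.cellMap f ≫ τ ▷ pw F (PiL.ord k') = τ ▷ pw F (PiL.ord k) ≫ y.cellMap f := by
  have h₁ := congrArg (· ▷ pw F (PiL.ord k')) h
  simp only [comp_whiskerRight] at h₁
  rw [cellMap, cellMap, action, action, ← Category.assoc (τ ▷ _), ← whisker_exchange,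
    whiskerRight_conj τ (pw_add F (PiL.ord k') ⟨1⟩), whiskerRight_comp_strict]
  simp only [Category.assoc, h₁, eqToHom_trans_assoc, eqToHom_refl, Category.id_comp]

theorem whiskerRight_ord_act {x y : Alg F X} (τ : x.U ⟶ y.U) (n : Simp) (k : PiL) :
    τ ▷ pw F (PiL.ord (PiL.act n k)) = eqToHom (x.comp_pw_ord_act n k) ≫
      (τ ▷ pw F (PiL.ord k)) ▷ pw F n ≫ eqToHom (y.comp_pw_ord_act n k).symm := by
  have h : pw F (PiL.ord (PiL.act n k)) = pw F (PiL.ord k) ≫ pw F n := pw_add F n (PiL.ord k)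
  rw [whiskerRight_conj τ h, whiskerRight_comp_strict]
  simp only [Category.assoc, eqToHom_trans_assoc, eqToHom_trans]

end Alg

/-! ### The 2-natural isomorphism between `Cone_{W_l}(𝐓)` and `Subeq_T` -/

theorem conj_symm {C : Type u₁} [Category.{v₁} C] {a a' b b' : C} (e : a = a') (f : a ⟶ b)
    (f' : a' ⟶ b') (e' : b' = b) (h : f = eqToHom e ≫ f' ≫ eqToHom e') :
    f' = eqToHom e.symm ≫ f ≫ eqToHom e'.symm := by
  subst e e'; simpa using h.symm

namespace ConeCat

open EquivariantFunctor

variable {F : StrictPseudofunctor Del D} {X : D}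

theorem cell_naturality {l l' : ConeCat Wl F X} (ν : l ⟶ l') {k k' : PiL} (f : k ⟶ k') :
    (ofCone l).Φ.map f ≫ cell ν Del.star k' = cell ν Del.star k ≫ (ofCone l').Φ.map f :=
  (Modif.app ν Del.star).naturality f

/-- Taken at `k = 0`, this shows that a modification is determined by its component at `0`. -/
theorem cell_act {l l' : ConeCat Wl F X} (ν : l ⟶ l') (n : Simp) (k : PiL) :
    cell ν Del.star (PiL.act n k) = eqToHom ((ofCone l).obj_act n k) ≫
      cell ν Del.star k ▷ pw F n ≫ eqToHom ((ofCone l').obj_act n k).symm :=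
  (congrArg (fun t => t.app k) (Modif.naturality ν (i := Del.star) (j := Del.star) n)).trans
    (conj_app _ _ _ k)

/-- The morphism of cones given by an equivariant natural transformation. -/
def homMk {L L' : EquivariantFunctor F X} (θ : L.Φ ⟶ L'.Φ)
    (h : ∀ n k, θ.app (PiL.act n k) = eqToHom (L.obj_act n k) ≫ θ.app k ▷ pw F n ≫
      eqToHom (L'.obj_act n k).symm) : toCone L ⟶ toCone L' :=
  Modif.mk (fun i => match i with | .star => θ) (by
    rintro ⟨⟩ ⟨⟩ n
    ext k
    refine Eq.trans ?_ (conj_app _ _ _ k).symm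
    exact h n k)

theorem ξ_comm {L L' : EquivariantFunctor F X} {τ : ∀ k, L.Φ.obj k ⟶ L'.Φ.obj k}
    (h₁ : L.Φ.map PiL.counit ≫ τ ⟨0⟩ = τ (PiL.act ⟨1⟩ ⟨0⟩) ≫ L'.Φ.map PiL.counit)
    (h₂ : τ (PiL.act ⟨1⟩ ⟨0⟩) = eqToHom (L.obj_act ⟨1⟩ ⟨0⟩) ≫ τ ⟨0⟩ ▷ pw F ⟨1⟩ ≫
      eqToHom (L'.obj_act ⟨1⟩ ⟨0⟩).symm) :
    (toAlg L).ξ ≫ τ ⟨0⟩ = τ ⟨0⟩ ▷ pw F ⟨1⟩ ≫ (toAlg L').ξ := by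
  show (eqToHom (L.obj_act ⟨1⟩ ⟨0⟩).symm ≫ L.Φ.map PiL.counit) ≫ τ ⟨0⟩ =
    τ ⟨0⟩ ▷ pw F ⟨1⟩ ≫ eqToHom (L'.obj_act ⟨1⟩ ⟨0⟩).symm ≫ L'.Φ.map PiL.counit
  rw [Category.assoc, h₁, h₂]
  simp only [Category.assoc, eqToHom_trans_assoc, eqToHom_refl, Category.id_comp]

/-- The functor from cones to subequalizing pairs. -/
def toSubeqFunctor (F : StrictPseudofunctor Del D) (X : D) :
    ConeCat Wl F X ⥤ SubeqCat (monadOf F) X where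
  obj l := (toAlg (ofCone l)).toSubeq
  map {l l'} ν := SubeqCat.Hom.mk (x := (toAlg (ofCone l)).toSubeq)
    (y := (toAlg (ofCone l')).toSubeq) (cell ν Del.star ⟨0⟩)
    (ξ_comm (L := ofCone l) (L' := ofCone l') (τ := cell ν Del.star)
      (cell_naturality ν PiL.counit) (cell_act ν ⟨1⟩ ⟨0⟩))
  map_id _ := rfl
  map_comp _ _ := rfl

/-- The equivariant natural transformation given by a morphism of algebras. -/
def algTrans {x y : Alg F X} (τ : x.U ⟶ y.U) (h : x.ξ ≫ τ = τ ▷ pw F ⟨1⟩ ≫ y.ξ) :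
    x.functor ⟶ y.functor where
  app k := τ ▷ pw F (PiL.ord k)
  naturality _ _ f := Alg.cellMap_naturality h f

/-- The functor from subequalizing pairs to cones. -/
def ofSubeqFunctor (F : StrictPseudofunctor Del D) (X : D) :
    SubeqCat (monadOf F) X ⥤ ConeCat Wl F X where
  obj x := toCone (ofAlg (Alg.ofSubeq x))
  map {x y} f := homMk (L := ofAlg (Alg.ofSubeq x)) (L' := ofAlg (Alg.ofSubeq y))
    (algTrans (x := Alg.ofSubeq x) (y := Alg.ofSubeq y) (SubeqCat.cell f) (SubeqCat.cell_comm f))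
    (Alg.whiskerRight_ord_act (x := Alg.ofSubeq x) (y := Alg.ofSubeq y) (SubeqCat.cell f))
  map_id x := by
    refine hom_ext ?_
    rintro ⟨⟩ k
    exact id_whiskerRight _ _
  map_comp f g := by
    refine hom_ext ?_
    rintro ⟨⟩ k
    exact comp_whiskerRight _ _ _

theorem toSubeqFunctor_comp_obj (l : ConeCat Wl F X) :
    toCone (ofAlg (Alg.ofSubeq (toAlg (ofCone l)).toSubeq)) = l :=
  (congrArg toCone (ofAlg_toAlg (ofCone l))).trans (toCone_ofCone l)

theorem ofSubeqFunctor_comp_obj (x : SubeqCat (monadOf F) X) :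
    (toAlg (ofCone (toCone (ofAlg (Alg.ofSubeq x))))).toSubeq = x :=
  congrArg Alg.toSubeq (Alg.toAlg_ofAlg (Alg.ofSubeq x))

theorem eq_conj {k k' l l' : ConeCat Wl F X} (e : k = k') (ν : k ⟶ l) (ν' : k' ⟶ l') (e' : l' = l)
    (h : ∀ x, cell ν Del.star x = eqToHom (by rw [e]) ≫ cell ν' Del.star x ≫
      eqToHom (by rw [e'])) : ν = eqToHom e ≫ ν' ≫ eqToHom e' := by
  refine hom_ext ?_
  rintro ⟨⟩ x
  rw [cell_conj]
  exact h x

theorem toSubeqFunctor_comp (F : StrictPseudofunctor Del D) (X : D) :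
    toSubeqFunctor F X ⋙ ofSubeqFunctor F X = 𝟭 _ :=
  CategoryTheory.Functor.ext toSubeqFunctor_comp_obj fun l l' ν => by
    refine eq_conj (toSubeqFunctor_comp_obj l) _ _ (toSubeqFunctor_comp_obj l').symm fun k => ?_
    -- `PiL.act (PiL.ord k) ⟨0⟩` is `k` by definition, so this identifies the reconstructed
    -- component with the original one.
    have h : cell ν Del.star ⟨0⟩ ▷ pw F (PiL.ord k) =
        eqToHom ((ofCone l).obj_act (PiL.ord k) ⟨0⟩).symm ≫
          cell ν Del.star (PiL.act (PiL.ord k) ⟨0⟩) ≫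
            eqToHom ((ofCone l').obj_act (PiL.ord k) ⟨0⟩) :=
      conj_symm _ _ _ _ (cell_act ν (PiL.ord k) ⟨0⟩)
    exact h

theorem ofSubeqFunctor_comp (F : StrictPseudofunctor Del D) (X : D) :
    ofSubeqFunctor F X ⋙ toSubeqFunctor F X = 𝟭 _ :=
  CategoryTheory.Functor.ext ofSubeqFunctor_comp_obj fun x y f => by
    refine SubeqCat.eq_conj (ofSubeqFunctor_comp_obj x) _ _ (ofSubeqFunctor_comp_obj y).symm ?_
    have h : ∀ {U V : X ⟶ F.obj Del.star} (τ : U ⟶ V), τ ▷ pw F ⟨0⟩ =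
        eqToHom (comp_pw_zero F U) ≫ τ ≫ eqToHom (comp_pw_zero F V).symm := by
      intro U V τ
      rw [whiskerRight_conj τ (pw_zero F), whiskerRight_id_strict]
      simp
    exact h (SubeqCat.cell f)

/-- Precomposition with `G` whiskers every leg and cell of the cone, so the underlying 1-cells agree
definitionally; the structural 2-cells differ only in where the associativity identity is inserted.
-/
theorem toSubeq_coneMap {Y : D} (G : X ⟶ Y) (l : ConeCat Wl F Y) :
    (toAlg (ofCone ((coneMap Wl F G).obj l))).toSubeq =
      SubeqCat.pre G (toAlg (ofCone l)).toSubeq := by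
  refine SubeqCat.obj_ext rfl ?_
  have h : ∀ {U V : Y ⟶ F.obj Del.star} (e : U ≫ pw F ⟨1⟩ = V) (e' : (G ≫ U) ≫ pw F ⟨1⟩ = G ≫ V)
      (x : V ⟶ U), (eqToHom e' ≫ G ◁ x) ≫ 𝟙 (G ≫ U) =
        𝟙 (G ≫ U) ▷ pw F ⟨1⟩ ≫ (α_ G U (pw F ⟨1⟩)).hom ≫ G ◁ (eqToHom e ≫ x) := by
    intro U V e e' x
    subst e
    simp [Strict.associator_eqToIso]
  exact h ((ofCone l).obj_act ⟨1⟩ ⟨0⟩).symm _ _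

/-- The 2-natural transformation from `Cone_{W_l}(𝐓)` to `Subeq_T`. -/
def toSubeqTwoNat (F : StrictPseudofunctor Del D) : TwoNat (Cone Wl F) (Subeq (monadOf F)) where
  app X := toSubeqFunctor F X.unop
  naturality {X Y} G := CategoryTheory.Functor.ext (fun l => toSubeq_coneMap G.unop l)
    fun l l' ν => by
      refine SubeqCat.eq_conj (toSubeq_coneMap G.unop l) _ _ (toSubeq_coneMap G.unop l').symm ?_
      exact ((Category.id_comp _).trans (Category.comp_id _)).symm
  naturality₂ {X Y G H} β := by
    ext l
    refine Eq.trans ?_ (conj_app _ _ _ _).symm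
    refine SubeqCat.eq_conj (toSubeq_coneMap G.unop l) _ _ (toSubeq_coneMap H.unop l).symm ?_
    exact ((Category.id_comp _).trans (Category.comp_id _)).symm

/-- The 2-natural isomorphism between `Cone_{W_l}(𝐓)` and `Subeq_T`. -/
def isoSubeq (F : StrictPseudofunctor Del D) : TwoNatIso (Cone Wl F) (Subeq (monadOf F)) :=
  TwoNatIso.ofComponents (toSubeqTwoNat F) (fun X => ofSubeqFunctor F X.unop)
    (fun X => toSubeqFunctor_comp F X.unop) (fun X => ofSubeqFunctor_comp F X.unop)

end ConeCat

end EilenbergMoore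

/-! ### The theorem -/

theorem mainTheorem1 {D : Type u} [Bicategory.{w, v} D] [Bicategory.Strict D]
    (T : EilenbergMoore.Mnd D) :
    (∃ F : StrictPseudofunctor EilenbergMoore.Del D, EilenbergMoore.monadOf F = T) ∧
    ∀ F : StrictPseudofunctor EilenbergMoore.Del D, EilenbergMoore.monadOf F = T →
      (EilenbergMoore.AdmitsEMObject T ↔
        EilenbergMoore.HasWeightedLimit EilenbergMoore.Wl F) ∧
      (∀ E L : D, EilenbergMoore.IsEMObject T E →
        EilenbergMoore.IsWeightedLimit EilenbergMoore.Wl F L → Nonempty (E ≅ L)) ∧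
      Nonempty (EilenbergMoore.TwoNatIso (EilenbergMoore.Cone EilenbergMoore.Wl F)
        (EilenbergMoore.Subeq T)) ∧
      Nonempty (EilenbergMoore.TwoNatIso (EilenbergMoore.Subeq T)
        (EilenbergMoore.MndIota T)) := by
  refine ⟨⟨T.functor, T.monadOf_functor⟩, ?_⟩
  rintro F rfl
  let e := EilenbergMoore.ConeCat.isoSubeq F
  let e' := EilenbergMoore.SubeqCat.isoMnd (EilenbergMoore.monadOf F)
  refine ⟨⟨?_, ?_⟩, ?_, ⟨e⟩, ⟨e'⟩⟩
  · rintro ⟨E, ⟨r⟩⟩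
    exact ⟨E, ⟨(r.trans e'.symm).trans e.symm⟩⟩
  · rintro ⟨L, ⟨r⟩⟩
    exact ⟨L, ⟨(r.trans e).trans e'⟩⟩
  · rintro E L ⟨r⟩ ⟨s⟩
    -- Through `e` and `e'`, both `E` and `L` represent `Mnd(ι(-), T)`, so Yoneda applies.
    exact ⟨(r.trans ((s.trans e).trans e').symm).isoOfRepresented⟩
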